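/- Let $d$ be a natural number and let $\omega:[0,\infty)\to[0,\infty)$ be a weight function, that is, a continuous increasing function with $\omega\equiv 0$ on $[0,1]$, $\omega(2t)=O(\omega(t))$, $\omega(t)=O(t)$ and $\log t=o(\omega(t))$ as $t\to\infty$, and such that $\psi(x):=\omega(e^x)$ is convex on $[0,\infty)$. Let $\psi^*(y)=\sup_{x\ge 0}(xy-\psi(x))$ be the Young conjugate of $\psi$. For $n\in\mathbb Z_+=\{1,2,\dots\}$ let $\mathcal D_{L^1,\omega,n}(\mathbb R^d)$ be the space of all $\varphi\in C^\infty(\mathbb R^d)$ with $\varphi^{(\alpha)}\in L^1(\mathbb R^d)$ for all $\alpha\in\mathbb N^d$ and $$\|\varphi\|_{\mathcal D_{L^1,\omega,n}}:=\sup_{\alpha\in\mathbb N^d}\|\varphi^{(\alpha)}\|_{L^1}\exp\left(-\tfrac1n\psi^*(n|\alpha|)\right)<\infty,$$ let $\mathcal D_{L^1,\{\omega\}}(\mathbb R^d)=\varinjlim_n\mathcal D_{L^1,\omega,n}(\mathbb R^d)$ (inductive limit of locally convex spaces), and let $\mathcal B'_{\{\omega\}}(\mathbb R^d)$ be its dual,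 endowed with the strong topology. Let $C_{b,\{\omega\}}(\mathbb R^{2d})$ be the space of all continuous $F:\mathbb R^{2d}\to\mathbb C$ with $$\sup_{(x,\xi)\in\mathbb R^{2d}}|F(x,\xi)|\exp\left(-\tfrac1n\omega(|\xi|)\right)<\infty\qquad\text{for all } n\in\mathbb Z_+,$$ with the topology given by these norms. Let $\mathcal S^{(1)}_{(1)}(\mathbb R^d)$ be the space of all $\varphi\in C^\infty(\mathbb R^d)$ with $\sup_{\alpha,x}n^{|\alpha|}|\varphi^{(\alpha)}(x)|e^{n|x|}/|\alpha|!<\infty$ for all $n\in\mathbb N$, with the topology given by these norms, and let $\mathcal S'^{(1)}_{(1)}(\mathbb R^d)$ be its dual. Since $\mathcal S^{(1)}_{(1)}(\mathbb R^d)$ is densely and continuously included in $\mathcal D_{L^1,\{\omega\}}(\mathbb R^d)$, the space $\mathcal B'_{\{\omega\}}(\mathbb R^d)$ is regarded, by restriction of functionals, as a subspace of $\mathcal S'^{(1)}_{(1)}(\mathbb R^d)$. Write $(f,g)_{L^2}=\int_{\mathbb R^d}f(t)\overline{g(t)}\,dt$, $T_xf(t)=f(t-x)$ and $M_\xi f(t)=e^{2\pi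 i\xi\cdot t}f(t)$. For $\chi\in\mathcal S^{(1)}_{(1)}(\mathbb R^d)$, the short-time Fourier transform of $f\in\mathcal S'^{(1)}_{(1)}(\mathbb R^d)$ is $V_\chi f(x,\xi)=\langle f,\overline{M_\xi T_x\chi}\rangle$; for $\varphi\in\mathcal S^{(1)}_{(1)}(\mathbb R^d)$ it is $V_\chi\varphi(x,\xi)=(\varphi,M_\xi T_x\chi)_{L^2}$. The adjoint short-time Fourier transform of $F\in C_{b,\{\omega\}}(\mathbb R^{2d})$ is the functional $V_\chi^*F$ on $\mathcal S^{(1)}_{(1)}(\mathbb R^d)$ given by $$\langle V^*_\chi F,\varphi\rangle=\iint_{\mathbb R^{2d}}F(x,\xi)\,\overline{V_\chi\overline{\varphi}(x,\xi)}\,dx\,d\xi,\qquad\varphi\in\mathcal S^{(1)}_{(1)}(\mathbb R^d).$$ **Proposition.** Let $\chi\in\mathcal S^{(1)}_{(1)}(\mathbb R^d)$. The linear mappings $$V_\chi:\mathcal B'_{\{\omega\}}(\mathbb R^d)\to C_{b,\{\omega\}}(\mathbb R^{2d})\qquad\text{and}\qquad V_\chi^*:C_{b,\{\omega\}}(\mathbb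 R^{2d})\to\mathcal B'_{\{\omega\}}(\mathbb R^d)$$ are well-defined and continuous. That is: $V_\chi f\in C_{b,\{\omega\}}(\mathbb R^{2d})$ for every $f\in\mathcal B'_{\{\omega\}}(\mathbb R^d)$; for every $F\in C_{b,\{\omega\}}(\mathbb R^{2d})$ the integrals defining $V^*_\chi F$ converge absolutely and $V_\chi^*F$ is the restriction to $\mathcal S^{(1)}_{(1)}(\mathbb R^d)$ of a unique element of $\mathcal B'_{\{\omega\}}(\mathbb R^d)$, again denoted by $V^*_\chi F$; and both mappings are continuous. Moreover, if $\gamma\in\mathcal S^{(1)}_{(1)}(\mathbb R^d)$ is a synthesis window for $\chi$, that is, $(\gamma,\chi)_{L^2}\neq0$, then $$\frac1{(\gamma,\chi)_{L^2}}V^*_\gamma\circ V_\chi=\operatorname{id}_{\mathcal B'_{\{\omega\}}(\mathbb R^d)}.$$ -/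

import Mathlib

open Filter Topology MeasureTheory Set
open scoped ComplexConjugate

noncomputable section

namespace BoundedUltra

/-- The Euclidean space `ℝ^d`. -/
abbrev E (d : ℕ) := EuclideanSpace ℝ (Fin d)

/-- The partial derivative `∂φ/∂x_i`. -/
def pderiv {d : ℕ} (i : Fin d) (φ : E d → ℂ) : E d → ℂ :=
  fun x => fderiv ℝ φ x (EuclideanSpace.single i 1)

/-- The partial derivative `φ^{(α)} = ∂_1^{α_1} ⋯ ∂_d^{α_d} φ` for a multi-index `α ∈ ℕ^d`. -/
def mderiv {d : ℕ} (α : Fin d → ℕ) (φ : E d → ℂ) : E d → ℂ :=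
  (List.finRange d).foldr (fun i g => (pderiv i)^[α i] g) φ

/-- Iterated partial derivatives along a list of coordinates. -/
def pdList {d : ℕ} (l : List (Fin d)) (φ : E d → ℂ) : E d → ℂ := l.foldr pderiv φ

section Derivatives

open scoped ContDiff

variable {d : ℕ}

theorem contDiff_pderiv {φ : E d → ℂ} (h : ContDiff ℝ ∞ φ) (i : Fin d) :
    ContDiff ℝ ∞ (pderiv i φ) := by
  have : ContDiff ℝ ∞ (fderiv ℝ φ) := h.fderiv_right (by simp)
  exact this.clm_apply contDiff_const

theorem contDiff_pdList {φ : E d → ℂ} (h : ContDiff ℝ ∞ φ) (l : List (Fin d)) :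
    ContDiff ℝ ∞ (pdList l φ) := by
  induction l with
  | nil => exact h
  | cons i l ih => exact contDiff_pderiv ih i

theorem pdList_append (l l' : List (Fin d)) (φ : E d → ℂ) :
    pdList (l ++ l') φ = pdList l (pdList l' φ) := by
  simp [pdList]

theorem pdList_replicate (n : ℕ) (i : Fin d) (φ : E d → ℂ) :
    pdList (List.replicate n i) φ = (pderiv i)^[n] φ := by
  induction n with
  | zero => rfl
  | succ n ih =>
    rw [Function.iterate_succ_apply', ← ih, List.replicate_succ]; rfl

/-- The list that contains the coordinate `i` exactly `α i` times, in increasing order. -/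
def wordOf (α : Fin d → ℕ) : List (Fin d) :=
  (List.finRange d).flatMap fun i => List.replicate (α i) i

theorem mderiv_eq (α : Fin d → ℕ) (φ : E d → ℂ) : mderiv α φ = pdList (wordOf α) φ := by
  unfold mderiv wordOf
  induction List.finRange d with
  | nil => rfl
  | cons i l ih => rw [List.foldr_cons, ih, List.flatMap_cons, pdList_append, pdList_replicate]

theorem length_wordOf (α : Fin d → ℕ) : (wordOf α).length = ∑ i, α i := by
  simp [wordOf, List.length_flatMap, Fin.sum_univ_def]

theorem count_wordOf (α : Fin d → ℕ) (j : Fin d) : (wordOf α).count j = α j := by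
  rw [wordOf, List.count_flatMap]
  have h : (List.count j ∘ fun i => List.replicate (α i) i) = fun i => if i = j then α j else 0 := by
    funext i
    by_cases hij : i = j
    · subst hij; simp
    · simp [List.count_replicate, hij]
  rw [h, ← Fin.sum_univ_def]
  simp

theorem contDiff_mderiv {φ : E d → ℂ} (h : ContDiff ℝ ∞ φ) (α : Fin d → ℕ) :
    ContDiff ℝ ∞ (mderiv α φ) := by
  rw [mderiv_eq]; exact contDiff_pdList h _

theorem pderiv_add {φ ψ : E d → ℂ} (hφ : ContDiff ℝ ∞ φ) (hψ : ContDiff ℝ ∞ ψ) (i : Fin d) :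
    pderiv i (φ + ψ) = pderiv i φ + pderiv i ψ := by
  funext x
  simp [pderiv, fderiv_add (hφ.differentiable (by simp) x) (hψ.differentiable (by simp) x)]

theorem pderiv_smul {φ : E d → ℂ} (hφ : ContDiff ℝ ∞ φ) (c : ℂ) (i : Fin d) :
    pderiv i (c • φ) = c • pderiv i φ := by
  funext x
  simp [pderiv, fderiv_const_smul (hφ.differentiable (by simp) x) c]

theorem mderiv_add {φ ψ : E d → ℂ} (hφ : ContDiff ℝ ∞ φ) (hψ : ContDiff ℝ ∞ ψ) (α : Fin d → ℕ) :
    mderiv α (φ + ψ) = mderiv α φ + mderiv α ψ := by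
  simp only [mderiv_eq]
  induction wordOf α with
  | nil => rfl
  | cons i l ih =>
    change pderiv i (pdList l (φ + ψ)) = pderiv i (pdList l φ) + pderiv i (pdList l ψ)
    rw [ih, pderiv_add (contDiff_pdList hφ l) (contDiff_pdList hψ l)]

theorem mderiv_smul {φ : E d → ℂ} (hφ : ContDiff ℝ ∞ φ) (c : ℂ) (α : Fin d → ℕ) :
    mderiv α (c • φ) = c • mderiv α φ := by
  simp only [mderiv_eq]
  induction wordOf α with
  | nil => rfl
  | cons i l ih =>
    change pderiv i (pdList l (c • φ)) = c • pderiv i (pdList l φ)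
    rw [ih, pderiv_smul (contDiff_pdList hφ l)]

theorem pderiv_comm {φ : E d → ℂ} (hφ : ContDiff ℝ ∞ φ) (i j : Fin d) :
    pderiv i (pderiv j φ) = pderiv j (pderiv i φ) := by
  have hd : Differentiable ℝ (fderiv ℝ φ) :=
    (hφ.fderiv_right (m := ∞) (by simp)).differentiable (by simp)
  have key : ∀ (a b : Fin d) (x : E d), pderiv a (pderiv b φ) x =
      fderiv ℝ (fderiv ℝ φ) x (EuclideanSpace.single a 1) (EuclideanSpace.single b 1) := by
    intro a b x
    change fderiv ℝ (fun y => fderiv ℝ φ y (EuclideanSpace.single b 1)) x _ = _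
    rw [fderiv_clm_apply (hd x) (differentiableAt_const _)]
    simp
  funext x
  rw [key, key]
  exact (hφ.contDiffAt.isSymmSndFDerivAt (by simpa using (WithTop.coe_le_coe.2 le_top : ((2 : ℕ∞) : WithTop ℕ∞) ≤ _))).eq _ _

theorem pdList_perm {φ : E d → ℂ} (hφ : ContDiff ℝ ∞ φ) {l l' : List (Fin d)} (h : l.Perm l') :
    pdList l φ = pdList l' φ := by
  induction h with
  | nil => rfl
  | cons i _ ih => exact congrArg (pderiv i) ih
  | swap i j l => exact pderiv_comm (contDiff_pdList hφ l) _ _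
  | trans _ _ ih ih' => exact ih.trans ih'

theorem pdList_eq_mderiv {φ : E d → ℂ} (hφ : ContDiff ℝ ∞ φ) (l : List (Fin d)) :
    pdList l φ = mderiv (fun i => l.count i) φ := by
  rw [mderiv_eq]
  refine pdList_perm hφ (List.perm_iff_count.2 fun j => ?_)
  rw [count_wordOf]

theorem iteratedFDeriv_eq_pdList {φ : E d → ℂ} (hφ : ContDiff ℝ ∞ φ) {m : ℕ} (w : Fin m → Fin d)
    (x : E d) : iteratedFDeriv ℝ m φ x (fun k => EuclideanSpace.single (w k) 1) =
      pdList (List.ofFn w) φ x := by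
  induction m generalizing x with
  | zero => simp [pdList]
  | succ m ih =>
    rw [iteratedFDeriv_succ_apply_left, List.ofFn_succ]
    change _ = fderiv ℝ (pdList (List.ofFn fun i => w i.succ) φ) x (EuclideanSpace.single (w 0) 1)
    have : pdList (List.ofFn fun i : Fin m => w i.succ) φ = fun y => iteratedFDeriv ℝ m φ y
        (fun k => EuclideanSpace.single (w k.succ) 1) := by
      funext y; rw [ih]
    rw [this]
    have hd : DifferentiableAt ℝ (iteratedFDeriv ℝ m φ) x :=
      hφ.differentiable_iteratedFDeriv (by exact_mod_cast WithTop.coe_lt_top _) x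
    rw [fderiv_continuousMultilinear_apply_const_apply hd]
    rfl

theorem norm_mderiv_le {φ : E d → ℂ} (hφ : ContDiff ℝ ∞ φ) (α : Fin d → ℕ) (x : E d) :
    ‖mderiv α φ x‖ ≤ ‖iteratedFDeriv ℝ (∑ i, α i) φ x‖ := by
  rw [mderiv_eq, ← length_wordOf]
  have h := iteratedFDeriv_eq_pdList hφ (fun k => (wordOf α).get k) x
  rw [List.ofFn_get] at h
  rw [← h]
  refine (ContinuousMultilinearMap.le_opNorm _ _).trans ?_
  simp

theorem norm_iteratedFDeriv_le {φ : E d → ℂ} (hφ : ContDiff ℝ ∞ φ) (m : ℕ) (x : E d) {B : ℝ}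
    (hB0 : 0 ≤ B) (hB : ∀ α : Fin d → ℕ, ∑ i, α i = m → ‖mderiv α φ x‖ ≤ B) :
    ‖iteratedFDeriv ℝ m φ x‖ ≤ (d : ℝ) ^ m * B := by
  refine ContinuousMultilinearMap.opNorm_le_bound (by positivity) fun v => ?_
  have hv : v = fun k => ∑ i, (v k i) • (EuclideanSpace.single i (1 : ℝ) : E d) := by
    funext k
    ext j
    simp [Finset.sum_apply, Pi.single_apply]
  conv_lhs => rw [hv]
  rw [ContinuousMultilinearMap.map_sum]
  refine (norm_sum_le _ _).trans ?_
  have : ∀ w : Fin m → Fin d, ‖iteratedFDeriv ℝ m φ x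
      (fun k => (v k (w k)) • (EuclideanSpace.single (w k) (1 : ℝ) : E d))‖ ≤ B * ∏ k, ‖v k‖ := by
    intro w
    rw [ContinuousMultilinearMap.map_smul_univ, norm_smul, iteratedFDeriv_eq_pdList hφ,
      pdList_eq_mderiv hφ, norm_prod, mul_comm]
    refine mul_le_mul (hB _ ?_) (Finset.prod_le_prod (fun _ _ => norm_nonneg _)
      fun k _ => PiLp.norm_apply_le (v k) (w k)) (by positivity) hB0
    have := List.sum_toFinset_count_eq_length (List.ofFn w)
    rw [List.length_ofFn] at this
    conv_rhs => rw [← this]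
    symm
    refine Finset.sum_subset (Finset.subset_univ _) fun j _ hj => ?_
    simpa [List.count_eq_zero] using hj
  refine (Finset.sum_le_sum fun w _ => this w).trans ?_
  simp [mul_assoc]

end Derivatives

section Seminorms

variable {X : Type*} [AddCommGroup X] [Module ℂ X]

/-- The pointwise supremum of a pointwise bounded family of seminorms. -/
def supSeminorm {ι : Type*} (p : ι → Seminorm ℂ X) (h : ∀ φ, BddAbove (range fun i => p i φ)) :
    Seminorm ℂ X :=
  Seminorm.of (fun φ => ⨆ i, p i φ)
    (fun φ ψ => by
      rcases isEmpty_or_nonempty ι with hι | hι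
      · simp
      · exact ciSup_le fun i => (map_add_le_add (p i) φ ψ).trans
          (add_le_add (le_ciSup (h φ) i) (le_ciSup (h ψ) i)))
    (fun c φ => by
      simp only [map_smul_eq_mul]
      rw [Real.mul_iSup_of_nonneg (norm_nonneg c)])

end Seminorms

/-- Weight functions. Only the values on `[0, ∞)` matter. -/
structure IsWeightFunction (ω : ℝ → ℝ) : Prop where
  continuousOn : ContinuousOn ω (Ici 0)
  monotoneOn : MonotoneOn ω (Ici 0)
  eq_zero : ∀ t ∈ Icc (0 : ℝ) 1, ω t = 0
  alpha : (fun t => ω (2 * t)) =O[atTop] ω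
  beta : ω =O[atTop] fun t : ℝ => t
  gamma : Real.log =o[atTop] ω
  delta : ConvexOn ℝ (Ici 0) fun x => ω (Real.exp x)

/-- The Young conjugate `ψ*(y) = sup_{x ≥ 0} (x y - ψ(x))` of `ψ(x) = ω(e^x)`. -/
def youngConj (ω : ℝ → ℝ) (y : ℝ) : ℝ :=
  sSup ((fun x => x * y - ω (Real.exp x)) '' Ici 0)

/-- The weight `exp(-ψ*(n k)/n)`. -/
def expWeight (ω : ℝ → ℝ) (n : ℕ+) (k : ℕ) : ℝ :=
  Real.exp (-(1 / (n : ℝ) * youngConj ω ((n : ℝ) * k)))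

theorem expWeight_nonneg (ω : ℝ → ℝ) (n : ℕ+) (k : ℕ) : 0 ≤ expWeight ω n k :=
  (Real.exp_pos _).le

/-! ### The spaces `D_{L¹,ω,n}` and `D_{L¹,{ω}}` -/

/-- The functions `φ ∈ C^∞(ℝ^d)` all of whose derivatives are integrable and such that
`sup_α ‖φ^{(α)}‖_{L¹} exp(-ψ*(n|α|)/n) < ∞`. -/
def stepSubmodule (ω : ℝ → ℝ) (d : ℕ) (n : ℕ+) : Submodule ℂ (E d → ℂ) where
  carrier := {φ | ContDiff ℝ (⊤ : ℕ∞) φ ∧ (∀ α, Integrable (mderiv α φ)) ∧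
    BddAbove (range fun α : Fin d → ℕ => (∫ x, ‖mderiv α φ x‖) * expWeight ω n (∑ i, α i))}
  zero_mem' := by
    have h0 : ∀ α : Fin d → ℕ, mderiv α (0 : E d → ℂ) = 0 := fun α => by
      simpa using mderiv_smul (φ := (0 : E d → ℂ)) contDiff_const 0 α
    refine ⟨contDiff_const, fun α => by rw [h0]; exact integrable_zero _ _ _, 0, ?_⟩
    rintro _ ⟨α, rfl⟩
    simp [h0]
  add_mem' := by
    rintro φ ψ ⟨hφ, hφi, A, hA⟩ ⟨hψ, hψi, B, hB⟩
    refine ⟨hφ.add hψ, fun α => by rw [mderiv_add hφ hψ]; exact (hφi α).add (hψi α), A + B, ?_⟩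
    rintro _ ⟨α, rfl⟩
    refine le_trans ?_ (add_le_add (hA ⟨α, rfl⟩) (hB ⟨α, rfl⟩))
    simp only [mderiv_add hφ hψ]
    rw [← add_mul, ← integral_add (hφi α).norm (hψi α).norm]
    exact mul_le_mul_of_nonneg_right (integral_mono ((hφi α).add (hψi α)).norm
      ((hφi α).norm.add (hψi α).norm) fun x => norm_add_le _ _) (expWeight_nonneg _ _ _)
  smul_mem' := by
    rintro c φ ⟨hφ, hφi, A, hA⟩
    refine ⟨contDiff_const.smul hφ, fun α => by rw [mderiv_smul hφ]; exact (hφi α).smul c,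
      ‖c‖ * A, ?_⟩
    rintro _ ⟨α, rfl⟩
    refine le_trans (le_of_eq ?_) (mul_le_mul_of_nonneg_left (hA ⟨α, rfl⟩) (norm_nonneg c))
    simp only [mderiv_smul hφ, Pi.smul_apply, norm_smul, integral_const_mul, mul_assoc]

/-- The space `D_{L¹,ω,n}(ℝ^d)`. -/
def StepSpace (ω : ℝ → ℝ) (d : ℕ) (n : ℕ+) : Type := stepSubmodule ω d n

namespace StepSpace

variable {ω : ℝ → ℝ} {d : ℕ} {n : ℕ+}

instance : AddCommGroup (StepSpace ω d n) := inferInstanceAs (AddCommGroup (stepSubmodule ω d n))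

instance : Module ℂ (StepSpace ω d n) := inferInstanceAs (Module ℂ (stepSubmodule ω d n))

/-- The norm `‖φ‖ = sup_α ‖φ^{(α)}‖_{L¹} exp(-ψ*(n|α|)/n)`. -/
def seminorm (ω : ℝ → ℝ) (d : ℕ) (n : ℕ+) : Seminorm ℂ (StepSpace ω d n) :=
  supSeminorm (ι := Fin d → ℕ)
    (fun α => Seminorm.of (fun φ => (∫ x, ‖mderiv α φ.1 x‖) * expWeight ω n (∑ i, α i))
      (fun φ ψ => by
        change (∫ x, ‖mderiv α (φ.1 + ψ.1) x‖) * _ ≤ _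
        rw [mderiv_add φ.2.1 ψ.2.1, ← add_mul,
          ← integral_add (φ.2.2.1 α).norm (ψ.2.2.1 α).norm]
        exact mul_le_mul_of_nonneg_right (integral_mono ((φ.2.2.1 α).add (ψ.2.2.1 α)).norm
          ((φ.2.2.1 α).norm.add (ψ.2.2.1 α).norm) fun x => norm_add_le _ _)
          (expWeight_nonneg _ _ _))
      (fun c φ => by
        change (∫ x, ‖mderiv α (c • φ.1) x‖) * _ = _
        simp only [mderiv_smul φ.2.1, Pi.smul_apply, norm_smul, integral_const_mul, mul_assoc]))
    (fun φ => φ.2.2.2)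

/-- The topology of the normed space `D_{L¹,ω,n}(ℝ^d)`. -/
instance : TopologicalSpace (StepSpace ω d n) :=
  SeminormFamily.moduleFilterBasis (𝕜 := ℂ) (fun _ : Unit => seminorm ω d n) |>.topology

theorem withSeminorms : WithSeminorms (fun _ : Unit => seminorm ω d n) := ⟨rfl⟩

end StepSpace

/-- The union of the increasing sequence of spaces `D_{L¹,ω,n}(ℝ^d)`, `n ≥ 1`. -/
def unionSubmodule (ω : ℝ → ℝ) (d : ℕ) : Submodule ℂ (E d → ℂ) := ⨆ n : ℕ+, stepSubmodule ω d n

/-- The space `D_{L¹,{ω}}(ℝ^d)`, the inductive limit of the spaces `D_{L¹,ω,n}(ℝ^d)`. -/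
def DSpace (ω : ℝ → ℝ) (d : ℕ) : Type := unionSubmodule ω d

namespace DSpace

variable {ω : ℝ → ℝ} {d : ℕ}

instance : AddCommGroup (DSpace ω d) := inferInstanceAs (AddCommGroup (unionSubmodule ω d))

instance : Module ℂ (DSpace ω d) := inferInstanceAs (Module ℂ (unionSubmodule ω d))

/-- The inclusion of `D_{L¹,ω,n}(ℝ^d)` into `D_{L¹,{ω}}(ℝ^d)`. -/
def ofStep (ω : ℝ → ℝ) (d : ℕ) (n : ℕ+) : StepSpace ω d n →ₗ[ℂ] DSpace ω d :=
  Submodule.inclusion (le_iSup (stepSubmodule ω d) n)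

/-- The inductive limit topology in the category of locally convex spaces: the finest locally
convex vector space topology for which all the inclusions `D_{L¹,ω,n} → D_{L¹,{ω}}` are
continuous. -/
instance : TopologicalSpace (DSpace ω d) :=
  sInf {t : TopologicalSpace (DSpace ω d) |
    (∀ n : ℕ+, @Continuous _ _ _ t (ofStep ω d n)) ∧
    @IsTopologicalAddGroup (DSpace ω d) t _ ∧
    @ContinuousSMul ℂ (DSpace ω d) _ _ t ∧
    @LocallyConvexSpace ℝ (DSpace ω d) _ _ _ _ t}

theorem continuous_ofStep (n : ℕ+) : Continuous (ofStep ω d n) :=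
  continuous_sInf_rng.2 fun _ ht => ht.1 n

instance : IsTopologicalAddGroup (DSpace ω d) := topologicalAddGroup_sInf fun _ ht => ht.2.1

instance : ContinuousSMul ℂ (DSpace ω d) := continuousSMul_sInf fun _ ht => ht.2.2.1

instance : LocallyConvexSpace ℝ (DSpace ω d) := .sInf fun _ ht => ht.2.2.2

end DSpace

/-- The space `B'_{{ω}}(ℝ^d)`, the topological dual of `D_{L¹,{ω}}(ℝ^d)`. As everywhere for spaces
of continuous linear maps in Mathlib, its topology is the strong one, that is, the topology of
uniform convergence on bounded sets. -/
abbrev BDual (ω : ℝ → ℝ) (d : ℕ) : Type := DSpace ω d →L[ℂ] ℂ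

/-! ### The space `S^{(1)}_{(1)}` and its dual -/

/-- The functions `φ ∈ C^∞(ℝ^d)` such that
`sup_{α,x} n^{|α|} |φ^{(α)}(x)| e^{n|x|} / |α|! < ∞` for all `n ∈ ℕ`. -/
def sSubmodule (d : ℕ) : Submodule ℂ (E d → ℂ) where
  carrier := {φ | ContDiff ℝ (⊤ : ℕ∞) φ ∧ ∀ n : ℕ, BddAbove (range fun p : (Fin d → ℕ) × E d =>
    (n : ℝ) ^ (∑ i, p.1 i) * ‖mderiv p.1 φ p.2‖ * Real.exp (n * ‖p.2‖) / (∑ i, p.1 i).factorial)}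
  zero_mem' := by
    have h0 : ∀ α : Fin d → ℕ, mderiv α (0 : E d → ℂ) = 0 := fun α => by
      simpa using mderiv_smul (φ := (0 : E d → ℂ)) contDiff_const 0 α
    refine ⟨contDiff_const, fun n => ⟨0, ?_⟩⟩
    rintro _ ⟨p, rfl⟩
    simp [h0]
  add_mem' := by
    rintro φ ψ ⟨hφ, hφb⟩ ⟨hψ, hψb⟩
    refine ⟨hφ.add hψ, fun n => ?_⟩
    obtain ⟨A, hA⟩ := hφb n
    obtain ⟨B, hB⟩ := hψb n
    refine ⟨A + B, ?_⟩
    rintro _ ⟨p, rfl⟩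
    refine le_trans ?_ (add_le_add (hA ⟨p, rfl⟩) (hB ⟨p, rfl⟩))
    simp only [mderiv_add hφ hψ, Pi.add_apply]
    rw [← add_div, ← add_mul, ← mul_add]
    gcongr
    exact norm_add_le _ _
  smul_mem' := by
    rintro c φ ⟨hφ, hφb⟩
    refine ⟨contDiff_const.smul hφ, fun n => ?_⟩
    obtain ⟨A, hA⟩ := hφb n
    refine ⟨‖c‖ * A, ?_⟩
    rintro _ ⟨p, rfl⟩
    refine le_trans (le_of_eq ?_) (mul_le_mul_of_nonneg_left (hA ⟨p, rfl⟩) (norm_nonneg c))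
    simp only [mderiv_smul hφ, Pi.smul_apply, norm_smul]
    ring

/-- The space `S^{(1)}_{(1)}(ℝ^d)`. -/
def SSpace (d : ℕ) : Type := sSubmodule d

namespace SSpace

variable {d : ℕ}

instance : AddCommGroup (SSpace d) := inferInstanceAs (AddCommGroup (sSubmodule d))

instance : Module ℂ (SSpace d) := inferInstanceAs (Module ℂ (sSubmodule d))

instance : CoeFun (SSpace d) fun _ => E d → ℂ := ⟨fun φ => φ.1⟩

/-- The norm `‖φ‖_n = sup_{α,x} n^{|α|} |φ^{(α)}(x)| e^{n|x|} / |α|!`. -/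
def seminorm (d : ℕ) (n : ℕ) : Seminorm ℂ (SSpace d) :=
  supSeminorm (ι := (Fin d → ℕ) × E d)
    (fun p => Seminorm.of (fun φ => (n : ℝ) ^ (∑ i, p.1 i) * ‖mderiv p.1 φ.1 p.2‖ *
        Real.exp (n * ‖p.2‖) / (∑ i, p.1 i).factorial)
      (fun φ ψ => by
        change _ * ‖mderiv p.1 (φ.1 + ψ.1) p.2‖ * _ / _ ≤ _
        rw [mderiv_add φ.2.1 ψ.2.1, ← add_div, ← add_mul, ← mul_add]
        gcongr
        exact norm_add_le _ _)
      (fun c φ => by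
        change _ * ‖mderiv p.1 (c • φ.1) p.2‖ * _ / _ = _
        simp only [mderiv_smul φ.2.1, Pi.smul_apply, norm_smul]
        ring))
    (fun φ => φ.2.2 n)

/-- The topology of `S^{(1)}_{(1)}(ℝ^d)`, given by the norms `‖·‖_n`, `n ∈ ℕ`. -/
instance : TopologicalSpace (SSpace d) :=
  SeminormFamily.moduleFilterBasis (𝕜 := ℂ) (fun n : ℕ => seminorm d n) |>.topology

theorem withSeminorms : WithSeminorms (fun n : ℕ => seminorm d n) := ⟨rfl⟩

end SSpace

/-- The space `S'^{(1)}_{(1)}(ℝ^d)` of Fourier ultrahyperfunctions. -/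
abbrev SDual (d : ℕ) : Type := SSpace d →L[ℂ] ℂ

/-! ### The space `C_{b,{ω}}` -/

/-- The continuous functions `F` on `ℝ^{2d} = ℝ^d × ℝ^d` such that
`sup_{(x,ξ)} |F(x,ξ)| exp(-ω(|ξ|)/n) < ∞` for all `n ≥ 1`. -/
def cbSubmodule (ω : ℝ → ℝ) (d : ℕ) : Submodule ℂ (E d × E d → ℂ) where
  carrier := {F | Continuous F ∧ ∀ n : ℕ+, BddAbove (range fun z : E d × E d =>
    ‖F z‖ * Real.exp (-(1 / (n : ℝ) * ω ‖z.2‖)))}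
  zero_mem' := by
    refine ⟨continuous_const, fun n => ⟨0, ?_⟩⟩
    rintro _ ⟨p, rfl⟩
    simp
  add_mem' := by
    rintro F G ⟨hF, hFb⟩ ⟨hG, hGb⟩
    refine ⟨hF.add hG, fun n => ?_⟩
    obtain ⟨A, hA⟩ := hFb n
    obtain ⟨B, hB⟩ := hGb n
    refine ⟨A + B, ?_⟩
    rintro _ ⟨p, rfl⟩
    refine le_trans ?_ (add_le_add (hA ⟨p, rfl⟩) (hB ⟨p, rfl⟩))
    simp only [Pi.add_apply]
    rw [← add_mul]
    gcongr
    exact norm_add_le _ _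
  smul_mem' := by
    rintro c F ⟨hF, hFb⟩
    refine ⟨hF.const_smul c, fun n => ?_⟩
    obtain ⟨A, hA⟩ := hFb n
    refine ⟨‖c‖ * A, ?_⟩
    rintro _ ⟨p, rfl⟩
    refine le_trans (le_of_eq ?_) (mul_le_mul_of_nonneg_left (hA ⟨p, rfl⟩) (norm_nonneg c))
    simp only [Pi.smul_apply, norm_smul, mul_assoc]

/-- The space `C_{b,{ω}}(ℝ^{2d})`. -/
def CbSpace (ω : ℝ → ℝ) (d : ℕ) : Type := cbSubmodule ω d

namespace CbSpace

variable {ω : ℝ → ℝ} {d : ℕ}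

instance : AddCommGroup (CbSpace ω d) := inferInstanceAs (AddCommGroup (cbSubmodule ω d))

instance : Module ℂ (CbSpace ω d) := inferInstanceAs (Module ℂ (cbSubmodule ω d))

instance : CoeFun (CbSpace ω d) fun _ => E d × E d → ℂ := ⟨fun F => F.1⟩

/-- The norm `‖F‖_n = sup_{(x,ξ)} |F(x,ξ)| exp(-ω(|ξ|)/n)`. -/
def seminorm (ω : ℝ → ℝ) (d : ℕ) (n : ℕ+) : Seminorm ℂ (CbSpace ω d) :=
  supSeminorm (ι := E d × E d)
    (fun z => Seminorm.of (fun F => ‖F.1 z‖ * Real.exp (-(1 / (n : ℝ) * ω ‖z.2‖)))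
      (fun F G => by
        change ‖F.1 z + G.1 z‖ * _ ≤ _
        rw [← add_mul]
        gcongr
        exact norm_add_le _ _)
      (fun c F => by
        change ‖c • F.1 z‖ * _ = _
        rw [norm_smul, mul_assoc]))
    (fun F => F.2.2 n)

/-- The topology of `C_{b,{ω}}(ℝ^{2d})`, given by the norms `‖·‖_n`, `n ≥ 1`. -/
instance : TopologicalSpace (CbSpace ω d) :=
  SeminormFamily.moduleFilterBasis (𝕜 := ℂ) (fun n : ℕ+ => seminorm ω d n) |>.topology

theorem withSeminorms : WithSeminorms (fun n : ℕ+ => seminorm ω d n) := ⟨rfl⟩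

end CbSpace

/-! ### Translations, modulations and the inclusion `S^{(1)}_{(1)} ⊆ D_{L¹,{ω}}` -/

section Membership

variable {d : ℕ}

/-- Membership in `S^{(1)}_{(1)}` in terms of the norms of the Fréchet derivatives. -/
theorem mem_sSubmodule_iff (φ : E d → ℂ) :
    φ ∈ sSubmodule d ↔ ContDiff ℝ (⊤ : ℕ∞) φ ∧ ∀ n : ℕ, ∃ C : ℝ, ∀ (m : ℕ) (x : E d),
      (n : ℝ) ^ m * ‖iteratedFDeriv ℝ m φ x‖ * Real.exp (n * ‖x‖) ≤ C * m.factorial := by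
  constructor
  · rintro ⟨hφ, h⟩
    refine ⟨hφ, fun n => ?_⟩
    obtain ⟨C, hC⟩ := h ((n + 1) * (d + 1))
    set N : ℕ := (n + 1) * (d + 1) with hN
    have hNpos : (0 : ℝ) < N := by positivity
    have hC0 : 0 ≤ C := le_trans (by positivity) (hC ⟨(0, 0), rfl⟩)
    have hnN : (n : ℝ) ≤ N := by
      rw [hN]; push_cast; nlinarith [n.cast_nonneg (α := ℝ), d.cast_nonneg (α := ℝ)]
    have hndN : (n : ℝ) * d ≤ N := by
      rw [hN]; push_cast; nlinarith [n.cast_nonneg (α := ℝ), d.cast_nonneg (α := ℝ)]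
    refine ⟨C, fun m x => ?_⟩
    have hb := norm_iteratedFDeriv_le hφ m x
      (B := C * m.factorial / ((N : ℝ) ^ m * Real.exp (N * ‖x‖))) (by positivity) (by
        intro α hα
        have := hC ⟨(α, x), rfl⟩
        simp only [hα] at this
        rw [div_le_iff₀ (by positivity)] at this
        rw [le_div_iff₀ (by positivity)]
        linarith)
    calc (n : ℝ) ^ m * ‖iteratedFDeriv ℝ m φ x‖ * Real.exp (n * ‖x‖)
        ≤ (n : ℝ) ^ m * ((d : ℝ) ^ m * (C * m.factorial / ((N : ℝ) ^ m * Real.exp (N * ‖x‖)))) *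
          Real.exp (N * ‖x‖) := by gcongr
      _ = ((n : ℝ) * d) ^ m / (N : ℝ) ^ m * (C * m.factorial) := by
          rw [mul_pow]; field_simp
      _ ≤ 1 * (C * m.factorial) := by
          gcongr
          exact div_le_one_of_le₀ (by gcongr) (by positivity)
      _ = C * m.factorial := one_mul _
  · rintro ⟨hφ, h⟩
    refine ⟨hφ, fun n => ?_⟩
    obtain ⟨C, hC⟩ := h n
    refine ⟨C, ?_⟩
    rintro _ ⟨⟨α, x⟩, rfl⟩
    simp only
    rw [div_le_iff₀ (by positivity)]
    refine le_trans ?_ (hC _ x)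
    gcongr
    exact norm_mderiv_le hφ α x

/-- The translation operator `T_x f(t) = f(t - x)`. -/
def translate (x : E d) (f : E d → ℂ) : E d → ℂ := fun t => f (t - x)

/-- The modulation operator `M_ξ f(t) = e^{2πi ξ·t} f(t)`. -/
def modulate (ξ : E d) (f : E d → ℂ) : E d → ℂ :=
  fun t => Complex.exp (2 * Real.pi * Complex.I * (inner ℝ ξ t : ℝ)) * f t

theorem translate_mem_sSubmodule {φ : E d → ℂ} (hφ : φ ∈ sSubmodule d) (x : E d) :
    translate x φ ∈ sSubmodule d := by
  rw [mem_sSubmodule_iff] at hφ ⊢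
  refine ⟨hφ.1.comp (contDiff_id.sub contDiff_const), fun n => ?_⟩
  obtain ⟨C, hC⟩ := hφ.2 n
  refine ⟨C * Real.exp (n * ‖x‖), fun m t => ?_⟩
  unfold translate
  rw [iteratedFDeriv_comp_sub]
  have h1 : Real.exp (n * ‖t‖) ≤ Real.exp (n * ‖t - x‖) * Real.exp (n * ‖x‖) := by
    rw [← Real.exp_add, ← mul_add]
    gcongr
    simpa using norm_add_le (t - x) x
  calc _ ≤ (n : ℝ) ^ m * ‖iteratedFDeriv ℝ m φ (t - x)‖ *
        (Real.exp (n * ‖t - x‖) * Real.exp (n * ‖x‖)) := by gcongr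
    _ = ((n : ℝ) ^ m * ‖iteratedFDeriv ℝ m φ (t - x)‖ * Real.exp (n * ‖t - x‖)) *
        Real.exp (n * ‖x‖) := by ring
    _ ≤ (C * m.factorial) * Real.exp (n * ‖x‖) :=
        mul_le_mul_of_nonneg_right (hC m _) (Real.exp_pos _).le
    _ = _ := by ring

theorem conj_mem_sSubmodule {φ : E d → ℂ} (hφ : φ ∈ sSubmodule d) :
    (fun t => conj (φ t)) ∈ sSubmodule d := by
  rw [mem_sSubmodule_iff] at hφ ⊢
  refine ⟨Complex.conjLIE.contDiff.comp hφ.1, fun n => ?_⟩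
  obtain ⟨C, hC⟩ := hφ.2 n
  refine ⟨C, fun m t => ?_⟩
  have : ‖iteratedFDeriv ℝ m (fun t => conj (φ t)) t‖ = ‖iteratedFDeriv ℝ m φ t‖ :=
    Complex.conjLIE.norm_iteratedFDeriv_comp_left φ t m
  rw [this]
  exact hC m t

theorem mul_mem_sSubmodule {w φ : E d → ℂ} (hw : ContDiff ℝ (⊤ : ℕ∞) w) {R : ℝ} (hR : 0 ≤ R)
    (hwR : ∀ (i : ℕ) (t : E d), ‖iteratedFDeriv ℝ i w t‖ ≤ R ^ i) (hφ : φ ∈ sSubmodule d) :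
    (fun t => w t * φ t) ∈ sSubmodule d := by
  rw [mem_sSubmodule_iff] at hφ ⊢
  refine ⟨hw.mul hφ.1, fun n => ?_⟩
  obtain ⟨C, hC⟩ := hφ.2 (n + 1)
  set N : ℕ := n + 1 with hN
  have hNpos : (0 : ℝ) < N := by positivity
  have hnN : (n : ℝ) ≤ N := by rw [hN]; push_cast; linarith
  have hC0 : 0 ≤ C := by
    have := hC 0 0
    have h2 : (0 : ℝ) ≤ C * ((0 : ℕ).factorial : ℕ) := le_trans (by positivity) this
    simpa using h2
  refine ⟨C * Real.exp (R * N), fun m t => ?_⟩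
  have hL := norm_iteratedFDeriv_mul_le hw hφ.1 t (n := m)
    (by exact_mod_cast (WithTop.coe_lt_coe.2 (ENat.natCast_lt_top m)).le)
  calc (n : ℝ) ^ m * ‖iteratedFDeriv ℝ m (fun t => w t * φ t) t‖ * Real.exp (n * ‖t‖)
      ≤ (N : ℝ) ^ m * (∑ i ∈ Finset.range (m + 1), (m.choose i : ℝ) *
        ‖iteratedFDeriv ℝ i w t‖ * ‖iteratedFDeriv ℝ (m - i) φ t‖) * Real.exp (N * ‖t‖) := by
        gcongr
    _ = ∑ i ∈ Finset.range (m + 1), (m.choose i : ℝ) * ((N : ℝ) ^ i *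
        ‖iteratedFDeriv ℝ i w t‖) * ((N : ℝ) ^ (m - i) *
          ‖iteratedFDeriv ℝ (m - i) φ t‖ * Real.exp (N * ‖t‖)) := by
        rw [Finset.mul_sum, Finset.sum_mul]
        refine Finset.sum_congr rfl fun i hi => ?_
        have hi' : i ≤ m := Nat.lt_succ_iff.1 (Finset.mem_range.1 hi)
        conv_lhs => rw [← Nat.add_sub_cancel' hi', pow_add]
        rw [Nat.add_sub_cancel' hi']
        ring
    _ ≤ ∑ i ∈ Finset.range (m + 1), (m.choose i : ℝ) * ((N : ℝ) ^ i * R ^ i) *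
        (C * (m - i).factorial) := by
        refine Finset.sum_le_sum fun i _ => mul_le_mul ?_ (hC _ _) (by positivity) (by positivity)
        exact mul_le_mul_of_nonneg_left (mul_le_mul_of_nonneg_left (hwR i t) (by positivity))
          (by positivity)
    _ = C * m.factorial * ∑ i ∈ Finset.range (m + 1), (R * N) ^ i / i.factorial := by
        rw [Finset.mul_sum]
        refine Finset.sum_congr rfl fun i hi => ?_
        have hi' : i ≤ m := Nat.lt_succ_iff.1 (Finset.mem_range.1 hi)
        have h := Nat.choose_mul_factorial_mul_factorial hi'
        rw [← h]
        push_cast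
        rw [mul_pow]
        field_simp
    _ ≤ C * m.factorial * Real.exp (R * N) := by
        gcongr
        exact Real.sum_le_exp_of_nonneg (by positivity) _
    _ = _ := by ring

theorem modulate_mem_sSubmodule {φ : E d → ℂ} (hφ : φ ∈ sSubmodule d) (ξ : E d) :
    modulate ξ φ ∈ sSubmodule d := by
  let c : ℂ := 2 * Real.pi * Complex.I
  let g : ℝ → ℂ := fun s => Complex.exp (c * s)
  have hg : ContDiff ℝ (⊤ : ℕ∞) g :=
    Complex.contDiff_exp.comp (contDiff_const.mul Complex.ofRealCLM.contDiff)
  have hgn : ∀ (i : ℕ) (s : ℝ), iteratedDeriv i g s = c ^ i * g s := by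
    intro i
    induction i with
    | zero => intro s; simp
    | succ i ih =>
      intro s
      rw [iteratedDeriv_succ, funext ih]
      have h1 : HasDerivAt (fun s : ℝ => c * (s : ℂ)) c s := by
        simpa using (Complex.ofRealCLM.hasDerivAt (x := s)).const_mul c
      have h2 : HasDerivAt g (Complex.exp (c * s) * c) s := h1.cexp
      rw [(h2.const_mul (c ^ i)).deriv, pow_succ]
      simp only [g]
      ring
  have hgnorm : ∀ s : ℝ, ‖g s‖ = 1 := by
    intro s
    have : c * s = ((2 * Real.pi * s : ℝ) : ℂ) * Complex.I := by
      simp only [c]; push_cast; ring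
    simp only [g]
    rw [this, Complex.norm_exp_ofReal_mul_I]
  refine mul_mem_sSubmodule (w := fun t => g ((innerSL ℝ ξ) t)) (R := ‖c‖ * ‖innerSL ℝ ξ‖)
    (hg.comp (innerSL ℝ ξ).contDiff) (by positivity) (fun i t => ?_) hφ
  have := (innerSL ℝ ξ).iteratedFDeriv_comp_right hg t (i := i)
    (by exact_mod_cast (WithTop.coe_lt_coe.2 (ENat.natCast_lt_top i)).le)
  change ‖iteratedFDeriv ℝ i (g ∘ (innerSL ℝ ξ)) t‖ ≤ _
  rw [this]
  refine (ContinuousMultilinearMap.norm_compContinuousLinearMap_le _ _).trans ?_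
  rw [norm_iteratedFDeriv_eq_norm_iteratedDeriv, hgn, norm_mul, hgnorm, norm_pow, mul_pow]
  simp

theorem bddAbove_young {ω : ℝ → ℝ} (hω : IsWeightFunction ω) (y : ℝ) :
    BddAbove ((fun x => x * y - ω (Real.exp x)) '' Ici 0) := by
  have hω0 : ∀ x : ℝ, 0 ≤ ω (Real.exp x) := fun x => by
    have := hω.monotoneOn (self_mem_Ici) (Real.exp_pos x).le (Real.exp_pos x).le
    rwa [hω.eq_zero 0 (by simp)] at this
  have h := hω.gamma.def (c := 1 / (|y| + 1)) (by positivity)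
  obtain ⟨X, hX⟩ := eventually_atTop.1 (Real.tendsto_exp_atTop.eventually h)
  refine ⟨|X| * |y|, ?_⟩
  rintro _ ⟨x, hx, rfl⟩
  have hx0 : 0 ≤ x := hx
  have hxy : x * y ≤ x * |y| := mul_le_mul_of_nonneg_left (le_abs_self y) hx0
  change x * y - ω (Real.exp x) ≤ _
  rcases le_total X x with hXx | hXx
  · have h1 := hX x hXx
    rw [Real.log_exp, Real.norm_of_nonneg hx0, Real.norm_of_nonneg (hω0 x), div_mul_eq_mul_div,
      one_mul, le_div_iff₀ (by positivity)] at h1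
    have : 0 ≤ |X| * |y| := by positivity
    nlinarith
  · have : x * |y| ≤ |X| * |y| :=
      mul_le_mul_of_nonneg_right (hXx.trans (le_abs_self X)) (abs_nonneg y)
    linarith [hω0 x]

theorem expWeight_anti {ω : ℝ → ℝ} (hω : IsWeightFunction ω) {n m : ℕ+} (h : n ≤ m) (k : ℕ) :
    expWeight ω m k ≤ expWeight ω n k := by
  have hω0 : ∀ x : ℝ, 0 ≤ ω (Real.exp x) := fun x => by
    have := hω.monotoneOn (self_mem_Ici) (Real.exp_pos x).le (Real.exp_pos x).le
    rwa [hω.eq_zero 0 (by simp)] at this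
  have hn : (0 : ℝ) < n := by exact_mod_cast n.pos
  have hm : (0 : ℝ) < m := by exact_mod_cast m.pos
  have hnm : (n : ℝ) ≤ m := by exact_mod_cast h
  refine Real.exp_le_exp.2 (neg_le_neg ?_)
  rw [one_div_mul_eq_div, div_le_iff₀ hn]
  refine csSup_le (Set.image_nonempty.2 nonempty_Ici) ?_
  rintro _ ⟨x, hx, rfl⟩
  have h1 : x * (m * k) - ω (Real.exp x) ≤ youngConj ω (m * k) :=
    le_csSup (bddAbove_young hω _) ⟨x, hx, rfl⟩
  have h2 : ω (Real.exp x) / m ≤ ω (Real.exp x) / n := by gcongr; exact hω0 x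
  have h3 : x * k - ω (Real.exp x) / m ≤ 1 / m * youngConj ω (m * k) := by
    calc _ = 1 / m * (x * (m * k) - ω (Real.exp x)) := by field_simp
      _ ≤ _ := by gcongr
  calc x * (n * k) - ω (Real.exp x) = (x * k - ω (Real.exp x) / n) * n := by field_simp
    _ ≤ (x * k - ω (Real.exp x) / m) * n := by gcongr
    _ ≤ _ := by gcongr

theorem stepSubmodule_mono {ω : ℝ → ℝ} (hω : IsWeightFunction ω) (d : ℕ) :
    Monotone (stepSubmodule ω d) := by
  rintro n m h φ ⟨hφ, hφi, A, hA⟩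
  refine ⟨hφ, hφi, A, ?_⟩
  rintro _ ⟨α, rfl⟩
  exact (mul_le_mul_of_nonneg_left (expWeight_anti hω h _)
    (integral_nonneg fun _ => norm_nonneg _)).trans (hA ⟨α, rfl⟩)

/-- As a set, `D_{L¹,{ω}}(ℝ^d)` is the union of the spaces `D_{L¹,ω,n}(ℝ^d)`. -/
theorem mem_unionSubmodule_iff {ω : ℝ → ℝ} (hω : IsWeightFunction ω) (φ : E d → ℂ) :
    φ ∈ unionSubmodule ω d ↔ ∃ n : ℕ+, φ ∈ stepSubmodule ω d n :=
  Submodule.mem_iSup_of_directed _ (stepSubmodule_mono hω d).directed_le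

/-- The weight `exp(-ψ*(k))` beats `k!` up to a geometric factor. -/
theorem exists_expWeight_mul_factorial_le {ω : ℝ → ℝ} (hω : IsWeightFunction ω) :
    ∃ (C : ℝ) (N : ℕ), 0 ≤ C ∧ 1 ≤ N ∧ ∀ k : ℕ, expWeight ω 1 k * k.factorial ≤ C * (N : ℝ) ^ k := by
  obtain ⟨A, hA0, hA⟩ := hω.beta.exists_pos
  obtain ⟨T, hT⟩ := eventually_atTop.1 hA.bound
  have hlin : ∀ t : ℝ, 0 ≤ t → ω t ≤ A * t + ω (max T 0) := by
    intro t ht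
    have hm0 : 0 ≤ ω (max T 0) := by
      have := hω.monotoneOn (self_mem_Ici) (le_max_right T 0) (le_max_right T 0)
      rwa [hω.eq_zero 0 (by simp)] at this
    rcases le_total T t with h | h
    · have := (le_abs_self _).trans (hT t h)
      rw [Real.norm_of_nonneg ht] at this
      linarith
    · have := hω.monotoneOn ht (le_max_right T 0) (h.trans (le_max_left T 0))
      have : 0 ≤ A * t := by positivity
      linarith
  obtain ⟨N, hN⟩ := exists_nat_ge (Real.exp A)
  have hN1 : 1 ≤ N := by
    have : (1 : ℝ) ≤ N := (Real.one_le_exp hA0.le).trans hN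
    exact_mod_cast this
  refine ⟨Real.exp (ω (max T 0)), N, (Real.exp_pos _).le, hN1, fun k => ?_⟩
  have key : ∀ x : ℝ, 0 ≤ x → x * k - ω (Real.exp x) ≤ youngConj ω k := fun x hx =>
    le_csSup (bddAbove_young hω k) ⟨x, hx, rfl⟩
  rcases Nat.eq_zero_or_pos k with rfl | hk
  · have h0 := key 0 le_rfl
    rw [hω.eq_zero _ (by simp)] at h0
    have hm0 : 0 ≤ ω (max T 0) := by
      have := hω.monotoneOn (self_mem_Ici) (le_max_right T 0) (le_max_right T 0)
      rwa [hω.eq_zero 0 (by simp)] at this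
    simp only [expWeight, Nat.factorial_zero, Nat.cast_one, mul_one, pow_zero]
    refine Real.exp_le_exp.2 ?_
    simp at h0 ⊢
    linarith
  · have hk0 : (0 : ℝ) < k := by exact_mod_cast hk
    have h1 := key (Real.log k) (Real.log_natCast_nonneg k)
    rw [Real.exp_log hk0] at h1
    have h2 := hlin k hk0.le
    have h3 : expWeight ω 1 k ≤ Real.exp (ω (max T 0)) * Real.exp A ^ k / (k : ℝ) ^ k := by
      rw [le_div_iff₀ (by positivity), expWeight, ← Real.exp_nat_mul, ← Real.exp_add]
      conv_lhs => rw [← Real.exp_log (pow_pos hk0 k), Real.log_pow, ← Real.exp_add]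
      refine Real.exp_le_exp.2 ?_
      simp only [PNat.one_coe, Nat.cast_one, div_one, one_mul]
      linarith
    calc expWeight ω 1 k * k.factorial ≤ (Real.exp (ω (max T 0)) * Real.exp A ^ k / (k : ℝ) ^ k) *
          (k : ℝ) ^ k := by
          gcongr
          exact_mod_cast Nat.factorial_le_pow k
      _ = Real.exp (ω (max T 0)) * Real.exp A ^ k := by field_simp
      _ ≤ _ := by gcongr

theorem integrable_exp_neg (d : ℕ) : Integrable fun x : E d => Real.exp (-((d + 1 : ℕ) * ‖x‖)) := by
  have h := integrable_one_add_norm (E := E d) (μ := volume) (r := ((d + 1 : ℕ) : ℝ)) (by simp)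
  refine h.mono' (by fun_prop) (Eventually.of_forall fun x => ?_)
  have hx : 0 < 1 + ‖x‖ := by positivity
  rw [Real.norm_of_nonneg (Real.exp_pos _).le, Real.rpow_neg hx.le, Real.rpow_natCast, Real.exp_neg,
    Real.exp_nat_mul]
  gcongr
  rw [add_comm]
  exact Real.add_one_le_exp _

/-- The inclusion of `S^{(1)}_{(1)}` into `D_{L¹,ω,1}` with a norm estimate. -/
theorem exists_step_bound {ω : ℝ → ℝ} (hω : IsWeightFunction ω) (d : ℕ) :
    ∃ (M : ℕ) (C : ℝ), 0 ≤ C ∧ ∀ φ : SSpace d, ∀ α : Fin d → ℕ, Integrable (mderiv α φ.1) ∧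
      (∫ x, ‖mderiv α φ.1 x‖) * expWeight ω 1 (∑ i, α i) ≤ C * SSpace.seminorm d M φ := by
  obtain ⟨C, N, hC, hN, hCN⟩ := exists_expWeight_mul_factorial_le hω
  set M : ℕ := N * (d + 1) with hM
  have hM0 : (0 : ℝ) < M := by
    have : 0 < M := by positivity
    exact_mod_cast this
  have hNM : (N : ℝ) ≤ M := by exact_mod_cast Nat.le_mul_of_pos_right N (Nat.succ_pos d)
  have hdM : ((d + 1 : ℕ) : ℝ) ≤ M := by exact_mod_cast Nat.le_mul_of_pos_left (d + 1) hN
  set I : ℝ := ∫ x : E d, Real.exp (-((d + 1 : ℕ) * ‖x‖)) with hI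
  have hI0 : 0 ≤ I := integral_nonneg fun _ => (Real.exp_pos _).le
  refine ⟨M, C * I, by positivity, fun φ α => ?_⟩
  set k := ∑ i, α i with hk
  set P := SSpace.seminorm d M φ with hP
  have hP0 : 0 ≤ P := apply_nonneg _ _
  have hpt : ∀ x, ‖mderiv α φ.1 x‖ ≤ P * k.factorial / (M : ℝ) ^ k * Real.exp (-((d + 1 : ℕ) * ‖x‖)) := by
    intro x
    have h1 : (M : ℝ) ^ k * ‖mderiv α φ.1 x‖ * Real.exp (M * ‖x‖) / k.factorial ≤ P :=
      le_ciSup (φ.2.2 M) (α, x)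
    rw [div_le_iff₀ (by positivity)] at h1
    have h2 : Real.exp ((d + 1 : ℕ) * ‖x‖) ≤ Real.exp (M * ‖x‖) := by gcongr
    rw [Real.exp_neg, ← div_eq_mul_inv, div_div, le_div_iff₀ (by positivity)]
    calc _ = (M : ℝ) ^ k * ‖mderiv α φ.1 x‖ * Real.exp ((d + 1 : ℕ) * ‖x‖) := by ring
      _ ≤ _ := by gcongr
      _ ≤ _ := h1
  have hint : Integrable (mderiv α φ.1) :=
    ((integrable_exp_neg d).const_mul _).mono'
      (contDiff_mderiv φ.2.1 α).continuous.aestronglyMeasurable (Eventually.of_forall hpt)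
  refine ⟨hint, ?_⟩
  have hle : (∫ x, ‖mderiv α φ.1 x‖) ≤ P * k.factorial / (M : ℝ) ^ k * I := by
    rw [hI, ← integral_const_mul]
    exact integral_mono hint.norm ((integrable_exp_neg d).const_mul _) hpt
  calc _ ≤ (P * k.factorial / (M : ℝ) ^ k * I) * expWeight ω 1 k := by
        gcongr; exact expWeight_nonneg _ _ _
    _ = (expWeight ω 1 k * k.factorial) * (P * I / (M : ℝ) ^ k) := by ring
    _ ≤ (C * (N : ℝ) ^ k) * (P * I / (M : ℝ) ^ k) :=
        mul_le_mul_of_nonneg_right (hCN k) (by positivity)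
    _ ≤ (C * (M : ℝ) ^ k) * (P * I / (M : ℝ) ^ k) := by gcongr
    _ = C * I * P := by field_simp

theorem sSubmodule_le_step {ω : ℝ → ℝ} (hω : IsWeightFunction ω) (d : ℕ) :
    sSubmodule d ≤ stepSubmodule ω d 1 := by
  obtain ⟨M, C, -, h⟩ := exists_step_bound hω d
  intro φ hφ
  refine ⟨hφ.1, fun α => (h ⟨φ, hφ⟩ α).1, C * SSpace.seminorm d M ⟨φ, hφ⟩, ?_⟩
  rintro _ ⟨α, rfl⟩
  exact (h ⟨φ, hφ⟩ α).2

/-- The continuous inclusion `S^{(1)}_{(1)}(ℝ^d) → D_{L¹,{ω}}(ℝ^d)`, `φ ↦ φ`. -/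
def sInclusion {ω : ℝ → ℝ} (hω : IsWeightFunction ω) (d : ℕ) : SSpace d →L[ℂ] DSpace ω d where
  toLinearMap := (DSpace.ofStep ω d 1).comp
    (Submodule.inclusion (sSubmodule_le_step hω d) : SSpace d →ₗ[ℂ] StepSpace ω d 1)
  cont := by
    refine (DSpace.continuous_ofStep 1).comp ?_
    refine WithSeminorms.continuous_of_isBounded SSpace.withSeminorms StepSpace.withSeminorms _ ?_
    obtain ⟨M, C, hC, h⟩ := exists_step_bound hω d
    refine fun _ => ⟨{M}, ⟨C, hC⟩, fun φ => ?_⟩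
    rw [Finset.sup_singleton]
    exact ciSup_le fun α => (h φ α).2

theorem sInclusion_val {ω : ℝ → ℝ} (hω : IsWeightFunction ω) (d : ℕ) (φ : SSpace d) :
    (sInclusion hω d φ).1 = φ.1 := rfl

end Membership

/-- The restriction of `f ∈ B'_{{ω}}(ℝ^d)` to `S^{(1)}_{(1)}(ℝ^d)`, by which `B'_{{ω}}(ℝ^d)` is
viewed as a subspace of `S'^{(1)}_{(1)}(ℝ^d)`. -/
def toSDual {ω : ℝ → ℝ} (hω : IsWeightFunction ω) {d : ℕ} (f : BDual ω d) : SDual d :=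
  f.comp (sInclusion hω d)

/-! ### The short-time Fourier transform -/

/-- The inner product `(f, g)_{L²} = ∫ f(t) conj(g(t)) dt`. -/
def innerL2 {d : ℕ} (f g : E d → ℂ) : ℂ := ∫ t, f t * conj (g t)

/-- The short-time Fourier transform `V_χ φ(x, ξ) = (φ, M_ξ T_x χ)_{L²}` of a function `φ`. -/
def stftFun {d : ℕ} (χ φ : E d → ℂ) : E d × E d → ℂ :=
  fun z => innerL2 φ (modulate z.2 (translate z.1 χ))

/-- The test function `conj(M_ξ T_x χ)`. -/
def conjShift {d : ℕ} (χ : SSpace d) (x ξ : E d) : SSpace d :=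
  ⟨fun t => conj (modulate ξ (translate x χ) t),
    conj_mem_sSubmodule (modulate_mem_sSubmodule (translate_mem_sSubmodule χ.2 x) ξ)⟩

/-- The short-time Fourier transform `V_χ f(x, ξ) = ⟨f, conj(M_ξ T_x χ)⟩` of `f ∈ S'^{(1)}_{(1)}`. -/
def stft {d : ℕ} (χ : SSpace d) (f : SDual d) : E d × E d → ℂ :=
  fun z => f (conjShift χ z.1 z.2)

/-- The integrand of `⟨F, conj(V_χ(conj φ))⟩ = ∫∫ F(x, ξ) conj(V_χ(conj φ)(x, ξ)) dx dξ`, for a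
function `F` on `ℝ^{2d}` and a test function `φ`. -/
def adjIntegrand {d : ℕ} (χ : SSpace d) (F : E d × E d → ℂ) (φ : SSpace d) : E d × E d → ℂ :=
  fun z => F z * conj (stftFun χ (fun t => conj (φ t)) z)

/-- The Fourier ultrahyperfunction `u` is the adjoint short-time Fourier transform `V*_χ F` of the
function `F` on `ℝ^{2d}`: `⟨u, φ⟩ = ⟨F, conj(V_χ(conj φ))⟩` for all `φ ∈ S^{(1)}_{(1)}(ℝ^d)`, where
`F` acts by integration and all the integrals converge absolutely. -/
def IsAdjointSTFT {d : ℕ} (χ : SSpace d) (F : E d × E d → ℂ) (u : SDual d) : Prop :=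
  ∀ φ : SSpace d, Integrable (adjIntegrand χ F φ) ∧ u φ = ∫ z, adjIntegrand χ F φ z

end BoundedUltra

end

open BoundedUltra

noncomputable section

namespace BoundedUltra

/-! ### Weight functions and Young conjugates -/

section Weights

variable {ω : ℝ → ℝ}

/-! The Young conjugate ψ* turns bounds on derivatives into decay in frequency and back. Write g(k)
= exp(ψ*(nk)/n) for the weights of the n-th step (`growth`). Young's inequality gives s^k ≤
e^{ω(s)/n} g(k) (`IsWeightFunction.pow_le_growth`). Conversely, s^k J ≤ B g(k) for all k forces J ≤
B(1+s)e^{-ω(s)/n}, by the best choice of k (`IsWeightFunction.le_of_pow_mul_le_growth`).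
Superadditivity of ψ* absorbs the product rule, and the doubling condition absorbs dilations of the
argument of ω at the price of a larger step index.

Transform. For every m there is a step in which the norm of M_ξ T_x χ is O(e^{ω(|ξ|)/m}), uniformly
in x, and in which this shift depends continuously on (x, ξ) (`exists_seminorm_atomS_le`,
`exists_continuous_toStep_atomS`). Applying f gives V_χ f ∈ C_{b,{ω}}. The shifts multiplied by
e^{-ω(|ξ|)/m} form a bounded set, so the m-th norm of V_χ f is the supremum of |f| over a bounded
set, hence continuous for the strong topology.

Adjoint. For φ in a step, integration by parts bounds |ξ_j|^k ∫ |V(x,ξ)| dx by the weights, where V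
is the transform of φ. The converse Young estimate then makes V integrable against e^{ω(|ξ|)/m} for
some m (`exists_lintegral_pairing_le`). Integration against V therefore defines V*F on each step and
is continuous in F for each φ. Uniformity over a bounded set of φ follows from Banach–Steinhaus on
the Fréchet space C_{b,{ω}}; it need not be known that bounded sets of the inductive limit lie in
one step.

Reconstruction. Tested against a compactly supported smooth function, the formula for φ is Parseval
in ξ followed by integration in x (`integral_pairing_mul_integral_mul_conjShift`), and derivatives
can be moved onto the test function. A step embeds isometrically in ℓ^∞(ℕ^d; L¹), where the integral
of the shifts of χ against V converges in Bochner's sense; the tested formula identifies it with (γ,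
χ)φ. The functional f extends from the step to this Banach space by Hahn–Banach and commutes with
the integral (`adjointSTFT_stftLin`).

Uniqueness. V_χ f sees only the restriction of f to test functions, so reconstruction with a
Gaussian window shows that this restriction determines f (`BDual.ext_of_toSDual_eq`). -/

theorem IsWeightFunction.nonneg (hω : IsWeightFunction ω) {t : ℝ} (ht : 0 ≤ t) : 0 ≤ ω t := by
  have := hω.monotoneOn self_mem_Ici ht ht
  rwa [hω.eq_zero 0 (by simp)] at this

theorem IsWeightFunction.le_youngConj (hω : IsWeightFunction ω) {x : ℝ} (hx : 0 ≤ x) (y : ℝ) :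
    x * y - ω (Real.exp x) ≤ youngConj ω y :=
  le_csSup (bddAbove_young hω y) ⟨x, hx, rfl⟩

theorem youngConj_le {y B : ℝ} (h : ∀ x, 0 ≤ x → x * y - ω (Real.exp x) ≤ B) :
    youngConj ω y ≤ B := by
  refine csSup_le (Set.image_nonempty.2 nonempty_Ici) ?_
  rintro _ ⟨x, hx, rfl⟩
  exact h x hx

theorem IsWeightFunction.youngConj_nonneg (hω : IsWeightFunction ω) (y : ℝ) :
    0 ≤ youngConj ω y := by
  have := hω.le_youngConj le_rfl y
  rwa [Real.exp_zero, hω.eq_zero 1 (by simp), zero_mul, sub_zero] at this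

theorem IsWeightFunction.youngConj_zero (hω : IsWeightFunction ω) : youngConj ω 0 = 0 := by
  refine le_antisymm (youngConj_le fun x _ => ?_) (hω.youngConj_nonneg 0)
  have := hω.nonneg (Real.exp_pos x).le
  linarith

theorem IsWeightFunction.youngConj_mono (hω : IsWeightFunction ω) : Monotone (youngConj ω) :=
  fun _ _ h => youngConj_le fun _ hx =>
    (sub_le_sub_right (mul_le_mul_of_nonneg_left h hx) _).trans (hω.le_youngConj hx _)

/-- The Young conjugate is superadditive. -/
theorem IsWeightFunction.youngConj_add_le (hω : IsWeightFunction ω) {a b : ℝ} (ha : 0 ≤ a)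
    (hb : 0 ≤ b) : youngConj ω a + youngConj ω b ≤ youngConj ω (a + b) := by
  rw [← le_sub_iff_add_le]
  refine youngConj_le fun x hx => ?_
  rw [le_sub_comm]
  refine youngConj_le fun y hy => ?_
  have hx' := hω.nonneg (Real.exp_pos x).le
  have hy' := hω.nonneg (Real.exp_pos y).le
  -- The larger of the two points is used for `a + b`; the value of ω at the other point is
  -- nonnegative and is dropped.
  rcases le_total x y with h | h
  · have := hω.le_youngConj hy (a + b)
    nlinarith
  · have := hω.le_youngConj hx (a + b)
    nlinarith

/-- A monotone convex function on `[0, ∞)` has a nonnegative subgradient at each `x > 0`. -/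
theorem ConvexOn.exists_subgradient {f : ℝ → ℝ} (hf : ConvexOn ℝ (Ici 0) f)
    (hm : MonotoneOn f (Ici 0)) {x : ℝ} (hx : 0 < x) :
    ∃ y, 0 ≤ y ∧ ∀ z, 0 ≤ z → f x + y * (z - x) ≤ f z := by
  -- The subgradient is the right derivative, the infimum of the slopes to the right of `x`. By
  -- convexity the slopes to the left lie below it.
  set S := (fun z => (f z - f x) / (z - x)) '' Ioi x with hS
  have hSne : S.Nonempty := Set.image_nonempty.2 nonempty_Ioi
  have hS0 : ∀ r ∈ S, 0 ≤ r := by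
    rintro _ ⟨z, hz, rfl⟩
    have hz : x < z := hz
    exact div_nonneg (sub_nonneg.2 (hm hx.le (hx.trans hz).le hz.le)) (sub_nonneg.2 hz.le)
  refine ⟨sInf S, le_csInf hSne hS0, fun z hz => ?_⟩
  rcases lt_trichotomy z x with h | rfl | h
  · have : (f x - f z) / (x - z) ≤ sInf S := by
      refine le_csInf hSne ?_
      rintro _ ⟨w, hw, rfl⟩
      exact hf.slope_mono_adjacent hz (hx.trans hw).le h hw
    rw [div_le_iff₀ (sub_pos.2 h)] at this
    linarith
  · simp
  · have : sInf S ≤ (f z - f x) / (z - x) := csInf_le ⟨0, hS0⟩ ⟨z, h, rfl⟩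
    rw [le_div_iff₀ (sub_pos.2 h)] at this
    linarith

/-- The weight `exp(ψ*(n k)/n)`. -/
def growth (ω : ℝ → ℝ) (n : ℕ+) (k : ℕ) : ℝ :=
  Real.exp (1 / (n : ℝ) * youngConj ω ((n : ℝ) * k))

theorem growth_pos (ω : ℝ → ℝ) (n : ℕ+) (k : ℕ) : 0 < growth ω n k := Real.exp_pos _

theorem expWeight_eq (ω : ℝ → ℝ) (n : ℕ+) (k : ℕ) : expWeight ω n k = (growth ω n k)⁻¹ := by
  rw [expWeight, growth, Real.exp_neg]

theorem mul_expWeight_le_iff {ω : ℝ → ℝ} {n : ℕ+} {k : ℕ} {a b : ℝ} :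
    a * expWeight ω n k ≤ b ↔ a ≤ b * growth ω n k := by
  rw [expWeight_eq, ← div_eq_mul_inv, div_le_iff₀ (growth_pos _ _ _)]

theorem IsWeightFunction.one_le_growth (hω : IsWeightFunction ω) (n : ℕ+) (k : ℕ) :
    1 ≤ growth ω n k :=
  Real.one_le_exp (mul_nonneg (by positivity) (hω.youngConj_nonneg _))

theorem IsWeightFunction.growth_zero (hω : IsWeightFunction ω) (n : ℕ+) : growth ω n 0 = 1 := by
  simp [growth, hω.youngConj_zero]

theorem IsWeightFunction.growth_mono (hω : IsWeightFunction ω) {n m : ℕ+} (h : n ≤ m) (k : ℕ) :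
    growth ω n k ≤ growth ω m k := by
  have := expWeight_anti hω h k
  rw [expWeight_eq, expWeight_eq] at this
  exact (inv_le_inv₀ (growth_pos _ _ _) (growth_pos _ _ _)).1 this

/-- Superadditivity of ψ*. It bounds a product of derivatives of orders `a` and `b` by the weight of
the total order. -/
theorem IsWeightFunction.growth_mul_le (hω : IsWeightFunction ω) (n : ℕ+) (a b : ℕ) :
    growth ω n a * growth ω n b ≤ growth ω n (a + b) := by
  rw [growth, growth, growth, ← Real.exp_add, ← mul_add]
  refine Real.exp_le_exp.2 (mul_le_mul_of_nonneg_left ?_ (by positivity))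
  rw [Nat.cast_add, mul_add]
  exact hω.youngConj_add_le (by positivity) (by positivity)

/-- For `s ≥ 1` this is Young's inequality at the point log s, divided by `n`; for `s ≤ 1` both
factors on the right are at least 1. -/
theorem IsWeightFunction.pow_le_growth (hω : IsWeightFunction ω) (n : ℕ+) (k : ℕ) {s : ℝ}
    (hs : 0 ≤ s) : s ^ k ≤ Real.exp (ω s / n) * growth ω n k := by
  have hn : (0 : ℝ) < n := by exact_mod_cast n.pos
  rcases le_total s 1 with h | h
  · refine (pow_le_one₀ hs h).trans ?_
    have h1 : 1 ≤ Real.exp (ω s / n) := Real.one_le_exp (div_nonneg (hω.nonneg hs) hn.le)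
    have h2 := hω.one_le_growth n k
    nlinarith
  · have hs0 : 0 < s := by linarith
    have := hω.le_youngConj (Real.log_nonneg h) (n * k)
    rw [Real.exp_log hs0] at this
    rw [growth, ← Real.exp_add]
    conv_lhs => rw [← Real.exp_log (pow_pos hs0 k), Real.log_pow]
    refine Real.exp_le_exp.2 ?_
    rw [one_div_mul_eq_div, ← add_div, le_div_iff₀ hn]
    linarith

/-- A quantity whose products with the powers of `s` grow like `exp(ψ*(n k)/n)` decays like
`exp(-ω(s)/n)`. -/
theorem IsWeightFunction.le_of_pow_mul_le_growth (hω : IsWeightFunction ω) (n : ℕ+) {s J B : ℝ}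
    (hs : 0 ≤ s) (hB : 0 ≤ B) (h : ∀ k : ℕ, s ^ k * J ≤ B * growth ω n k) :
    J ≤ B * (1 + s) * Real.exp (-(ω s / n)) := by
  have hn : (0 : ℝ) < n := by exact_mod_cast n.pos
  rcases le_or_gt s 1 with h1 | h1
  · have := h 0
    rw [hω.growth_zero, pow_zero, one_mul, mul_one] at this
    rw [hω.eq_zero s ⟨hs, h1⟩, zero_div, neg_zero, Real.exp_zero, mul_one]
    nlinarith
  · have hs0 : 0 < s := by linarith
    have hm : MonotoneOn (fun x => ω (Real.exp x)) (Ici 0) := fun a _ b _ hab =>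
      hω.monotoneOn (Real.exp_pos a).le (Real.exp_pos b).le (Real.exp_le_exp.2 hab)
    obtain ⟨y, hy0, hy⟩ := ConvexOn.exists_subgradient hω.delta hm (Real.log_pos h1)
    rw [Real.exp_log hs0] at hy
    -- The case of equality in Young's inequality: a subgradient at log s is a maximising slope.
    have hyc : youngConj ω y ≤ Real.log s * y - ω s := youngConj_le fun x hx => by
      have := hy x hx
      linarith
    -- The optimal exponent is the real number `y / n`. Rounding it down costs at most one factor
    -- `s`, whence the factor `1 + s` in the conclusion.
    set k := ⌊y / n⌋₊ with hk
    have hk1 : (k : ℝ) ≤ y / n := Nat.floor_le (by positivity)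
    have hk2 : y / n < k + 1 := Nat.lt_floor_add_one _
    have hkn : (n : ℝ) * k ≤ y := by rwa [le_div_iff₀' hn] at hk1
    have hg : growth ω n k ≤ Real.exp (Real.log s * (y / n) - ω s / n) := by
      refine Real.exp_le_exp.2 ?_
      have := (hω.youngConj_mono hkn).trans hyc
      calc _ ≤ 1 / (n : ℝ) * (Real.log s * y - ω s) := by gcongr
        _ = _ := by ring
    have hg2 : growth ω n k ≤ s ^ k * (s * Real.exp (-(ω s / n))) := by
      refine hg.trans ?_
      have hsk : s ^ k * s = Real.exp (Real.log s * (k + 1)) := by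
        rw [← pow_succ]
        conv_lhs => rw [← Real.exp_log (pow_pos hs0 (k + 1)), Real.log_pow]
        push_cast
        rw [mul_comm]
      rw [← mul_assoc, hsk, ← Real.exp_add]
      refine Real.exp_le_exp.2 ?_
      have := mul_le_mul_of_nonneg_left hk2.le (Real.log_pos h1).le
      linarith
    have h2 : s ^ k * J ≤ s ^ k * (B * (s * Real.exp (-(ω s / n)))) := by
      refine (h k).trans ?_
      calc _ ≤ B * (s ^ k * (s * Real.exp (-(ω s / n)))) := by gcongr
        _ = _ := by ring
    refine (le_of_mul_le_mul_left h2 (pow_pos hs0 k)).trans ?_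
    have := Real.exp_pos (-(ω s / n))
    rw [← mul_assoc]
    gcongr
    linarith

/-- The doubling condition is iterated until 2^p exceeds `c`. The summand 1 covers small `t`, where
the asymptotic bound says nothing. `L` is an integer so that it can multiply the index of a step. -/
theorem IsWeightFunction.exists_le_dilate (hω : IsWeightFunction ω) {c : ℝ} (hc : 0 ≤ c) :
    ∃ L : ℕ, 1 ≤ L ∧ ∀ t, 0 ≤ t → ω (c * t) ≤ L * (ω t + 1) := by
  obtain ⟨A, hA0, hA⟩ := hω.alpha.exists_pos
  obtain ⟨T, hT⟩ := eventually_atTop.1 hA.bound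
  obtain ⟨N, hN⟩ := exists_nat_ge (max A (ω (2 * max T 0)))
  have hNA : A ≤ N := (le_max_left _ _).trans hN
  have hNT : ω (2 * max T 0) ≤ N := (le_max_right _ _).trans hN
  have h2 : ∀ t, 0 ≤ t → ω (2 * t) ≤ N * (ω t + 1) := by
    intro t ht
    have h0 := hω.nonneg ht
    rcases le_total T t with h | h
    · have := (le_abs_self _).trans (hT t h)
      rw [Real.norm_of_nonneg h0] at this
      have : A * ω t ≤ N * ω t := by gcongr
      have : (0 : ℝ) ≤ N := N.cast_nonneg
      linarith
    · have h1 : ω (2 * t) ≤ ω (2 * max T 0) :=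
        hω.monotoneOn (mul_nonneg zero_le_two ht) (mul_nonneg zero_le_two (le_max_right T 0))
          (mul_le_mul_of_nonneg_left (h.trans (le_max_left T 0)) zero_le_two)
      have : 0 ≤ N * ω t := by positivity
      linarith
  have hp : ∀ p : ℕ, ∃ L : ℕ, 1 ≤ L ∧ ∀ t, 0 ≤ t → ω (2 ^ p * t) ≤ L * (ω t + 1) := by
    intro p
    induction p with
    | zero => exact ⟨1, le_rfl, fun t _ => by simp⟩
    | succ p ih =>
      obtain ⟨L, hL, h⟩ := ih
      refine ⟨N * (L + 1) + 1, by omega, fun t ht => ?_⟩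
      have h3 := h2 (2 ^ p * t) (by positivity)
      have h4 := h t ht
      have h0 := hω.nonneg ht
      rw [pow_succ', mul_assoc]
      refine h3.trans ?_
      calc (N : ℝ) * (ω (2 ^ p * t) + 1) ≤ N * (L * (ω t + 1) + (ω t + 1)) := by gcongr; linarith
        _ ≤ N * (L * (ω t + 1) + (ω t + 1)) + (ω t + 1) := by linarith
        _ = _ := by push_cast; ring
  obtain ⟨p, hp1⟩ := pow_unbounded_of_one_lt |c| (one_lt_two (α := ℝ))
  obtain ⟨L, hL, h⟩ := hp p
  refine ⟨L, hL, fun t ht => ?_⟩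
  refine le_trans (hω.monotoneOn (mul_nonneg hc ht) (show (0 : ℝ) ≤ 2 ^ p * t by positivity)
    ?_) (h t ht)
  have := (le_abs_self c).trans hp1.le
  gcongr

/-- The function `exp ∘ ω` grows faster than every power. -/
theorem IsWeightFunction.exists_pow_le_exp (hω : IsWeightFunction ω) (p : ℕ) {ε : ℝ}
    (hε : 0 < ε) : ∃ C, 0 ≤ C ∧ ∀ s, 0 ≤ s → (1 + s) ^ p ≤ C * Real.exp (ε * ω s) := by
  have h := hω.gamma.def (c := ε / (p + 1)) (by positivity)
  obtain ⟨T, hT⟩ := eventually_atTop.1 h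
  set M := max T 1 with hM
  refine ⟨(1 + M) ^ p + 2 ^ p, by positivity, fun s hs => ?_⟩
  have hω0 := hω.nonneg hs
  have he : 1 ≤ Real.exp (ε * ω s) := Real.one_le_exp (by positivity)
  rcases le_total s M with h1 | h1
  · calc (1 + s) ^ p ≤ (1 + M) ^ p * 1 := by rw [mul_one]; gcongr
      _ ≤ ((1 + M) ^ p + 2 ^ p) * Real.exp (ε * ω s) := by
        gcongr
        exact le_add_of_nonneg_right (by positivity)
  · have hs1 : 1 ≤ s := (le_max_right T 1).trans h1
    have hs0 : 0 < s := by linarith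
    have h2 := hT s ((le_max_left T 1).trans h1)
    rw [Real.norm_of_nonneg (Real.log_nonneg hs1), Real.norm_of_nonneg hω0, div_mul_eq_mul_div,
      le_div_iff₀ (by positivity)] at h2
    have h3 : s ^ p ≤ Real.exp (ε * ω s) := by
      conv_lhs => rw [← Real.exp_log (pow_pos hs0 p), Real.log_pow]
      refine Real.exp_le_exp.2 ?_
      have := Real.log_nonneg hs1
      linarith
    calc (1 + s) ^ p ≤ (2 * s) ^ p := by gcongr; linarith
      _ = 2 ^ p * s ^ p := mul_pow _ _ _
      _ ≤ ((1 + M) ^ p + 2 ^ p) * Real.exp (ε * ω s) := by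
        gcongr
        exact le_add_of_nonneg_left (by positivity)

end Weights

/-! ### Time-frequency shifts of test functions -/

section Atoms

open scoped ContDiff

variable {d : ℕ}

theorem pdList_add {φ ψ : E d → ℂ} (hφ : ContDiff ℝ ∞ φ) (hψ : ContDiff ℝ ∞ ψ)
    (l : List (Fin d)) : pdList l (φ + ψ) = pdList l φ + pdList l ψ := by
  rw [pdList_eq_mderiv (φ := φ + ψ) (hφ.add hψ), pdList_eq_mderiv hφ, pdList_eq_mderiv hψ, mderiv_add hφ hψ]

theorem pdList_smul {φ : E d → ℂ} (hφ : ContDiff ℝ ∞ φ) (c : ℂ) (l : List (Fin d)) :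
    pdList l (c • φ) = c • pdList l φ := by
  rw [pdList_eq_mderiv (φ := c • φ) (contDiff_const.smul hφ), pdList_eq_mderiv hφ, mderiv_smul hφ]

theorem pdList_concat (l : List (Fin d)) (j : Fin d) (φ : E d → ℂ) :
    pdList (l ++ [j]) φ = pdList l (pderiv j φ) := pdList_append l [j] φ

theorem sum_count (l : List (Fin d)) : ∑ i, l.count i = l.length := by
  rw [← List.sum_toFinset_count_eq_length l]
  symm
  refine Finset.sum_subset (Finset.subset_univ _) fun j _ hj => ?_
  simpa [List.count_eq_zero] using hj

/-- The plane wave `t ↦ e^{2πi ξ·t}`. -/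
def wave (ξ t : E d) : ℂ := Complex.exp (2 * Real.pi * Complex.I * (inner ℝ ξ t : ℝ))

/-- The time-frequency shift `M_ξ T_x φ`. -/
def atom (φ : E d → ℂ) (x ξ : E d) : E d → ℂ := fun t => wave ξ t * φ (t - x)

theorem wave_eq (ξ t : E d) :
    wave ξ t = Complex.exp (((2 * Real.pi * inner ℝ ξ t : ℝ) : ℂ) * Complex.I) := by
  rw [wave]; congr 1; push_cast; ring

@[simp]
theorem norm_wave (ξ t : E d) : ‖wave ξ t‖ = 1 := by
  rw [wave_eq, Complex.norm_exp_ofReal_mul_I]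

theorem continuous_wave : Continuous fun p : E d × E d => wave p.1 p.2 := by
  unfold wave; fun_prop

theorem contDiff_wave (ξ : E d) : ContDiff ℝ ∞ (wave ξ) := by
  unfold wave
  refine Complex.contDiff_exp.comp (contDiff_const.mul (Complex.ofRealCLM.contDiff.comp ?_))
  exact (innerSL ℝ ξ).contDiff

theorem hasFDerivAt_wave (ξ t : E d) : HasFDerivAt (wave ξ)
    ((2 * Real.pi * Complex.I * wave ξ t) • (Complex.ofRealCLM.comp (innerSL ℝ ξ))) t := by
  have h1 : HasFDerivAt (fun t : E d => ((inner ℝ ξ t : ℝ) : ℂ))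
      (Complex.ofRealCLM.comp (innerSL ℝ ξ)) t := (Complex.ofRealCLM.comp (innerSL ℝ ξ)).hasFDerivAt
  have h2 := (h1.const_mul (2 * Real.pi * Complex.I)).cexp
  refine h2.congr_fderiv ?_
  rw [smul_smul]
  congr 1
  rw [wave, mul_comm]

theorem pderiv_wave (j : Fin d) (ξ t : E d) :
    pderiv j (wave ξ) t = 2 * Real.pi * Complex.I * ξ j * wave ξ t := by
  rw [pderiv, (hasFDerivAt_wave ξ t).fderiv]
  simp [EuclideanSpace.inner_single_right]
  ring

theorem contDiff_atom {φ : E d → ℂ} (hφ : ContDiff ℝ ∞ φ) (x ξ : E d) :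
    ContDiff ℝ ∞ (atom φ x ξ) :=
  (contDiff_wave ξ).mul (hφ.comp (contDiff_id.sub contDiff_const))

theorem pderiv_mul {φ ψ : E d → ℂ} (hφ : ContDiff ℝ ∞ φ) (hψ : ContDiff ℝ ∞ ψ) (j : Fin d)
    (t : E d) : pderiv j (fun t => φ t * ψ t) t = pderiv j φ t * ψ t + φ t * pderiv j ψ t := by
  rw [pderiv, fderiv_fun_mul (hφ.differentiable (by simp) t) (hψ.differentiable (by simp) t)]
  simp [pderiv]
  ring

theorem pderiv_comp_sub (φ : E d → ℂ) (j : Fin d) (x t : E d) :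
    pderiv j (fun t => φ (t - x)) t = pderiv j φ (t - x) := by
  rw [pderiv, fderiv_comp_sub, pderiv]

theorem pderiv_atom {φ : E d → ℂ} (hφ : ContDiff ℝ ∞ φ) (j : Fin d) (x ξ : E d) :
    pderiv j (atom φ x ξ) =
      (2 * Real.pi * Complex.I * ξ j : ℂ) • atom φ x ξ + atom (pderiv j φ) x ξ := by
  funext t
  have h := pderiv_mul (contDiff_wave ξ) (hφ.comp (contDiff_id.sub (contDiff_const (c := x)))) j t
  change pderiv j (fun t => wave ξ t * φ (t - x)) t = _
  refine h.trans ?_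
  have h2 : pderiv j (φ ∘ (id - fun _ => x)) t = pderiv j φ (t - x) := pderiv_comp_sub φ j x t
  rw [pderiv_wave]
  simp [atom]
  rw [← h2]
  simp [Function.comp_def]
  ring

/-- The last letter of the list is the derivative applied first, so the product rule there yields
time-frequency shifts again, of the same function and of its derivative. This makes induction from
the end of the list possible. -/
theorem pdList_concat_atom {φ : E d → ℂ} (hφ : ContDiff ℝ ∞ φ) (l l' : List (Fin d)) (j : Fin d)
    (x ξ : E d) : pdList (l ++ [j]) (atom (pdList l' φ) x ξ) =
      (2 * Real.pi * Complex.I * ξ j : ℂ) • pdList l (atom (pdList l' φ) x ξ) +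
        pdList l (atom (pdList (j :: l') φ) x ξ) := by
  have h := contDiff_pdList hφ l'
  have h' : ContDiff ℝ ∞ ((2 * Real.pi * Complex.I * ξ j : ℂ) • atom (pdList l' φ) x ξ) :=
    contDiff_const.smul (contDiff_atom h x ξ)
  rw [pdList_concat, pderiv_atom h, pdList_add h'
    (contDiff_atom (contDiff_pderiv h j) x ξ), pdList_smul (contDiff_atom h x ξ)]
  rfl

/-- Each derivative falls on the wave, giving a factor of size at most `c`, or on the window,
lengthening `l'`. Either way the total order `i + l.length + l'.length` is preserved, so a bound
depending on that order alone survives, and the two alternatives per letter give 2^{|l|}. The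
generality in `i` and `l'` is what the induction needs. -/
theorem norm_pdList_atom_le {φ : E d → ℂ} (hφ : ContDiff ℝ ∞ φ) {G : ℕ → ℝ} {e : E d → ℝ}
    {ξ : E d} {c : ℝ} (hc : ∀ j, ‖(2 * Real.pi * Complex.I * ξ j : ℂ)‖ ≤ c)
    (hc0 : 0 ≤ c)
    (h : ∀ (l : List (Fin d)) (i : ℕ) (s : E d), c ^ i * ‖pdList l φ s‖ ≤ G (i + l.length) * e s)
    (l : List (Fin d)) : ∀ (l' : List (Fin d)) (i : ℕ) (x t : E d),
    c ^ i * ‖pdList l (atom (pdList l' φ) x ξ) t‖ ≤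
      2 ^ l.length * G (i + l.length + l'.length) * e (t - x) := by
  induction l using List.reverseRecOn with
  | nil =>
    intro l' i x t
    have := h l' i (t - x)
    simpa [pdList, atom] using this
  | append_singleton l j ih =>
    intro l' i x t
    rw [pdList_concat_atom hφ]
    have h1 := ih l' (i + 1) x t
    have h2 := ih (j :: l') i x t
    have e1 : i + 1 + l.length + l'.length = i + (l ++ [j]).length + l'.length := by simp; omega
    have e2 : i + l.length + (j :: l').length = i + (l ++ [j]).length + l'.length := by
      simp; omega
    rw [e1] at h1
    rw [e2] at h2
    have e3 : (2 : ℝ) ^ (l ++ [j]).length = 2 * 2 ^ l.length := by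
      rw [List.length_append, List.length_singleton, pow_succ']
    calc _ ≤ c ^ i * (c * ‖pdList l (atom (pdList l' φ) x ξ) t‖ +
          ‖pdList l (atom (pdList (j :: l') φ) x ξ) t‖) := by
          refine mul_le_mul_of_nonneg_left ((norm_add_le _ _).trans ?_) (by positivity)
          rw [Pi.smul_apply, norm_smul]
          gcongr
          exact hc j
      _ = c ^ (i + 1) * ‖pdList l (atom (pdList l' φ) x ξ) t‖ +
          c ^ i * ‖pdList l (atom (pdList (j :: l') φ) x ξ) t‖ := by ring
      _ ≤ _ := by rw [e3]; linarith

theorem continuous_pdList_atom {φ : E d → ℂ} (hφ : ContDiff ℝ ∞ φ) (l : List (Fin d)) :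
    ∀ l' : List (Fin d), Continuous fun p : (E d × E d) × E d =>
      pdList l (atom (pdList l' φ) p.1.1 p.1.2) p.2 := by
  induction l using List.reverseRecOn with
  | nil =>
    intro l'
    have h := (contDiff_pdList hφ l').continuous
    have hw := continuous_wave (d := d)
    change Continuous fun p : (E d × E d) × E d => wave p.1.2 p.2 * pdList l' φ (p.2 - p.1.1)
    exact (hw.comp (continuous_fst.snd.prodMk continuous_snd)).mul (h.comp (by fun_prop))
  | append_singleton l j ih =>
    intro l'
    simp only [pdList_concat_atom hφ, Pi.add_apply, Pi.smul_apply, smul_eq_mul]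
    have h1 := ih l'
    have h2 := ih (j :: l')
    fun_prop

end Atoms

/-! ### Weighted bounds for windows and for their time-frequency shifts -/

section Windows

variable {d : ℕ} {ω : ℝ → ℝ}

/-- The exponentially decaying majorant of test functions. -/
def expDecay (t : E d) : ℝ := Real.exp (-((d + 1 : ℕ) * ‖t‖))

theorem expDecay_pos (t : E d) : 0 < expDecay t := Real.exp_pos _

theorem expDecay_sub_le {x : E d} {r : ℝ} (hx : ‖x‖ ≤ r) (t : E d) :
    expDecay (t - x) ≤ Real.exp ((d + 1 : ℕ) * r) * expDecay t := by
  rw [expDecay, expDecay, ← Real.exp_add]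
  refine Real.exp_le_exp.2 ?_
  have : ‖t‖ ≤ ‖t - x‖ + r := (norm_le_norm_sub_add t x).trans (by gcongr)
  have := mul_le_mul_of_nonneg_left this (Nat.cast_nonneg (α := ℝ) (d + 1))
  linarith

theorem integrable_expDecay : Integrable (expDecay (d := d)) := integrable_exp_neg d

theorem norm_pdList_window_le (hω : IsWeightFunction ω) (χ : SSpace d) {R : ℕ} (hR : 1 ≤ R) :
    ∃ C, 0 ≤ C ∧ ∀ (n : ℕ+) (l : List (Fin d)) (s : E d),
      (R : ℝ) ^ l.length * ‖pdList l χ s‖ ≤ C * growth ω n l.length * expDecay s := by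
  obtain ⟨C, N, hC, hN, hCN⟩ := exists_expWeight_mul_factorial_le hω
  -- `N` pays for replacing k! by the weight, `R` for the geometric factor, and `d + 1` for the rate
  -- of `expDecay`. The constant obtained does not depend on `n`.
  set M : ℕ := N * R * (d + 1) with hM
  obtain ⟨B, hB⟩ := χ.2.2 M
  have hB0 : 0 ≤ B := le_trans (by positivity) (hB ⟨(0, 0), rfl⟩)
  have hNR : (N : ℝ) * R ≤ M := by
    exact_mod_cast Nat.le_mul_of_pos_right (N * R) (Nat.succ_pos d)
  have hdM : ((d + 1 : ℕ) : ℝ) ≤ M := by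
    exact_mod_cast Nat.le_mul_of_pos_left (d + 1) (Nat.mul_pos hN hR)
  refine ⟨B * C, by positivity, fun n l s => ?_⟩
  rw [pdList_eq_mderiv χ.2.1]
  have h1 := hB ⟨(fun i => l.count i, s), rfl⟩
  simp only [sum_count] at h1
  set k := l.length with hk
  set D := ‖mderiv (fun i => l.count i) χ.1 s‖ with hD
  rw [div_le_iff₀ (by positivity)] at h1
  have h2 : (k.factorial : ℝ) ≤ C * N ^ k * growth ω n k := by
    have := hCN k
    rw [mul_comm, mul_expWeight_le_iff] at this
    refine this.trans ?_
    have := hω.growth_mono (one_le : 1 ≤ n) k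
    gcongr
  have hNk : (0 : ℝ) < N ^ k := by positivity
  rw [expDecay, Real.exp_neg, ← div_eq_mul_inv, le_div_iff₀ (Real.exp_pos _)]
  refine le_of_mul_le_mul_left ?_ hNk
  calc (N : ℝ) ^ k * (R ^ k * D * Real.exp ((d + 1 : ℕ) * ‖s‖))
      = (N * R) ^ k * D * Real.exp ((d + 1 : ℕ) * ‖s‖) := by rw [mul_pow]; ring
    _ ≤ (M : ℝ) ^ k * D * Real.exp (M * ‖s‖) := by gcongr
    _ ≤ B * k.factorial := h1
    _ ≤ B * (C * N ^ k * growth ω n k) := by gcongr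
    _ = _ := by ring

/-- The derivatives of the time-frequency shifts of a test function. -/
theorem exists_norm_pdList_atom_le (hω : IsWeightFunction ω) (m : ℕ+) :
    ∃ n₀ : ℕ+, ∀ n, n₀ ≤ n → ∀ χ : SSpace d, ∃ C, 0 ≤ C ∧
      ∀ (l : List (Fin d)) (x ξ t : E d), 2 ^ l.length * ‖pdList l (atom χ x ξ) t‖ ≤
        C * growth ω n l.length * Real.exp (1 / (m : ℝ) * ω ‖ξ‖) * expDecay (t - x) := by
  -- Young's inequality is applied below at the point 4·2π|ξ|. The index m·L makes its cost
  -- ω(8π|ξ|)/n at most (ω(|ξ|) + 1)/m.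
  obtain ⟨L, hL, hLω⟩ := hω.exists_le_dilate (c := 4 * (2 * Real.pi)) (by positivity)
  refine ⟨m * ⟨L, hL⟩, fun n hn χ => ?_⟩
  -- The number 4 is 2·2: one 2 is the number of alternatives in the product rule, the other is the
  -- 2^{|l|} on the left of the conclusion.
  obtain ⟨C, hC, h⟩ := norm_pdList_window_le hω χ (R := 4) (by norm_num)
  have hm : (0 : ℝ) < m := by exact_mod_cast m.pos
  have hn0 : (0 : ℝ) < n := by exact_mod_cast n.pos
  have hmn : (m : ℝ) * L ≤ n := by
    have : (m : ℕ) * L ≤ n := hn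
    exact_mod_cast this
  refine ⟨C * Real.exp (1 / m), by positivity, fun l x ξ t => ?_⟩
  obtain ⟨c, hc⟩ : ∃ c, c = 2 * Real.pi * ‖ξ‖ := ⟨_, rfl⟩
  have hc0 : 0 ≤ c := by rw [hc]; positivity
  have hωξ := hω.nonneg (norm_nonneg ξ)
  have hcj : ∀ j, ‖(2 * Real.pi * Complex.I * ξ j : ℂ)‖ ≤ c := by
    intro j
    simp only [norm_mul, Complex.norm_ofNat, Complex.norm_real, Complex.norm_I, mul_one,
      Real.norm_of_nonneg Real.pi_pos.le]
    rw [hc]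
    gcongr
    exact PiLp.norm_apply_le ξ j
  have hexp : Real.exp (ω (4 * c) / n) ≤ Real.exp (1 / m) * Real.exp (1 / (m : ℝ) * ω ‖ξ‖) := by
    rw [← Real.exp_add]
    refine Real.exp_le_exp.2 ?_
    have h1 := hLω ‖ξ‖ (norm_nonneg ξ)
    rw [mul_assoc, ← hc] at h1
    rw [div_le_iff₀ hn0]
    refine h1.trans ?_
    calc (L : ℝ) * (ω ‖ξ‖ + 1) = (1 / m + 1 / m * ω ‖ξ‖) * (m * L) := by field_simp; ring
      _ ≤ _ := by gcongr
  have key := norm_pdList_atom_le χ.2.1 (G := fun k => C * (4 ^ k)⁻¹ * Real.exp (ω (4 * c) / n) *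
    growth ω n k) (e := expDecay) (ξ := ξ) hcj hc0 (by
      intro l i s
      have h1 := h n l s
      have h2 := hω.pow_le_growth n i (s := 4 * c) (by positivity)
      have h3 := hω.growth_mul_le n i l.length
      have h4 : (0 : ℝ) < 4 ^ (i + l.length) := by positivity
      refine le_of_mul_le_mul_left ?_ h4
      have hg := growth_pos ω n i
      have hg' := growth_pos ω n l.length
      have he := expDecay_pos s
      calc (4 : ℝ) ^ (i + l.length) * (c ^ i * ‖pdList l χ.1 s‖)
          = (4 * c) ^ i * (4 ^ l.length * ‖pdList l χ.1 s‖) := by rw [mul_pow, pow_add]; ring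
        _ ≤ (Real.exp (ω (4 * c) / n) * growth ω n i) *
            (C * growth ω n l.length * expDecay s) := by
            refine mul_le_mul h2 (by exact_mod_cast h1) (by positivity) (by positivity)
        _ = (C * Real.exp (ω (4 * c) / n) * expDecay s) *
            (growth ω n i * growth ω n l.length) := by ring
        _ ≤ (C * Real.exp (ω (4 * c) / n) * expDecay s) * growth ω n (i + l.length) := by gcongr
        _ = _ := by field_simp) l [] 0 x t
  simp only [pow_zero, one_mul, zero_add, List.length_nil, add_zero] at key
  have hpd : pdList [] χ.1 = χ.1 := rfl
  rw [hpd] at key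
  have hg := growth_pos ω n l.length
  have he := expDecay_pos (t - x)
  calc (2 : ℝ) ^ l.length * ‖pdList l (atom χ.1 x ξ) t‖
      ≤ 2 ^ l.length * (2 ^ l.length * (C * (4 ^ l.length)⁻¹ * Real.exp (ω (4 * c) / n) *
        growth ω n l.length) * expDecay (t - x)) := by gcongr
    _ = (2 * 2) ^ l.length * (4 ^ l.length)⁻¹ * (C * Real.exp (ω (4 * c) / n) *
        growth ω n l.length * expDecay (t - x)) := by rw [mul_pow]; ring
    _ = C * Real.exp (ω (4 * c) / n) * growth ω n l.length * expDecay (t - x) := by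
        norm_num
    _ ≤ C * (Real.exp (1 / m) * Real.exp (1 / (m : ℝ) * ω ‖ξ‖)) * growth ω n l.length *
        expDecay (t - x) := by gcongr
    _ = _ := by ring

end Windows

/-! ### Time-frequency shifts as elements of the step spaces -/

section Steps

variable {d : ℕ} {ω : ℝ → ℝ}

theorem StepSpace.seminorm_le_iff {n : ℕ+} {φ : StepSpace ω d n} {B : ℝ} :
    StepSpace.seminorm ω d n φ ≤ B ↔
      ∀ α, (∫ x, ‖mderiv α φ.1 x‖) ≤ B * growth ω n (∑ i, α i) := by
  constructor
  · intro h α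
    rw [← mul_expWeight_le_iff]
    exact (le_ciSup (φ.2.2.2) α).trans h
  · intro h
    exact ciSup_le fun α => mul_expWeight_le_iff.2 (h α)

theorem StepSpace.integral_norm_mderiv_le {n : ℕ+} (φ : StepSpace ω d n) (α : Fin d → ℕ) :
    (∫ x, ‖mderiv α φ.1 x‖) ≤ StepSpace.seminorm ω d n φ * growth ω n (∑ i, α i) :=
  StepSpace.seminorm_le_iff.1 le_rfl α

/-- The inclusion of test functions in `D_{L¹,ω,n}(ℝ^d)`. -/
def toStep (hω : IsWeightFunction ω) (n : ℕ+) : SSpace d →ₗ[ℂ] StepSpace ω d n :=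
  Submodule.inclusion ((sSubmodule_le_step hω d).trans (stepSubmodule_mono hω d one_le))

theorem ofStep_val (n : ℕ+) (φ : StepSpace ω d n) : (DSpace.ofStep ω d n φ).1 = φ.1 := rfl

theorem toStep_val (hω : IsWeightFunction ω) (n : ℕ+) (φ : SSpace d) :
    (toStep hω n φ).1 = φ.1 := rfl

theorem ofStep_toStep (hω : IsWeightFunction ω) (n : ℕ+) (φ : SSpace d) :
    DSpace.ofStep ω d n (toStep hω n φ) = sInclusion hω d φ :=
  Subtype.ext ((ofStep_val n _).trans ((toStep_val hω n φ).trans (sInclusion_val hω d φ).symm))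

/-- The time-frequency shift of a test function as a test function. -/
def atomS (χ : SSpace d) (z : E d × E d) : SSpace d :=
  ⟨atom χ z.1 z.2, modulate_mem_sSubmodule (translate_mem_sSubmodule χ.2 z.1) z.2⟩

/-- The complex conjugate of a test function. -/
def conjS (χ : SSpace d) : SSpace d := ⟨fun t => conj (χ t), conj_mem_sSubmodule χ.2⟩

theorem conj_wave (ξ t : E d) : conj (wave ξ t) = wave (-ξ) t := by
  rw [wave_eq, wave_eq, ← Complex.exp_conj, map_mul, Complex.conj_ofReal, Complex.conj_I,
    inner_neg_left, mul_neg, mul_neg, Complex.ofReal_neg, neg_mul]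

/-- Conjugation exchanges ξ and -ξ. The weights depend only on |ξ|, so all bounds for shifts pass to
their conjugates. -/
theorem conjShift_eq (χ : SSpace d) (x ξ : E d) :
    conjShift χ x ξ = atomS (conjS χ) (x, -ξ) := by
  refine Subtype.ext (funext fun t => ?_)
  change conj (wave ξ t * χ (t - x)) = wave (-ξ) t * conj (χ (t - x))
  rw [map_mul, conj_wave]

/-- The factor 2^{|α|} on the left makes the derivatives of high order uniformly small relative to
their weights, as the proof of continuity in (x, ξ) requires. -/
theorem exists_integral_norm_mderiv_atom_le (hω : IsWeightFunction ω) (m : ℕ+) :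
    ∃ n₀ : ℕ+, ∀ n, n₀ ≤ n → ∀ χ : SSpace d, ∃ C, 0 ≤ C ∧ ∀ (α : Fin d → ℕ) (x ξ : E d),
      2 ^ (∑ i, α i) * (∫ t, ‖mderiv α (atom χ x ξ) t‖) ≤
        C * growth ω n (∑ i, α i) * Real.exp (1 / (m : ℝ) * ω ‖ξ‖) := by
  obtain ⟨n₀, h⟩ := exists_norm_pdList_atom_le (d := d) hω m
  refine ⟨n₀, fun n hn χ => ?_⟩
  obtain ⟨C, hC, hb⟩ := h n hn χ
  refine ⟨C * ∫ t : E d, expDecay t, mul_nonneg hC (integral_nonneg fun t => (expDecay_pos t).le),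
    fun α x ξ => ?_⟩
  rw [mderiv_eq, ← length_wordOf, ← integral_const_mul]
  calc _ ≤ ∫ t, C * growth ω n (wordOf α).length * Real.exp (1 / (m : ℝ) * ω ‖ξ‖) *
        expDecay (t - x) := by
        refine integral_mono_of_nonneg (Eventually.of_forall fun t => by positivity)
          ((integrable_expDecay.comp_sub_right x).const_mul _)
          (Eventually.of_forall fun t => hb _ x ξ t)
    _ = _ := by
        rw [integral_const_mul, integral_sub_right_eq_self (fun t : E d => expDecay t) x]
        ring

/-- The norms of the time-frequency shifts of a test function in the step spaces. -/
theorem exists_seminorm_atomS_le (hω : IsWeightFunction ω) (m : ℕ+) :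
    ∃ n₀ : ℕ+, ∀ n, n₀ ≤ n → ∀ χ : SSpace d, ∃ C, 0 ≤ C ∧ ∀ z : E d × E d,
      StepSpace.seminorm ω d n (toStep hω n (atomS χ z)) ≤
        C * Real.exp (1 / (m : ℝ) * ω ‖z.2‖) := by
  obtain ⟨n₀, h⟩ := exists_integral_norm_mderiv_atom_le (d := d) hω m
  refine ⟨n₀, fun n hn χ => ?_⟩
  obtain ⟨C, hC, hb⟩ := h n hn χ
  refine ⟨C, hC, fun z => StepSpace.seminorm_le_iff.2 fun α => ?_⟩
  have h1 := hb α z.1 z.2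
  have h2 : (∫ t, ‖mderiv α (atom χ z.1 z.2) t‖) ≤
      2 ^ (∑ i, α i) * ∫ t, ‖mderiv α (atom χ z.1 z.2) t‖ :=
    le_mul_of_one_le_left (integral_nonneg fun _ => norm_nonneg _) (one_le_pow₀ one_le_two)
  refine (h2.trans h1).trans (le_of_eq ?_)
  ring

theorem continuous_mderiv_atom {φ : E d → ℂ} (hφ : ContDiff ℝ (⊤ : ℕ∞) φ) (α : Fin d → ℕ) :
    Continuous fun p : (E d × E d) × E d => mderiv α (atom φ p.1.1 p.1.2) p.2 := by
  have h := continuous_pdList_atom hφ (wordOf α) []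
  rw [show pdList [] φ = φ from rfl] at h
  simpa only [mderiv_eq] using h

/-- Dominated convergence for one fixed derivative: while (x, ξ) stays in a ball, all the shifts lie
below one multiple of `expDecay`. -/
theorem tendsto_integral_norm_mderiv_atom_sub (hω : IsWeightFunction ω) (χ : SSpace d)
    (α : Fin d → ℕ) (z₀ : E d × E d) :
    Tendsto (fun z : E d × E d =>
      ∫ t, ‖mderiv α (atom χ z.1 z.2) t - mderiv α (atom χ z₀.1 z₀.2) t‖) (𝓝 z₀) (𝓝 0) := by
  obtain ⟨n, h⟩ := exists_norm_pdList_atom_le (d := d) hω 1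
  obtain ⟨C, hC, hb⟩ := h n le_rfl χ
  set r := ‖z₀‖ + 1 with hr
  set l := wordOf α with hl
  set K := C * growth ω n l.length * Real.exp (1 / ((1 : ℕ+) : ℝ) * ω r) *
    Real.exp ((d + 1 : ℕ) * r) with hK
  have hbd : ∀ z : E d × E d, ‖z‖ ≤ r → ∀ t, ‖mderiv α (atom χ z.1 z.2) t‖ ≤ K * expDecay t := by
    intro z hz t
    have h1 : ‖z.1‖ ≤ r := (norm_fst_le z).trans hz
    have h2 : ‖z.2‖ ≤ r := (norm_snd_le z).trans hz
    have h3 : ω ‖z.2‖ ≤ ω r := hω.monotoneOn (norm_nonneg _) ((norm_nonneg _).trans h2) h2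
    have h4 := expDecay_sub_le h1 t
    have hg := growth_pos ω n l.length
    rw [mderiv_eq]
    calc _ ≤ 2 ^ l.length * ‖pdList l (atom χ z.1 z.2) t‖ :=
          le_mul_of_one_le_left (norm_nonneg _) (one_le_pow₀ one_le_two)
      _ ≤ _ := hb l z.1 z.2 t
      _ ≤ C * growth ω n l.length * Real.exp (1 / ((1 : ℕ+) : ℝ) * ω r) *
          (Real.exp ((d + 1 : ℕ) * r) * expDecay t) := by
          have := expDecay_pos (t - z.1)
          gcongr
      _ = _ := by rw [hK]; ring
  have hcont := continuous_mderiv_atom χ.2.1 α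
  have hc : ContinuousAt (fun z : E d × E d =>
      ∫ t, ‖mderiv α (atom χ z.1 z.2) t - mderiv α (atom χ z₀.1 z₀.2) t‖) z₀ := by
    refine continuousAt_of_dominated (bound := fun t => 2 * K * expDecay t) ?_ ?_
      (integrable_expDecay.const_mul _) (Eventually.of_forall fun t => ?_)
    · refine Eventually.of_forall fun z => Continuous.aestronglyMeasurable ?_
      have h1 := (contDiff_mderiv (contDiff_atom χ.2.1 z.1 z.2) α).continuous
      have h2 := (contDiff_mderiv (contDiff_atom χ.2.1 z₀.1 z₀.2) α).continuous
      fun_prop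
    · have : ∀ᶠ z in 𝓝 z₀, ‖z‖ < r := by
        refine continuous_norm.continuousAt.eventually_lt continuousAt_const ?_
        rw [hr]; linarith
      filter_upwards [this] with z hz
      refine Eventually.of_forall fun t => ?_
      rw [norm_norm]
      refine (norm_sub_le _ _).trans ?_
      have h1 := hbd z hz.le t
      have h2 := hbd z₀ (by rw [hr]; linarith) t
      linarith
    · have h1 : Continuous fun z : E d × E d => mderiv α (atom χ z.1 z.2) t :=
        Continuous.comp (g := fun p : (E d × E d) × E d => mderiv α (atom χ p.1.1 p.1.2) p.2)
          (f := fun z => (z, t)) hcont (by fun_prop)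
      have h2 : Continuous fun z : E d × E d =>
          ‖mderiv α (atom χ z.1 z.2) t - mderiv α (atom χ z₀.1 z₀.2) t‖ := by fun_prop
      exact h2.continuousAt
  have := hc.tendsto
  simpa using this

/-- Time-frequency shifts depend continuously on the point of the phase space. -/
theorem exists_continuous_toStep_atomS (hω : IsWeightFunction ω) :
    ∃ n₀ : ℕ+, ∀ n, n₀ ≤ n → ∀ χ : SSpace d,
      Continuous fun z : E d × E d => toStep hω n (atomS χ z) := by
  obtain ⟨n₀, h⟩ := exists_integral_norm_mderiv_atom_le (d := d) hω 1
  refine ⟨n₀, fun n hn χ => ?_⟩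
  obtain ⟨C, hC, hb⟩ := h n hn χ
  refine continuous_iff_continuousAt.2 fun z₀ => ?_
  refine (StepSpace.withSeminorms.tendsto_nhds _ _).2 fun _ ε hε => ?_
  set r := ‖z₀‖ + 1 with hr
  set K := C * Real.exp (1 / ((1 : ℕ+) : ℝ) * ω r) with hK
  have hK0 : 0 ≤ K := by positivity
  -- Continuity must be uniform over all α. Orders at least `N` are small by the spare factor
  -- 2^{-|α|}; only finitely many α remain, and they are treated one at a time.
  obtain ⟨N, hN⟩ := exists_pow_lt_of_lt_one (show 0 < ε / (4 * (K + 1)) by positivity)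
    (show (1 / 2 : ℝ) < 1 by norm_num)
  have hbd : ∀ z : E d × E d, ‖z‖ ≤ r → ∀ α : Fin d → ℕ, N ≤ ∑ i, α i →
      (∫ t, ‖mderiv α (atom χ z.1 z.2) t‖) ≤ ε / 4 * growth ω n (∑ i, α i) := by
    intro z hz α hα
    have h2 : ‖z.2‖ ≤ r := (norm_snd_le z).trans hz
    have h3 : ω ‖z.2‖ ≤ ω r := hω.monotoneOn (norm_nonneg _) ((norm_nonneg _).trans h2) h2
    have hg := growth_pos ω n (∑ i, α i)
    have h4 : 2 ^ (∑ i, α i) * (∫ t, ‖mderiv α (atom χ z.1 z.2) t‖) ≤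
        K * growth ω n (∑ i, α i) := by
      refine (hb α z.1 z.2).trans ?_
      rw [hK, mul_right_comm]
      gcongr
    have h5 : (∫ t, ‖mderiv α (atom χ z.1 z.2) t‖) ≤
        (1 / 2) ^ (∑ i, α i) * (K * growth ω n (∑ i, α i)) := by
      rw [one_div, inv_pow, inv_mul_eq_div, le_div_iff₀' (by positivity)]
      exact h4
    have h6 : (1 / 2 : ℝ) ^ (∑ i, α i) ≤ ε / (4 * (K + 1)) :=
      (pow_le_pow_of_le_one (by norm_num) (by norm_num) hα).trans hN.le
    calc _ ≤ _ := h5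
      _ ≤ ε / (4 * (K + 1)) * ((K + 1) * growth ω n (∑ i, α i)) := by gcongr; linarith
      _ = _ := by field_simp
  have hfin : {α : Fin d → ℕ | ∑ i, α i < N}.Finite := by
    refine (Set.Finite.pi' (fun _ : Fin d => Set.finite_Iio N)).subset fun α hα i => ?_
    exact (Finset.single_le_sum (f := α) (fun _ _ => Nat.zero_le _) (Finset.mem_univ i)).trans_lt hα
  have hev : ∀ᶠ z in 𝓝 z₀, ∀ α ∈ {α : Fin d → ℕ | ∑ i, α i < N},
      ∫ t, ‖mderiv α (atom χ z.1 z.2) t - mderiv α (atom χ z₀.1 z₀.2) t‖ < ε / 2 := by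
    refine (Filter.eventually_all_finite hfin).2 fun α _ => ?_
    exact (tendsto_integral_norm_mderiv_atom_sub hω χ α z₀).eventually_lt_const (half_pos hε)
  have hev2 : ∀ᶠ z in 𝓝 z₀, ‖z‖ < r := by
    refine continuous_norm.continuousAt.eventually_lt continuousAt_const ?_
    rw [hr]; linarith
  filter_upwards [hev, hev2] with z hz hzr
  refine lt_of_le_of_lt (StepSpace.seminorm_le_iff.2 fun α => ?_) (half_lt_self hε)
  have hmd : mderiv α (toStep hω n (atomS χ z) - toStep hω n (atomS χ z₀)).1 =
      mderiv α (atom χ z.1 z.2) - mderiv α (atom χ z₀.1 z₀.2) := by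
    have h1 := contDiff_atom χ.2.1 z.1 z.2
    have h2 := contDiff_atom χ.2.1 z₀.1 z₀.2
    have h3 : ContDiff ℝ (⊤ : ℕ∞) ((-1 : ℂ) • atom χ.1 z₀.1 z₀.2) := contDiff_const.smul h2
    have h4 : (toStep hω n (atomS χ z) - toStep hω n (atomS χ z₀)).1 =
        atom χ.1 z.1 z.2 + (-1 : ℂ) • atom χ.1 z₀.1 z₀.2 := by
      rw [neg_one_smul, ← sub_eq_add_neg]; rfl
    rw [h4, mderiv_add h1 h3, mderiv_smul h2, neg_one_smul, ← sub_eq_add_neg]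
  simp only [hmd, Pi.sub_apply]
  have hg := hω.one_le_growth n (∑ i, α i)
  by_cases hα : ∑ i, α i < N
  · refine (hz α hα).le.trans ?_
    nlinarith
  · rw [not_lt] at hα
    have i1 : Integrable (mderiv α (atom χ z.1 z.2)) := (toStep hω n (atomS χ z)).2.2.1 α
    have i2 : Integrable (mderiv α (atom χ z₀.1 z₀.2)) := (toStep hω n (atomS χ z₀)).2.2.1 α
    have h1 := hbd z hzr.le α hα
    have h2 := hbd z₀ (by rw [hr]; linarith) α hα
    calc _ ≤ ∫ t, (‖mderiv α (atom χ z.1 z.2) t‖ + ‖mderiv α (atom χ z₀.1 z₀.2) t‖) :=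
          integral_mono (i1.sub i2).norm (i1.norm.add i2.norm) fun t => norm_sub_le _ _
      _ = _ := integral_add i1.norm i2.norm
      _ ≤ _ := by linarith

end Steps

/-! ### Continuous linear functionals on the inductive limit -/

section Functionals

variable {d : ℕ} {ω : ℝ → ℝ}

theorem exists_norm_apply_ofStep_le (f : BDual ω d) (n : ℕ+) :
    ∃ A, 0 ≤ A ∧ ∀ φ : StepSpace ω d n,
      ‖f (DSpace.ofStep ω d n φ)‖ ≤ A * StepSpace.seminorm ω d n φ := by
  let g : StepSpace ω d n →ₗ[ℂ] ℂ := f.toLinearMap.comp (DSpace.ofStep ω d n)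
  have hg : Continuous ((normSeminorm ℂ ℂ).comp g) :=
    continuous_norm.comp (f.continuous.comp (DSpace.continuous_ofStep n))
  obtain ⟨s, C, -, h⟩ := Seminorm.bound_of_continuous StepSpace.withSeminorms _ hg
  refine ⟨C, C.2, fun φ => (h φ).trans ?_⟩
  refine mul_le_mul_of_nonneg_left ?_ C.2
  exact Seminorm.finset_sup_apply_le (apply_nonneg _ _) fun _ _ => le_rfl

/-- Linear functionals on the inductive limit are continuous if they are so on all steps. -/
theorem DSpace.continuous_of_step (g : DSpace ω d →ₗ[ℂ] ℂ)
    (h : ∀ n : ℕ+, Continuous fun φ : StepSpace ω d n => g (DSpace.ofStep ω d n φ)) :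
    Continuous g := by
  rw [continuous_iff_le_induced]
  -- The topology induced by `g` is locally convex and makes every inclusion continuous, so the
  -- inductive limit topology is finer than it.
  refine sInf_le ⟨fun n => continuous_induced_rng.2 (h n), topologicalAddGroup_induced g,
    continuousSMul_induced g, ?_⟩
  exact LocallyConvexSpace.induced (g.restrictScalars ℝ)

theorem StepSpace.continuous_of_le {n : ℕ+} (g : StepSpace ω d n →ₗ[ℂ] ℂ) {C : ℝ} (hC : 0 ≤ C)
    (h : ∀ φ, ‖g φ‖ ≤ C * StepSpace.seminorm ω d n φ) : Continuous g := by
  refine WithSeminorms.continuous_of_isBounded StepSpace.withSeminorms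
    (norm_withSeminorms ℂ ℂ) g fun _ => ⟨{()}, ⟨C, hC⟩, fun φ => ?_⟩
  rw [Finset.sup_singleton]
  exact h φ

end Functionals

/-! ### The short-time Fourier transform on the dual space -/

section STFT

variable {d : ℕ} {ω : ℝ → ℝ}

instance : IsTopologicalAddGroup (CbSpace ω d) := CbSpace.withSeminorms.topologicalAddGroup

instance : ContinuousSMul ℂ (CbSpace ω d) := CbSpace.withSeminorms.continuousSMul

theorem CbSpace.seminorm_le_iff {m : ℕ+} {F : CbSpace ω d} {B : ℝ} :
    CbSpace.seminorm ω d m F ≤ B ↔ ∀ z, ‖F z‖ ≤ B * Real.exp (1 / (m : ℝ) * ω ‖z.2‖) := by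
  have key : ∀ z, ‖F z‖ * Real.exp (-(1 / (m : ℝ) * ω ‖z.2‖)) ≤ B ↔
      ‖F z‖ ≤ B * Real.exp (1 / (m : ℝ) * ω ‖z.2‖) := fun z => by
    rw [Real.exp_neg, ← div_eq_mul_inv, div_le_iff₀ (Real.exp_pos _)]
  constructor
  · exact fun h z => (key z).1 ((le_ciSup (F.2.2 m) z).trans h)
  · exact fun h => ciSup_le fun z => (key z).2 (h z)

theorem CbSpace.norm_apply_le (F : CbSpace ω d) (m : ℕ+) (z : E d × E d) :
    ‖F z‖ ≤ CbSpace.seminorm ω d m F * Real.exp (1 / (m : ℝ) * ω ‖z.2‖) :=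
  CbSpace.seminorm_le_iff.1 le_rfl z

theorem continuous_apply_conjShift (hω : IsWeightFunction ω) (χ : SSpace d) (f : BDual ω d) :
    Continuous fun z : E d × E d => f (sInclusion hω d (conjShift χ z.1 z.2)) := by
  obtain ⟨n, hn⟩ := exists_continuous_toStep_atomS (d := d) hω
  have h := hn n le_rfl (conjS χ)
  have h2 := f.continuous.comp ((DSpace.continuous_ofStep n).comp h)
  have h3 := h2.comp (by fun_prop : Continuous fun z : E d × E d => (z.1, -z.2))
  refine h3.congr fun z => ?_
  rw [conjShift_eq, ← ofStep_toStep hω n]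
  rfl

theorem exists_seminorm_conjShift_le (hω : IsWeightFunction ω) (m : ℕ+) :
    ∃ n₀ : ℕ+, ∀ n, n₀ ≤ n → ∀ χ : SSpace d, ∃ C, 0 ≤ C ∧ ∀ x ξ : E d,
      StepSpace.seminorm ω d n (toStep hω n (conjShift χ x ξ)) ≤
        C * Real.exp (1 / (m : ℝ) * ω ‖ξ‖) := by
  obtain ⟨n₀, h⟩ := exists_seminorm_atomS_le (d := d) hω m
  refine ⟨n₀, fun n hn χ => ?_⟩
  obtain ⟨C, hC, hb⟩ := h n hn (conjS χ)
  refine ⟨C, hC, fun x ξ => ?_⟩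
  have := hb (x, -ξ)
  rwa [← conjShift_eq, norm_neg] at this

theorem stft_mem (hω : IsWeightFunction ω) (χ : SSpace d) (f : BDual ω d) :
    stft χ (toSDual hω f) ∈ cbSubmodule ω d := by
  refine ⟨continuous_apply_conjShift hω χ f, fun m => ?_⟩
  obtain ⟨n, hn⟩ := exists_seminorm_conjShift_le (d := d) hω m
  obtain ⟨C, hC, hb⟩ := hn n le_rfl χ
  obtain ⟨A, hA, hf⟩ := exists_norm_apply_ofStep_le f n
  refine ⟨A * C, ?_⟩
  rintro _ ⟨z, rfl⟩
  simp only
  rw [Real.exp_neg, ← div_eq_mul_inv, div_le_iff₀ (Real.exp_pos _), mul_assoc]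
  have h := hf (toStep hω n (conjShift χ z.1 z.2))
  rw [ofStep_toStep] at h
  exact h.trans
    (mul_le_mul_of_nonneg_left (hb z.1 z.2) hA)

/-- The short-time Fourier transform `V_χ` as a linear map. -/
def stftLin (hω : IsWeightFunction ω) (χ : SSpace d) : BDual ω d →ₗ[ℂ] CbSpace ω d where
  toFun f := ⟨stft χ (toSDual hω f), stft_mem hω χ f⟩
  map_add' _ _ := rfl
  map_smul' _ _ := rfl

/-- The supremum of |f| over this set is the `m`-th norm of V_χ f, so its boundedness gives
continuity of V_χ for the strong topology. The set is the image of a bounded subset of one step. -/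
theorem isVonNBounded_weighted_conjShift (hω : IsWeightFunction ω) (χ : SSpace d) (m : ℕ+) :
    Bornology.IsVonNBounded ℂ (range fun z : E d × E d =>
      ((Real.exp (-(1 / (m : ℝ) * ω ‖z.2‖)) : ℝ) : ℂ) •
        sInclusion hω d (conjShift χ z.1 z.2)) := by
  obtain ⟨n, hn⟩ := exists_seminorm_conjShift_le (d := d) hω m
  obtain ⟨C, hC, hb⟩ := hn n le_rfl χ
  have h1 : Bornology.IsVonNBounded ℂ (range fun z : E d × E d =>
      ((Real.exp (-(1 / (m : ℝ) * ω ‖z.2‖)) : ℝ) : ℂ) • toStep hω n (conjShift χ z.1 z.2)) := by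
    refine StepSpace.withSeminorms.isVonNBounded_iff_seminorm_bounded.2 fun _ =>
      ⟨C + 1, by positivity, ?_⟩
    rintro _ ⟨z, rfl⟩
    rw [map_smul_eq_mul, Complex.norm_real, Real.norm_of_nonneg (Real.exp_pos _).le,
      Real.exp_neg, inv_mul_eq_div, div_lt_iff₀ (Real.exp_pos _)]
    refine (hb z.1 z.2).trans_lt ?_
    gcongr
    linarith
  have h2 := h1.image (⟨DSpace.ofStep ω d n, DSpace.continuous_ofStep n⟩ :
    StepSpace ω d n →L[ℂ] DSpace ω d)
  refine h2.subset ?_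
  rintro _ ⟨z, rfl⟩
  refine ⟨_, ⟨z, rfl⟩, (map_smul (DSpace.ofStep ω d n) _ _).trans ?_⟩
  rw [ofStep_toStep]

theorem continuous_stftLin (hω : IsWeightFunction ω) (χ : SSpace d) :
    Continuous (stftLin hω χ) := by
  refine continuous_of_continuousAt_zero (stftLin hω χ) ?_
  refine (CbSpace.withSeminorms.tendsto_nhds _ _).2 fun m ε hε => ?_
  filter_upwards [ContinuousLinearMap.eventually_nhds_zero_mapsTo
    (isVonNBounded_weighted_conjShift hω χ m) (Metric.ball_mem_nhds (0 : ℂ) (half_pos hε))]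
    with f hf
  rw [map_zero, sub_zero]
  refine lt_of_le_of_lt (CbSpace.seminorm_le_iff.2 fun z => ?_) (half_lt_self hε)
  have h := hf ⟨z, rfl⟩
  rw [mem_ball_zero_iff, map_smul, norm_smul, Complex.norm_real,
    Real.norm_of_nonneg (Real.exp_pos _).le, Real.exp_neg, inv_mul_eq_div,
    div_lt_iff₀ (Real.exp_pos _)] at h
  exact h.le

end STFT

/-! ### The space `C_{b,{ω}}` is a Fréchet space -/

section Frechet

variable {d : ℕ} {ω : ℝ → ℝ}

/-- The pointwise limit is continuous because ω is bounded on bounded sets, so each weighted norm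
controls locally uniform convergence. -/
theorem CbSpace.exists_tendsto (hω : IsWeightFunction ω) (u : ℕ → CbSpace ω d)
    (hu : ∀ (m : ℕ+) (ε : ℝ), 0 < ε → ∃ N, ∀ i ≥ N, ∀ j ≥ N,
      CbSpace.seminorm ω d m (u i - u j) ≤ ε) : ∃ F, Tendsto u atTop (𝓝 F) := by
  have hsub : ∀ i j z, (u i - u j) z = u i z - u j z := fun _ _ _ => rfl
  have hz : ∀ z, CauchySeq fun i => u i z := by
    intro z
    refine Metric.cauchySeq_iff.2 fun ε hε => ?_
    have hpos := Real.exp_pos (1 / ((1 : ℕ+) : ℝ) * ω ‖z.2‖)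
    obtain ⟨N, hN⟩ := hu 1 (ε / 2 / Real.exp (1 / ((1 : ℕ+) : ℝ) * ω ‖z.2‖)) (by positivity)
    refine ⟨N, fun i hi j hj => ?_⟩
    have := CbSpace.seminorm_le_iff.1 (hN i hi j hj) z
    rw [hsub, div_mul_cancel₀ _ hpos.ne'] at this
    rw [dist_eq_norm]
    linarith
  choose F hF using fun z => cauchySeq_tendsto_of_complete (hz z)
  have hconv : ∀ (m : ℕ+) (ε : ℝ), 0 < ε → ∃ N, ∀ i ≥ N, ∀ z,
      ‖u i z - F z‖ ≤ ε * Real.exp (1 / (m : ℝ) * ω ‖z.2‖) := by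
    intro m ε hε
    obtain ⟨N, hN⟩ := hu m ε hε
    refine ⟨N, fun i hi z => ?_⟩
    refine le_of_tendsto (tendsto_const_nhds.sub (hF z)).norm ?_
    filter_upwards [eventually_ge_atTop N] with j hj
    exact CbSpace.seminorm_le_iff.1 (hN i hi j hj) z
  have hloc : TendstoLocallyUniformly (fun i z => u i z) F atTop := by
    refine Metric.tendstoLocallyUniformly_iff.2 fun ε hε z₀ => ?_
    set K := Real.exp (1 / ((1 : ℕ+) : ℝ) * ω (‖z₀‖ + 1)) with hK
    obtain ⟨N, hN⟩ := hconv 1 (ε / 2 / K) (by positivity)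
    have hev : ∀ᶠ z in 𝓝 z₀, ‖z‖ < ‖z₀‖ + 1 :=
      continuous_norm.continuousAt.eventually_lt continuousAt_const (by linarith)
    refine ⟨_, hev, ?_⟩
    filter_upwards [eventually_ge_atTop N] with i hi z hz
    rw [dist_comm, dist_eq_norm]
    have h2 : ‖z.2‖ ≤ ‖z₀‖ + 1 := (norm_snd_le z).trans hz.le
    have h3 : ω ‖z.2‖ ≤ ω (‖z₀‖ + 1) :=
      hω.monotoneOn (norm_nonneg _) ((norm_nonneg _).trans h2) h2
    calc ‖u i z - F z‖ ≤ ε / 2 / K * Real.exp (1 / ((1 : ℕ+) : ℝ) * ω ‖z.2‖) := hN i hi z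
      _ ≤ ε / 2 / K * K := by rw [hK]; gcongr
      _ = ε / 2 := div_mul_cancel₀ _ (Real.exp_pos _).ne'
      _ < ε := half_lt_self hε
  have hFc : Continuous F := hloc.continuous (Frequently.of_forall fun i => (u i).2.1)
  have hFm : F ∈ cbSubmodule ω d := by
    refine ⟨hFc, fun m => ?_⟩
    obtain ⟨N, hN⟩ := hconv m 1 one_pos
    refine ⟨1 + CbSpace.seminorm ω d m (u N), ?_⟩
    rintro _ ⟨z, rfl⟩
    simp only
    rw [Real.exp_neg, ← div_eq_mul_inv, div_le_iff₀ (Real.exp_pos _), add_mul]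
    have h1 := hN N le_rfl z
    have h2 := (u N).norm_apply_le m z
    have h3 := norm_le_norm_add_norm_sub (u N z) (F z)
    linarith
  refine ⟨⟨F, hFm⟩, (CbSpace.withSeminorms.tendsto_nhds _ _).2 fun m ε hε => ?_⟩
  obtain ⟨N, hN⟩ := hconv m (ε / 2) (half_pos hε)
  filter_upwards [eventually_ge_atTop N] with i hi
  exact lt_of_le_of_lt (CbSpace.seminorm_le_iff.2 (hN i hi)) (half_lt_self hε)

/-- Countably many norms and completeness. Baire's theorem is needed for the uniform boundedness
argument in `continuous_adjointSTFT`. -/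
theorem CbSpace.baireSpace (hω : IsWeightFunction ω) : BaireSpace (CbSpace ω d) := by
  let _ : UniformSpace (CbSpace ω d) := IsTopologicalAddGroup.rightUniformSpace (CbSpace ω d)
  have : IsUniformAddGroup (CbSpace ω d) := isUniformAddGroup_of_addCommGroup
  have : FirstCountableTopology (CbSpace ω d) := CbSpace.withSeminorms.firstCountableTopology
  have : (uniformity (CbSpace ω d)).IsCountablyGenerated :=
    IsUniformAddGroup.uniformity_countably_generated
  have : CompleteSpace (CbSpace ω d) := by
    refine UniformSpace.complete_of_cauchySeq_tendsto fun u hu => ?_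
    refine CbSpace.exists_tendsto hω u fun m ε hε => ?_
    rw [cauchySeq_iff_tendsto, uniformity_eq_comap_nhds_zero, tendsto_comap_iff] at hu
    have h := (CbSpace.withSeminorms.tendsto_nhds _ _).1 hu m ε hε
    obtain ⟨N, hN⟩ := eventually_atTop_prod_self'.1 h
    refine ⟨N, fun i hi j hj => ?_⟩
    have := hN j hj i hi
    simp only [Function.comp_apply, Prod.map_apply, sub_zero] at this
    exact this.le
  infer_instance

end Frechet

/-! ### The transforms of test functions -/

section Pairing

variable {d : ℕ} {ω : ℝ → ℝ}

/-- The integral `∫ φ(t) M_ξ T_x γ(t) dt`, which equals `conj(V_γ(conj φ)(x, ξ))`. -/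
def pairing (φ γ : E d → ℂ) (z : E d × E d) : ℂ := ∫ t, φ t * atom γ z.1 z.2 t

/-- The conjugations in the definition of the adjoint cancel, leaving a pairing linear in `φ`. -/
theorem conj_stftFun_conj (φ γ : E d → ℂ) (z : E d × E d) :
    conj (stftFun γ (fun t => conj (φ t)) z) = pairing φ γ z := by
  rw [stftFun, innerL2, ← integral_conj, pairing]
  congr 1
  funext t
  rw [map_mul, Complex.conj_conj, Complex.conj_conj]
  rfl

theorem norm_atom (γ : E d → ℂ) (x ξ t : E d) : ‖atom γ x ξ t‖ = ‖γ (t - x)‖ := by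
  rw [atom, norm_mul, norm_wave, one_mul]

theorem continuous_atom {γ : E d → ℂ} (hγ : Continuous γ) (x ξ : E d) :
    Continuous (atom γ x ξ) :=
  (continuous_wave.comp (by fun_prop : Continuous fun t : E d => (ξ, t))).mul
    (hγ.comp (by fun_prop))

theorem integrable_mul_atom {φ γ : E d → ℂ} (hφ : Integrable φ) (hγ : Continuous γ) {M : ℝ}
    (hM : ∀ t, ‖γ t‖ ≤ M) (x ξ : E d) : Integrable fun t => φ t * atom γ x ξ t :=
  hφ.mul_bdd (continuous_atom hγ x ξ).aestronglyMeasurable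
    (Eventually.of_forall fun t => by rw [norm_atom]; exact hM _)

theorem continuous_pairing {φ γ : E d → ℂ} (hφ : Integrable φ) (hγ : Continuous γ) {M : ℝ}
    (hM : ∀ t, ‖γ t‖ ≤ M) : Continuous (pairing φ γ) := by
  refine continuous_of_dominated (bound := fun t => ‖φ t‖ * M)
    (fun z => (integrable_mul_atom hφ hγ hM z.1 z.2).aestronglyMeasurable)
    (fun z => Eventually.of_forall fun t => ?_) (hφ.norm.mul_const M)
    (Eventually.of_forall fun t => continuous_const.mul ?_)
  · rw [norm_mul, norm_atom]
    gcongr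
    exact hM _
  · exact (continuous_wave.comp (by fun_prop : Continuous fun z : E d × E d => (z.2, t))).mul
      (hγ.comp (by fun_prop : Continuous fun z : E d × E d => t - z.1))

/-- Tonelli and translation invariance; the wave has modulus one. The bound is uniform in `ξ`. -/
theorem lintegral_enorm_pairing_le {φ γ : E d → ℂ} (hφ : Continuous φ) (hγ : Continuous γ)
    (ξ : E d) : ∫⁻ x, ‖pairing φ γ (x, ξ)‖ₑ ≤ (∫⁻ t, ‖φ t‖ₑ) * ∫⁻ t, ‖γ t‖ₑ := by
  calc ∫⁻ x, ‖pairing φ γ (x, ξ)‖ₑ ≤ ∫⁻ x, ∫⁻ t, ‖φ t‖ₑ * ‖γ (t - x)‖ₑ := by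
        refine lintegral_mono fun x => (enorm_integral_le_lintegral_enorm _).trans (le_of_eq ?_)
        refine lintegral_congr fun t => ?_
        rw [enorm_mul, ← ofReal_norm, ← ofReal_norm, ← ofReal_norm, norm_atom]
    _ = ∫⁻ t, ∫⁻ x, ‖φ t‖ₑ * ‖γ (t - x)‖ₑ := by
        refine lintegral_lintegral_swap (Measurable.aemeasurable ?_)
        have h1 := hφ.measurable
        have h2 := hγ.measurable
        unfold Function.uncurry
        fun_prop
    _ = ∫⁻ t, ‖φ t‖ₑ * ∫⁻ s, ‖γ s‖ₑ := by
        refine lintegral_congr fun t => ?_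
        have h2 := hγ.measurable
        rw [lintegral_const_mul _ (by fun_prop),
          lintegral_sub_left_eq_self (fun s => ‖γ s‖ₑ) t]
    _ = _ := lintegral_mul_const _ (by fun_prop)

/-- Integration by parts: multiplication by 2πiξ_j is differentiation of the wave, and integrability
removes the boundary terms. -/
theorem mul_pairing {φ γ : E d → ℂ} (hφ : ContDiff ℝ (⊤ : ℕ∞) φ) (hγ : ContDiff ℝ (⊤ : ℕ∞) γ)
    (j : Fin d) (hi : Integrable φ) (hi' : Integrable (pderiv j φ)) {M M' : ℝ}
    (hM : ∀ t, ‖γ t‖ ≤ M) (hM' : ∀ t, ‖pderiv j γ t‖ ≤ M') (z : E d × E d) :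
    (2 * Real.pi * Complex.I * z.2 j : ℂ) * pairing φ γ z =
      -(pairing (pderiv j φ) γ z + pairing φ (pderiv j γ) z) := by
  have hγ' := contDiff_pderiv hγ j
  have ha := contDiff_atom hγ z.1 z.2
  have i1 := integrable_mul_atom hi hγ.continuous hM z.1 z.2
  have i2 := integrable_mul_atom hi' hγ.continuous hM z.1 z.2
  have i3 := integrable_mul_atom hi hγ'.continuous hM' z.1 z.2
  have hpd : ∀ t, φ t * pderiv j (atom γ z.1 z.2) t =
      (2 * Real.pi * Complex.I * z.2 j : ℂ) * (φ t * atom γ z.1 z.2 t) +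
        φ t * atom (pderiv j γ) z.1 z.2 t := by
    intro t
    rw [pderiv_atom hγ, Pi.add_apply, Pi.smul_apply, smul_eq_mul]
    ring
  have h := integral_mul_fderiv_eq_neg_fderiv_mul_of_integrable (μ := volume) (f := φ)
    (g := atom γ z.1 z.2) (v := EuclideanSpace.single j 1) i2
    (by
      change Integrable fun t => φ t * pderiv j (atom γ z.1 z.2) t
      simp only [hpd]
      exact (i1.const_mul _).add i3) i1
    (fun x _ => hφ.differentiable (by simp) x) (fun x _ => ha.differentiable (by simp) x)
  change ∫ t, φ t * pderiv j (atom γ z.1 z.2) t = -pairing (pderiv j φ) γ z at h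
  simp only [hpd] at h
  rw [integral_add (i1.const_mul _) i3, integral_const_mul] at h
  change _ * pairing φ γ z + pairing φ (pderiv j γ) z = _ at h
  linear_combination h

/-- Iteration of `mul_pairing`: each factor ξ_j yields two pairings with one more derivative, on `φ`
or on `γ`, hence 2^k. The bound `N` depends only on the total number of derivatives, so the
induction runs over all pairs of lists. -/
theorem pow_mul_lintegral_enorm_pairing_le {φ γ : E d → ℂ} (hφ : ContDiff ℝ (⊤ : ℕ∞) φ)
    (hγ : ContDiff ℝ (⊤ : ℕ∞) γ) (hi : ∀ l, Integrable (pdList l φ))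
    (hb : ∀ l, ∃ M, ∀ t, ‖pdList l γ t‖ ≤ M) {N : ℕ → ENNReal}
    (hN : ∀ l l' : List (Fin d), (∫⁻ t, ‖pdList l φ t‖ₑ) * (∫⁻ t, ‖pdList l' γ t‖ₑ) ≤
      N (l.length + l'.length)) (j : Fin d) (ξ : E d) (k : ℕ) : ∀ l l' : List (Fin d),
    ‖(2 * Real.pi * Complex.I * ξ j : ℂ)‖ₑ ^ k *
      ∫⁻ x, ‖pairing (pdList l φ) (pdList l' γ) (x, ξ)‖ₑ ≤
        2 ^ k * N (l.length + l'.length + k) := by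
  induction k with
  | zero =>
    intro l l'
    simpa using (lintegral_enorm_pairing_le (contDiff_pdList hφ l).continuous
      (contDiff_pdList hγ l').continuous ξ).trans (hN l l')
  | succ k ih =>
    intro l l'
    obtain ⟨M, hM⟩ := hb l'
    obtain ⟨M', hM'⟩ := hb (j :: l')
    set c := (2 * Real.pi * Complex.I * ξ j : ℂ) with hc
    have hcont : ∀ l l', Continuous fun x : E d => pairing (pdList l φ) (pdList l' γ) (x, ξ) := by
      intro l l'
      obtain ⟨M, hM⟩ := hb l'
      exact (continuous_pairing (hi l) (contDiff_pdList hγ l').continuous hM).comp (by fun_prop)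
    have hc1 := (hcont l l').measurable.enorm
    have hc2 := (hcont (j :: l) l').measurable.enorm
    have h1 : ‖c‖ₑ * ∫⁻ x, ‖pairing (pdList l φ) (pdList l' γ) (x, ξ)‖ₑ ≤
        (∫⁻ x, ‖pairing (pdList (j :: l) φ) (pdList l' γ) (x, ξ)‖ₑ) +
          ∫⁻ x, ‖pairing (pdList l φ) (pdList (j :: l') γ) (x, ξ)‖ₑ := by
      rw [← lintegral_const_mul _ hc1, ← lintegral_add_left hc2]
      refine lintegral_mono fun x => ?_
      rw [← enorm_mul, hc, mul_pairing (z := (x, ξ)) (contDiff_pdList hφ l) (contDiff_pdList hγ l')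
        j (hi l) (hi (j :: l)) hM hM', enorm_neg]
      exact enorm_add_le _ _
    have h2 := ih (j :: l) l'
    have h3 := ih l (j :: l')
    have e1 : (j :: l).length + l'.length + k = l.length + l'.length + (k + 1) := by simp; omega
    have e2 : l.length + (j :: l').length + k = l.length + l'.length + (k + 1) := by simp; omega
    rw [e1] at h2
    rw [e2] at h3
    calc _ = ‖c‖ₑ ^ k * (‖c‖ₑ * ∫⁻ x, ‖pairing (pdList l φ) (pdList l' γ) (x, ξ)‖ₑ) := by
          rw [pow_succ, mul_assoc]
      _ ≤ _ := mul_le_mul_right h1 _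
      _ ≤ 2 ^ k * N (l.length + l'.length + (k + 1)) +
          2 ^ k * N (l.length + l'.length + (k + 1)) := by
          rw [mul_add]
          exact add_le_add h2 h3
      _ = _ := by ring

theorem norm_le_sum_abs (ξ : E d) : ‖ξ‖ ≤ ∑ j, |ξ j| := by
  have : ξ = ∑ j, ξ j • (EuclideanSpace.single j (1 : ℝ) : E d) := by
    ext j
    simp [Finset.sum_apply, Pi.single_apply]
  conv_lhs => rw [this]
  refine (norm_sum_le _ _).trans (le_of_eq (Finset.sum_congr rfl fun j _ => ?_))
  simp [norm_smul]

/-- Powers of a single coordinate then control powers of |ξ|. The case `ξ = 0` is there for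
dimension zero, which has no coordinates. -/
theorem exists_norm_le_mul_abs (ξ : E d) : ξ = 0 ∨ ∃ j, ‖ξ‖ ≤ (d + 1) * |ξ j| := by
  by_contra! h
  obtain ⟨h0, h⟩ := h
  have h1 := norm_le_sum_abs ξ
  have h2 : (d + 1) * ∑ j, |ξ j| ≤ d * ‖ξ‖ := by
    rw [Finset.mul_sum]
    refine (Finset.sum_le_sum fun j _ => (h j).le).trans ?_
    simp
  have h3 : 0 < ‖ξ‖ := norm_pos_iff.2 h0
  nlinarith [d.cast_nonneg (α := ℝ)]

/-- An integrable majorant for the weighted decay of transforms. -/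
theorem IsWeightFunction.exists_decay (hω : IsWeightFunction ω) (n : ℕ+) (p : ℕ) {κ : ℝ}
    (hκ : 0 < κ) : ∃ (m : ℕ+) (C : ℝ), 0 ≤ C ∧ ∀ t, 0 ≤ t →
      (1 + κ * t) * Real.exp (-(ω (κ * t) / n)) * Real.exp (1 / (m : ℝ) * ω t) * (1 + t) ^ p
        ≤ C := by
  obtain ⟨L, hL, hLω⟩ := hω.exists_le_dilate (c := κ⁻¹) (by positivity)
  have hn : (0 : ℝ) < n := by exact_mod_cast n.pos
  have hL0 : (0 : ℝ) < L := by exact_mod_cast hL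
  -- The decay e^{-ω(s)/n}, with s = κt, is split in halves: one absorbs the p + 1 polynomial
  -- factors, the other absorbs e^{ω(t)/m}, for which m = 2nL suffices because ω(t) ≤ L(ω(s) + 1).
  obtain ⟨C, hC, h⟩ := hω.exists_pow_le_exp (p + 1) (ε := 1 / (2 * n)) (by positivity)
  refine ⟨2 * n * ⟨L, hL⟩, Real.exp (1 / (2 * n)) * C * (1 + κ⁻¹) ^ p, by positivity,
    fun t ht => ?_⟩
  obtain ⟨s, hs⟩ : ∃ s, s = κ * t := ⟨_, rfl⟩
  have hs0 : 0 ≤ s := by rw [hs]; positivity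
  have hts : t = κ⁻¹ * s := by rw [hs]; field_simp
  have hm : (((2 * n * ⟨L, hL⟩ : ℕ+) : ℕ) : ℝ) = 2 * n * L := by
    change ((2 * (n : ℕ) * L : ℕ) : ℝ) = _
    push_cast
    rfl
  rw [← hs, hm]
  have h1 : Real.exp (1 / (2 * n * L) * ω t) ≤
      Real.exp (1 / (2 * n)) * Real.exp (1 / (2 * n) * ω s) := by
    rw [← Real.exp_add]
    refine Real.exp_le_exp.2 ?_
    have := hLω s hs0
    rw [← hts] at this
    calc 1 / (2 * n * L) * ω t ≤ 1 / (2 * n * L) * (L * (ω s + 1)) := by gcongr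
      _ = _ := by field_simp; ring
  have h2 : (1 + t) ^ p ≤ (1 + κ⁻¹) ^ p * (1 + s) ^ p := by
    rw [← mul_pow]
    gcongr
    rw [hts]
    have : 0 ≤ κ⁻¹ := by positivity
    nlinarith
  have h3 := h s hs0
  have h4 : Real.exp (-(ω s / n)) * (Real.exp (1 / (2 * n) * ω s) * Real.exp (1 / (2 * n) * ω s))
      = 1 := by
    rw [← Real.exp_add, ← Real.exp_add, Real.exp_eq_one_iff]
    field_simp
    ring
  calc _ ≤ (1 + s) * Real.exp (-(ω s / n)) * (Real.exp (1 / (2 * n)) *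
        Real.exp (1 / (2 * n) * ω s)) * ((1 + κ⁻¹) ^ p * (1 + s) ^ p) := by gcongr
    _ = Real.exp (-(ω s / n)) * (Real.exp (1 / (2 * n)) *
        Real.exp (1 / (2 * n) * ω s)) * (1 + κ⁻¹) ^ p * (1 + s) ^ (p + 1) := by ring
    _ ≤ Real.exp (-(ω s / n)) * (Real.exp (1 / (2 * n)) *
        Real.exp (1 / (2 * n) * ω s)) * (1 + κ⁻¹) ^ p * (C * Real.exp (1 / (2 * n) * ω s)) := by
        gcongr
    _ = Real.exp (1 / (2 * n)) * C * (1 + κ⁻¹) ^ p * (Real.exp (-(ω s / n)) *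
        (Real.exp (1 / (2 * n) * ω s) * Real.exp (1 / (2 * n) * ω s))) := by ring
    _ = _ := by rw [h4, mul_one]

theorem integrable_pdList_step {n : ℕ+} (φ : StepSpace ω d n) (l : List (Fin d)) :
    Integrable (pdList l φ.1) := by
  rw [pdList_eq_mderiv φ.2.1]
  exact φ.2.2.1 _

theorem lintegral_enorm_pdList_step_le {n : ℕ+} (φ : StepSpace ω d n) (l : List (Fin d)) :
    ∫⁻ t, ‖pdList l φ.1 t‖ₑ ≤
      ENNReal.ofReal (StepSpace.seminorm ω d n φ * growth ω n l.length) := by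
  rw [← ofReal_integral_norm_eq_lintegral_enorm (integrable_pdList_step φ l),
    pdList_eq_mderiv φ.2.1]
  refine ENNReal.ofReal_le_ofReal ?_
  have := φ.integral_norm_mderiv_le fun i => l.count i
  rwa [sum_count] at this

theorem exists_norm_pdList_le (hω : IsWeightFunction ω) (γ : SSpace d) (l : List (Fin d)) :
    ∃ M, 0 ≤ M ∧ ∀ t, ‖pdList l γ t‖ ≤ M * expDecay t := by
  obtain ⟨C, hC, h⟩ := norm_pdList_window_le hω γ le_rfl
  refine ⟨C * growth ω 1 l.length, mul_nonneg hC (growth_pos _ _ _).le, fun t => ?_⟩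
  simpa using h 1 l t

theorem exists_norm_pdList_le_const (hω : IsWeightFunction ω) (γ : SSpace d)
    (l : List (Fin d)) : ∃ M, ∀ t, ‖pdList l γ t‖ ≤ M := by
  obtain ⟨M, hM, h⟩ := exists_norm_pdList_le hω γ l
  refine ⟨M, fun t => (h t).trans (mul_le_of_le_one_right hM ?_)⟩
  rw [expDecay, Real.exp_le_one_iff, neg_nonpos]
  positivity

theorem exists_lintegral_enorm_pdList_le (hω : IsWeightFunction ω) (γ : SSpace d) :
    ∃ Q, 0 ≤ Q ∧ ∀ (n : ℕ+) (l : List (Fin d)),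
      ∫⁻ t, ‖pdList l γ t‖ₑ ≤ ENNReal.ofReal (Q * growth ω n l.length) := by
  obtain ⟨C, hC, h⟩ := norm_pdList_window_le hω γ le_rfl
  have hI : 0 ≤ ∫ t : E d, expDecay t := integral_nonneg fun t => (expDecay_pos t).le
  refine ⟨C * ∫ t : E d, expDecay t, mul_nonneg hC hI, fun n l => ?_⟩
  have h1 : ∀ t, ‖pdList l γ t‖ₑ ≤ ENNReal.ofReal (C * growth ω n l.length * expDecay t) := by
    intro t
    rw [← ofReal_norm]
    exact ENNReal.ofReal_le_ofReal (by simpa using h n l t)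
  have h0 : 0 ≤ C * growth ω n l.length := mul_nonneg hC (growth_pos _ _ _).le
  refine (lintegral_mono h1).trans (le_of_eq ?_)
  rw [← ofReal_integral_eq_lintegral_ofReal (integrable_expDecay.const_mul _)
    (Eventually.of_forall fun t => mul_nonneg h0 (expDecay_pos t).le), integral_const_mul]
  congr 1
  ring

/-- The polynomial bounds obtained by integration by parts satisfy the hypothesis of
`IsWeightFunction.le_of_pow_mul_le_growth`, which turns them into decay in `ξ` of the mass over `x`.
-/
theorem lintegral_pairing_fiber_le (hω : IsWeightFunction ω) (γ : SSpace d) {Q : ℝ}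
    (hQ0 : 0 ≤ Q) {n : ℕ+}
    (hQ : ∀ l, ∫⁻ t, ‖pdList l γ t‖ₑ ≤ ENNReal.ofReal (Q * growth ω n l.length))
    (φ : StepSpace ω d n) (ξ : E d) {s : ℝ} (hs : s = Real.pi / (d + 1) * ‖ξ‖) :
    ∫⁻ x, ‖pairing φ.1 γ (x, ξ)‖ₑ ≤ ENNReal.ofReal
      (StepSpace.seminorm ω d n φ * Q * (1 + s) * Real.exp (-(ω s / n))) := by
  set B := StepSpace.seminorm ω d n φ * Q with hB
  have hsem : 0 ≤ StepSpace.seminorm ω d n φ := apply_nonneg _ _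
  have hB0 : 0 ≤ B := mul_nonneg hsem hQ0
  have hs0 : 0 ≤ s := by rw [hs]; positivity
  set J := ∫⁻ x, ‖pairing φ.1 γ (x, ξ)‖ₑ with hJ
  have hN : ∀ l l' : List (Fin d), (∫⁻ t, ‖pdList l φ.1 t‖ₑ) * (∫⁻ t, ‖pdList l' γ.1 t‖ₑ) ≤
      ENNReal.ofReal (B * growth ω n (l.length + l'.length)) := by
    intro l l'
    refine (mul_le_mul' (lintegral_enorm_pdList_step_le φ l) (hQ l')).trans ?_
    rw [← ENNReal.ofReal_mul (mul_nonneg hsem (growth_pos _ _ _).le)]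
    refine ENNReal.ofReal_le_ofReal ?_
    have := mul_le_mul_of_nonneg_left (hω.growth_mul_le n l.length l'.length) hB0
    rw [hB] at this ⊢
    linarith
  have key : ∀ (j : Fin d) (k : ℕ), ‖(2 * Real.pi * Complex.I * ξ j : ℂ)‖ₑ ^ k * J ≤
      2 ^ k * ENNReal.ofReal (B * growth ω n k) := by
    intro j k
    have := pow_mul_lintegral_enorm_pairing_le (N := fun k => ENNReal.ofReal (B * growth ω n k))
      φ.2.1 γ.2.1 (integrable_pdList_step φ) (exists_norm_pdList_le_const hω γ) hN j ξ k [] []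
    simpa [pdList] using this
  have hJ0 : J ≤ ENNReal.ofReal (B * growth ω n 0) :=
    (lintegral_enorm_pairing_le φ.2.1.continuous γ.2.1.continuous ξ).trans (hN [] [])
  have hJtop : J ≠ ⊤ := ne_top_of_le_ne_top ENNReal.ofReal_ne_top hJ0
  have hJr0 : J.toReal ≤ B * growth ω n 0 :=
    ENNReal.toReal_le_of_le_ofReal (mul_nonneg hB0 (growth_pos _ _ _).le) hJ0
  have hpow : ∀ k : ℕ, s ^ k * J.toReal ≤ B * growth ω n k := by
    intro k
    have hg := growth_pos ω n k
    -- For `ξ = 0` only k = 0 has content. Otherwise the 2 in 2π|ξ_j| cancels the 2^k of the product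
    -- rule, and `s` was chosen so that s ≤ π|ξ_j|.
    rcases exists_norm_le_mul_abs ξ with h0 | ⟨j, hj⟩
    · rcases Nat.eq_zero_or_pos k with rfl | hk
      · simpa using hJr0
      · rw [hs, h0, norm_zero, mul_zero, zero_pow hk.ne', zero_mul]
        positivity
    · have h1 := ENNReal.toReal_mono (by finiteness) (key j k)
      rw [ENNReal.toReal_mul, ENNReal.toReal_mul, ENNReal.toReal_pow, ENNReal.toReal_pow,
        ENNReal.toReal_ofReal (by positivity), toReal_enorm] at h1
      have h2 : ‖(2 * Real.pi * Complex.I * ξ j : ℂ)‖ = 2 * (Real.pi * |ξ j|) := by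
        simp only [norm_mul, Complex.norm_ofNat, Complex.norm_real, Complex.norm_I, mul_one,
          Real.norm_of_nonneg Real.pi_pos.le, Real.norm_eq_abs]
        ring
      rw [h2, mul_pow, mul_assoc] at h1
      have h3 : (Real.pi * |ξ j|) ^ k * J.toReal ≤ B * growth ω n k :=
        le_of_mul_le_mul_left (by simpa using h1) (show (0 : ℝ) < 2 ^ k by positivity)
      refine le_trans ?_ h3
      gcongr
      rw [hs, div_mul_eq_mul_div, div_le_iff₀ (by positivity), mul_assoc]
      have := mul_le_mul_of_nonneg_left hj Real.pi_pos.le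
      linarith
  rw [← ENNReal.ofReal_toReal hJtop]
  exact ENNReal.ofReal_le_ofReal (hω.le_of_pow_mul_le_growth n hs0 hB0 hpow)

theorem IsWeightFunction.continuous_comp_norm (hω : IsWeightFunction ω) :
    Continuous fun ξ : E d => ω ‖ξ‖ :=
  hω.continuousOn.comp_continuous continuous_norm fun ξ => norm_nonneg ξ

/-- The weighted integrability of the transforms of functions in the step spaces. -/
theorem exists_lintegral_pairing_le (hω : IsWeightFunction ω) (d : ℕ) (n : ℕ+) :
    ∃ m : ℕ+, ∀ γ : SSpace d, ∃ C, 0 ≤ C ∧ ∀ φ : StepSpace ω d n,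
      ∫⁻ z, ENNReal.ofReal (‖pairing φ.1 γ z‖ * Real.exp (1 / (m : ℝ) * ω ‖z.2‖)) ≤
        ENNReal.ofReal (C * StepSpace.seminorm ω d n φ) := by
  have hκ : 0 < Real.pi / (d + 1) := by positivity
  -- The power d + 1 leaves the integrable function (1 + |ξ|)^{-(d+1)} on ℝ^d.
  obtain ⟨m, C, hC, h⟩ := hω.exists_decay n (d + 1) hκ
  refine ⟨m, fun γ => ?_⟩
  obtain ⟨Q, hQ0, hQ⟩ := exists_lintegral_enorm_pdList_le hω γ
  have hint : Integrable fun ξ : E d => (1 + ‖ξ‖) ^ (-((d + 1 : ℕ) : ℝ)) :=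
    integrable_one_add_norm (by simp)
  have hI : 0 ≤ ∫ ξ : E d, (1 + ‖ξ‖) ^ (-((d + 1 : ℕ) : ℝ)) :=
    integral_nonneg fun ξ => by positivity
  refine ⟨Q * C * ∫ ξ : E d, (1 + ‖ξ‖) ^ (-((d + 1 : ℕ) : ℝ)), by positivity, fun φ => ?_⟩
  have hsem : 0 ≤ StepSpace.seminorm ω d n φ := apply_nonneg _ _
  obtain ⟨M, hM⟩ := exists_norm_pdList_le_const hω γ []
  have hpc : Continuous (pairing φ.1 γ.1) :=
    continuous_pairing (integrable_pdList_step φ []) γ.2.1.continuous hM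
  have hωc := hω.continuous_comp_norm (d := d)
  rw [Measure.volume_eq_prod, lintegral_prod_symm' _ (by
    have h1 : Continuous fun z : E d × E d => ω ‖z.2‖ := hωc.comp continuous_snd
    exact (hpc.norm.mul (Real.continuous_exp.comp
      (continuous_const.mul h1))).measurable.ennreal_ofReal)]
  calc _ ≤ ∫⁻ ξ : E d, ENNReal.ofReal (StepSpace.seminorm ω d n φ * Q * C *
        (1 + ‖ξ‖) ^ (-((d + 1 : ℕ) : ℝ))) := by
        refine lintegral_mono fun ξ => ?_
        have hm : Measurable fun x : E d => ‖pairing φ.1 γ.1 (x, ξ)‖ₑ :=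
          (hpc.comp (by fun_prop : Continuous fun x : E d => (x, ξ))).measurable.enorm
        simp only [ENNReal.ofReal_mul (norm_nonneg _), ofReal_norm]
        rw [lintegral_mul_const _ hm]
        refine (mul_le_mul_left (lintegral_pairing_fiber_le hω γ hQ0 (hQ n) φ ξ rfl) _).trans ?_
        rw [← ENNReal.ofReal_mul' (Real.exp_pos _).le]
        refine ENNReal.ofReal_le_ofReal ?_
        have h2 := h ‖ξ‖ (norm_nonneg ξ)
        have h3 : 0 < 1 + ‖ξ‖ := by positivity
        rw [Real.rpow_neg h3.le, Real.rpow_natCast, ← div_eq_mul_inv, le_div_iff₀ (by positivity)]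
        calc _ = StepSpace.seminorm ω d n φ * Q * ((1 + Real.pi / (d + 1) * ‖ξ‖) *
              Real.exp (-(ω (Real.pi / (d + 1) * ‖ξ‖) / n)) * Real.exp (1 / (m : ℝ) * ω ‖ξ‖) *
              (1 + ‖ξ‖) ^ (d + 1)) := by ring
          _ ≤ _ := by gcongr
    _ = _ := by
        rw [← ofReal_integral_eq_lintegral_ofReal (hint.const_mul _)
          (Eventually.of_forall fun ξ => by positivity), integral_const_mul]
        congr 1
        ring

end Pairing

/-! ### The adjoint short-time Fourier transform -/

section Adjoint

variable {d : ℕ} {ω : ℝ → ℝ}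

theorem continuous_pairing_step (hω : IsWeightFunction ω) {n : ℕ+} (φ : StepSpace ω d n)
    (γ : SSpace d) : Continuous (pairing φ.1 γ) := by
  obtain ⟨M, hM⟩ := exists_norm_pdList_le_const hω γ []
  exact continuous_pairing (integrable_pdList_step φ []) γ.2.1.continuous hM

theorem exists_integrable_weighted_pairing (hω : IsWeightFunction ω) (d : ℕ) (n : ℕ+) :
    ∃ m : ℕ+, ∀ γ : SSpace d, ∃ C, 0 ≤ C ∧ ∀ φ : StepSpace ω d n,
      Integrable (fun z => ‖pairing φ.1 γ z‖ * Real.exp (1 / (m : ℝ) * ω ‖z.2‖)) ∧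
      ∫ z, ‖pairing φ.1 γ z‖ * Real.exp (1 / (m : ℝ) * ω ‖z.2‖) ≤
        C * StepSpace.seminorm ω d n φ := by
  obtain ⟨m, h⟩ := exists_lintegral_pairing_le hω d n
  refine ⟨m, fun γ => ?_⟩
  obtain ⟨C, hC, hb⟩ := h γ
  refine ⟨C, hC, fun φ => ?_⟩
  have hc : Continuous fun z : E d × E d =>
      ‖pairing φ.1 γ z‖ * Real.exp (1 / (m : ℝ) * ω ‖z.2‖) := by
    have h1 := continuous_pairing_step hω φ γ
    have h2 := (hω.continuous_comp_norm (d := d)).comp (continuous_snd (X := E d) (Y := E d))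
    exact h1.norm.mul (Real.continuous_exp.comp (continuous_const.mul h2))
  have h0 : ∀ z : E d × E d, 0 ≤ ‖pairing φ.1 γ z‖ * Real.exp (1 / (m : ℝ) * ω ‖z.2‖) :=
    fun z => by positivity
  have hi : Integrable fun z : E d × E d =>
      ‖pairing φ.1 γ z‖ * Real.exp (1 / (m : ℝ) * ω ‖z.2‖) := by
    refine ⟨hc.aestronglyMeasurable, ?_⟩
    rw [hasFiniteIntegral_iff_ofReal (Eventually.of_forall h0)]
    exact (hb φ).trans_lt ENNReal.ofReal_lt_top
  refine ⟨hi, ?_⟩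
  have h1 := hb φ
  rw [← ofReal_integral_eq_lintegral_ofReal hi (Eventually.of_forall h0)] at h1
  exact (ENNReal.ofReal_le_ofReal_iff (mul_nonneg hC (apply_nonneg _ _))).1 h1

/-- One bilinear estimate serves twice: for fixed `F` it gives continuity in `φ` on a step, for
fixed `φ` continuity in `F`. The index `m` depends on the step only. -/
theorem exists_integrable_mul_pairing (hω : IsWeightFunction ω) (d : ℕ) (n : ℕ+) :
    ∃ m : ℕ+, ∀ γ : SSpace d, ∃ C, 0 ≤ C ∧ ∀ (φ : StepSpace ω d n) (F : CbSpace ω d),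
      Integrable (fun z => F z * pairing φ.1 γ z) ∧
      ‖∫ z, F z * pairing φ.1 γ z‖ ≤
        C * StepSpace.seminorm ω d n φ * CbSpace.seminorm ω d m F := by
  obtain ⟨m, h⟩ := exists_integrable_weighted_pairing hω d n
  refine ⟨m, fun γ => ?_⟩
  obtain ⟨C, hC, hb⟩ := h γ
  refine ⟨C, hC, fun φ F => ?_⟩
  obtain ⟨hi, hle⟩ := hb φ
  have hpt : ∀ z, ‖F z * pairing φ.1 γ z‖ ≤ CbSpace.seminorm ω d m F *
      (‖pairing φ.1 γ z‖ * Real.exp (1 / (m : ℝ) * ω ‖z.2‖)) := by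
    intro z
    rw [norm_mul]
    have := mul_le_mul_of_nonneg_right (F.norm_apply_le m z) (norm_nonneg (pairing φ.1 γ z))
    linarith
  have hi2 : Integrable (fun z => F z * pairing φ.1 γ z) :=
    (hi.const_mul _).mono' (F.2.1.mul (continuous_pairing_step hω φ γ)).aestronglyMeasurable
      (Eventually.of_forall hpt)
  refine ⟨hi2, (norm_integral_le_of_norm_le (hi.const_mul _) (Eventually.of_forall hpt)).trans ?_⟩
  rw [integral_const_mul, mul_comm]
  exact mul_le_mul_of_nonneg_right hle (apply_nonneg _ _)

theorem DSpace.exists_step (hω : IsWeightFunction ω) (φ : DSpace ω d) :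
    ∃ (n : ℕ+) (φ' : StepSpace ω d n), DSpace.ofStep ω d n φ' = φ := by
  obtain ⟨n, hn⟩ := (mem_unionSubmodule_iff hω φ.1).1 φ.2
  exact ⟨n, ⟨φ.1, hn⟩, rfl⟩

theorem DSpace.integrable (hω : IsWeightFunction ω) (φ : DSpace ω d) : Integrable φ.1 := by
  obtain ⟨n, φ, rfl⟩ := φ.exists_step hω
  exact integrable_pdList_step φ []

theorem DSpace.integrable_mul_pairing (hω : IsWeightFunction ω) (γ : SSpace d)
    (F : CbSpace ω d) (φ : DSpace ω d) : Integrable fun z => F z * pairing φ.1 γ z := by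
  obtain ⟨n, φ, rfl⟩ := φ.exists_step hω
  obtain ⟨m, h⟩ := exists_integrable_mul_pairing hω d n
  obtain ⟨C, -, h⟩ := h γ
  exact (h φ F).1

theorem pairing_add (hω : IsWeightFunction ω) {φ ψ : E d → ℂ} (γ : SSpace d) (hφ : Integrable φ)
    (hψ : Integrable ψ) (z : E d × E d) :
    pairing (φ + ψ) γ z = pairing φ γ z + pairing ψ γ z := by
  obtain ⟨M, hM⟩ := exists_norm_pdList_le_const hω γ []
  have h1 := integrable_mul_atom hφ γ.2.1.continuous hM z.1 z.2
  have h2 := integrable_mul_atom hψ γ.2.1.continuous hM z.1 z.2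
  rw [pairing, pairing, pairing, ← integral_add h1 h2]
  simp only [Pi.add_apply, add_mul]

theorem pairing_smul (c : ℂ) (φ γ : E d → ℂ) (z : E d × E d) :
    pairing (c • φ) γ z = c * pairing φ γ z := by
  rw [pairing, pairing, ← integral_const_mul]
  simp only [Pi.smul_apply, smul_eq_mul, mul_assoc]

/-- The functional `V*_γ F` on `D_{L¹,{ω}}(ℝ^d)`, as a linear map. -/
def adjointLin (hω : IsWeightFunction ω) (γ : SSpace d) (F : CbSpace ω d) :
    DSpace ω d →ₗ[ℂ] ℂ where
  toFun φ := ∫ z, F z * pairing φ.1 γ z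
  map_add' φ ψ := by
    rw [← integral_add (φ.integrable_mul_pairing hω γ F) (ψ.integrable_mul_pairing hω γ F)]
    refine integral_congr_ae (Eventually.of_forall fun z => ?_)
    change F z * pairing (φ.1 + ψ.1) γ z = _
    rw [pairing_add hω γ (φ.integrable hω) (ψ.integrable hω), mul_add]
  map_smul' c φ := by
    rw [RingHom.id_apply, smul_eq_mul, ← integral_const_mul]
    refine integral_congr_ae (Eventually.of_forall fun z => ?_)
    change F z * pairing (c • φ.1) γ z = _
    rw [pairing_smul, mul_left_comm]

theorem continuous_adjointLin (hω : IsWeightFunction ω) (γ : SSpace d) (F : CbSpace ω d) :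
    Continuous (adjointLin hω γ F) := by
  refine DSpace.continuous_of_step _ fun n => ?_
  obtain ⟨m, h⟩ := exists_integrable_mul_pairing hω d n
  obtain ⟨C, hC, h⟩ := h γ
  refine StepSpace.continuous_of_le ((adjointLin hω γ F).comp (DSpace.ofStep ω d n))
    (C := C * CbSpace.seminorm ω d m F) (mul_nonneg hC (apply_nonneg _ _)) fun φ => ?_
  exact (h φ F).2.trans (le_of_eq (by ring))

/-- The adjoint short-time Fourier transform `V*_γ` as a linear map. -/
def adjointSTFT (hω : IsWeightFunction ω) (γ : SSpace d) : CbSpace ω d →ₗ[ℂ] BDual ω d where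
  toFun F := ⟨adjointLin hω γ F, continuous_adjointLin hω γ F⟩
  map_add' F G := by
    ext φ
    change (∫ z, (F z + G z) * pairing φ.1 γ z) = (∫ z, F z * pairing φ.1 γ z) +
      ∫ z, G z * pairing φ.1 γ z
    rw [← integral_add (φ.integrable_mul_pairing hω γ F) (φ.integrable_mul_pairing hω γ G)]
    simp only [add_mul]
  map_smul' c F := by
    ext φ
    change (∫ z, (c * F z) * pairing φ.1 γ z) = c * ∫ z, F z * pairing φ.1 γ z
    rw [← integral_const_mul]
    simp only [mul_assoc]

theorem adjointSTFT_apply (hω : IsWeightFunction ω) (γ : SSpace d) (F : CbSpace ω d)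
    (φ : DSpace ω d) : adjointSTFT hω γ F φ = ∫ z, F z * pairing φ.1 γ z := rfl

/-- The evaluation `F ↦ ⟨V*_γ F, φ⟩` as a linear map. -/
def adjointEval (hω : IsWeightFunction ω) (γ : SSpace d) (φ : DSpace ω d) :
    CbSpace ω d →ₗ[ℂ] ℂ where
  toFun F := adjointSTFT hω γ F φ
  map_add' F G := by rw [map_add]; rfl
  map_smul' c F := by rw [map_smul]; rfl

theorem continuous_adjointSTFT_apply (hω : IsWeightFunction ω) (γ : SSpace d) (φ : DSpace ω d) :
    Continuous fun F => adjointSTFT hω γ F φ := by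
  obtain ⟨n, φ, rfl⟩ := φ.exists_step hω
  obtain ⟨m, h⟩ := exists_integrable_mul_pairing hω d n
  obtain ⟨C, hC, h⟩ := h γ
  change Continuous (adjointEval hω γ (DSpace.ofStep ω d n φ))
  have h0 : 0 ≤ C * StepSpace.seminorm ω d n φ := mul_nonneg hC (apply_nonneg _ _)
  refine WithSeminorms.continuous_of_isBounded CbSpace.withSeminorms
    (norm_withSeminorms ℂ ℂ) _ fun _ => ⟨{m}, ⟨_, h0⟩, fun F => ?_⟩
  rw [Finset.sup_singleton]
  exact (h φ F).2

/-- Banach–Steinhaus. A strong neighbourhood of zero asks for smallness uniformly over a bounded set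
of φ; the evaluations at these φ are continuous and pointwise bounded on a Baire space, so their
supremum is a continuous seminorm. -/
theorem continuous_adjointSTFT (hω : IsWeightFunction ω) (γ : SSpace d) :
    Continuous (adjointSTFT hω γ) := by
  have := CbSpace.baireSpace (d := d) hω
  refine continuous_of_continuousAt_zero (adjointSTFT hω γ) ?_
  rw [ContinuousAt, map_zero]
  refine ((ContinuousLinearMap.hasBasis_nhds_zero_of_basis
    (Metric.nhds_basis_ball (x := (0 : ℂ)))).tendsto_right_iff).2 ?_
  rintro ⟨S, ε⟩ ⟨hS, hε⟩
  let q : S → Seminorm ℂ (CbSpace ω d) := fun φ => (normSeminorm ℂ ℂ).comp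
    (adjointEval hω γ φ)
  have hq : ∀ φ, Continuous (q φ) := fun φ =>
    continuous_norm.comp (continuous_adjointSTFT_apply hω γ φ)
  have hbdd : BddAbove (range q) := by
    -- For a fixed `F`, the continuous functional V*F maps the bounded set `S` to a bounded set of
    -- scalars.
    refine Seminorm.bddAbove_range_iff.2 fun F => ?_
    have h1 := (NormedSpace.isVonNBounded_iff ℂ).1 (hS.image (adjointSTFT hω γ F))
    obtain ⟨R, hR⟩ := h1.exists_norm_le
    refine ⟨R, ?_⟩
    rintro _ ⟨φ, rfl⟩
    exact hR _ ⟨φ, φ.2, rfl⟩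
  have hc := Seminorm.continuous_iSup q hq hbdd
  rw [← Seminorm.coe_iSup_eq hbdd] at hc
  have hev : ∀ᶠ F in 𝓝 (0 : CbSpace ω d), (⨆ i, q i) F < ε := by
    refine hc.continuousAt.eventually_lt continuousAt_const ?_
    rw [map_zero]
    exact hε
  filter_upwards [hev] with F hF φ hφ
  rw [mem_ball_zero_iff]
  refine lt_of_le_of_lt ?_ hF
  rw [Seminorm.iSup_apply hbdd]
  exact le_ciSup (Seminorm.bddAbove_range_iff.1 hbdd F) ⟨φ, hφ⟩

theorem isAdjointSTFT_adjointSTFT (hω : IsWeightFunction ω) (γ : SSpace d) (F : CbSpace ω d) :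
    IsAdjointSTFT γ F (toSDual hω (adjointSTFT hω γ F)) := by
  intro φ
  have h : adjIntegrand γ F φ = fun z => F z * pairing φ.1 γ z := by
    funext z
    rw [adjIntegrand, conj_stftFun_conj]
  rw [h]
  have h1 := (sInclusion hω d φ).integrable_mul_pairing hω γ F
  rw [sInclusion_val] at h1
  refine ⟨h1, ?_⟩
  have h2 := adjointSTFT_apply hω γ F (sInclusion hω d φ)
  rwa [sInclusion_val] at h2

end Adjoint

/-! ### The weak reconstruction formula -/

section WeakReconstruction

open scoped FourierTransform

variable {d : ℕ} {ω : ℝ → ℝ}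

theorem pairing_neg_eq_fourier (φ γ : E d → ℂ) (x ξ : E d) :
    pairing φ γ (x, -ξ) = 𝓕 (fun t => φ t * γ (t - x)) ξ := by
  rw [pairing, Real.fourier_eq']
  congr 1
  funext t
  rw [atom, wave_eq, smul_eq_mul, inner_neg_left, real_inner_comm]
  simp only [mul_neg, neg_mul]
  ring

theorem pairing_eq_fourierInv (φ γ : E d → ℂ) (x ξ : E d) :
    pairing φ γ (x, ξ) = 𝓕⁻ (fun t => φ t * γ (t - x)) ξ := by
  rw [pairing, Real.fourierInv_eq']
  congr 1
  funext t
  rw [atom, wave_eq, smul_eq_mul, real_inner_comm]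
  ring

/-- The multiplication formula applied to `u` and 𝓕⁻v. Since v is a Schwartz function, 𝓕⁻v is
integrable and inversion holds; `u` need only be integrable. -/
theorem integral_fourier_mul_fourierInv {u v : E d → ℂ} (hu : Integrable u)
    (hv : ContDiff ℝ (⊤ : ℕ∞) v) (hvc : HasCompactSupport v) :
    ∫ ξ, 𝓕 u ξ * 𝓕⁻ v ξ = ∫ t, u t * v t := by
  let V : SchwartzMap (E d) ℂ := hvc.toSchwartzMap hv
  have hV : (V : E d → ℂ) = v := rfl
  have h1 : Integrable (𝓕⁻ v) := by
    rw [← hV, ← SchwartzMap.fourierInv_coe]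
    exact (𝓕⁻ V).integrable
  have h2 : 𝓕 (𝓕⁻ v) = v := by
    rw [← hV, ← SchwartzMap.fourierInv_coe, ← SchwartzMap.fourier_coe,
      FourierTransform.fourier_fourierInv_eq]
  have h3 : ∫ ξ, 𝓕 u ξ • 𝓕⁻ v ξ = ∫ t, u t • 𝓕 (𝓕⁻ v) t := by
    simpa using! VectorFourier.integral_fourierIntegral_smul_eq_flip (L := innerₗ (E d))
      Real.continuous_fourierChar continuous_inner hu h1
  rw [h2] at h3
  exact h3

/-- For fixed `x` the two pairings are Fourier transforms in ξ of φ·T_x γ and g·T_x η with opposite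
signs of the frequency, so Parseval applies. Compact support of `g` makes the second product a
Schwartz function. -/
theorem integral_pairing_mul_pairing {φ γ g η : E d → ℂ} (hφ : Integrable φ)
    (hγ : Continuous γ) {M : ℝ} (hM : ∀ t, ‖γ t‖ ≤ M) (hg : ContDiff ℝ (⊤ : ℕ∞) g)
    (hgc : HasCompactSupport g) (hη : ContDiff ℝ (⊤ : ℕ∞) η) (x : E d) :
    ∫ ξ, pairing φ γ (x, ξ) * pairing g η (x, -ξ) =
      ∫ t, φ t * g t * (γ (t - x) * η (t - x)) := by
  rw [← integral_neg_eq_self]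
  simp only [neg_neg]
  simp only [pairing_neg_eq_fourier φ γ, pairing_eq_fourierInv g η]
  rw [integral_fourier_mul_fourierInv]
  · congr 1
    funext t
    ring
  · exact hφ.mul_bdd (hγ.comp (by fun_prop)).aestronglyMeasurable
      (Eventually.of_forall fun t => hM _)
  · exact hg.mul (hη.comp (contDiff_id.sub contDiff_const))
  · exact hgc.mul_right

/-- The reconstruction formula tested against smooth functions of compact support. -/
theorem integral_pairing_mul_integral_mul_conjShift (hω : IsWeightFunction ω) {n : ℕ+}
    (φ : StepSpace ω d n) (χ γ : SSpace d) {g : E d → ℂ} (hg : ContDiff ℝ (⊤ : ℕ∞) g)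
    (hgc : HasCompactSupport g) :
    ∫ z, pairing φ.1 γ z * ∫ t, g t * conjShift χ z.1 z.2 t =
      innerL2 γ χ * ∫ t, g t * φ.1 t := by
  have hφ : Integrable φ.1 := integrable_pdList_step φ []
  have hgi : Integrable g := hg.continuous.integrable_of_hasCompactSupport hgc
  obtain ⟨M, hM⟩ := exists_norm_pdList_le_const hω γ []
  obtain ⟨M', hM'⟩ := exists_norm_pdList_le_const hω (conjS χ) []
  obtain ⟨M₁, hM₁0, hM₁⟩ := exists_norm_pdList_le hω γ []
  have hγi : Integrable (γ.1 : E d → ℂ) := 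
    integrable_pdList_step (toStep hω 1 γ) []
  have hη : ContDiff ℝ (⊤ : ℕ∞) (conjS χ).1 := (conjS χ).2.1
  have hin : ∀ z : E d × E d, ∫ t, g t * conjShift χ z.1 z.2 t =
      pairing g (conjS χ).1 (z.1, -z.2) := by
    intro z
    rw [conjShift_eq]
    rfl
  simp only [hin]
  have hpc : Continuous fun z : E d × E d => pairing g (conjS χ).1 (z.1, -z.2) :=
    (continuous_pairing hgi hη.continuous hM').comp (by fun_prop)
  have hpb : ∀ z : E d × E d, ‖pairing g (conjS χ).1 (z.1, -z.2)‖ ≤ ∫ t, ‖g t‖ * M' := by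
    intro z
    refine norm_integral_le_of_norm_le (hgi.norm.mul_const M') (Eventually.of_forall fun t => ?_)
    rw [norm_mul, norm_atom]
    gcongr
    exact hM' _
  have hpi : Integrable (pairing φ.1 γ.1) := by
    obtain ⟨m, h⟩ := exists_integrable_weighted_pairing hω d n
    obtain ⟨C, -, h⟩ := h γ
    refine (h φ).1.mono' (continuous_pairing_step hω φ γ).aestronglyMeasurable
      (Eventually.of_forall fun z => le_mul_of_one_le_right (norm_nonneg _) ?_)
    exact Real.one_le_exp (mul_nonneg (by positivity) (hω.nonneg (norm_nonneg _)))
  have hint : Integrable fun z : E d × E d =>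
      pairing φ.1 γ z * pairing g (conjS χ).1 (z.1, -z.2) :=
    hpi.mul_bdd hpc.aestronglyMeasurable (Eventually.of_forall hpb)
  rw [Measure.volume_eq_prod] at hint ⊢
  rw [integral_prod _ hint]
  simp only
  simp only [fun x => integral_pairing_mul_pairing hφ γ.2.1.continuous hM hg hgc hη x]
  have hk : Integrable fun t => φ.1 t * g t := by
    obtain ⟨K, hK⟩ := hg.continuous.bounded_above_of_compact_support hgc
    exact hφ.mul_bdd hg.continuous.aestronglyMeasurable (Eventually.of_forall hK)
  have hh : Integrable fun s => γ.1 (-s) * (conjS χ).1 (-s) := by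
    have : Integrable fun s => γ.1 s * (conjS χ).1 s :=
      hγi.mul_bdd hη.continuous.aestronglyMeasurable (Eventually.of_forall hM')
    exact this.comp_neg
  -- The double integrand in x and t is that of the convolution of φg with the reflection of γ·conj
  -- χ. Its joint integrability allows the x-integral to be done first, which produces (γ, χ).
  have hconv := hk.convolution_integrand (ContinuousLinearMap.mul ℂ ℂ) hh
  have hswap : Integrable (Function.uncurry fun x t : E d =>
      φ.1 t * g t * (γ.1 (t - x) * (conjS χ).1 (t - x))) (volume.prod volume) := by
    refine hconv.congr (Eventually.of_forall fun p => ?_)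
    simp only [ContinuousLinearMap.mul_apply', neg_sub, Function.uncurry]
  rw [integral_integral_swap hswap]
  have h1 : ∀ t : E d, ∫ x, φ.1 t * g t * (γ.1 (t - x) * (conjS χ).1 (t - x)) =
      innerL2 γ χ * (g t * φ.1 t) := by
    intro t
    rw [integral_const_mul, integral_sub_left_eq_self
      (fun s => γ.1 s * (conjS χ).1 s) volume t]
    change _ * innerL2 γ.1 χ.1 = _
    ring
  simp only [h1]
  rw [integral_const_mul]

/-- Derivatives can be moved to a test function of compact support. -/
theorem exists_integral_mul_pdList (l : List (Fin d)) : ∀ g : E d → ℂ,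
    ContDiff ℝ (⊤ : ℕ∞) g → HasCompactSupport g → ∃ g' : E d → ℂ, ContDiff ℝ (⊤ : ℕ∞) g' ∧
      HasCompactSupport g' ∧ ∀ ψ : E d → ℂ, ContDiff ℝ (⊤ : ℕ∞) ψ →
        ∫ t, g t * pdList l ψ t = ∫ t, g' t * ψ t := by
  induction l with
  | nil => exact fun g hg hgc => ⟨g, hg, hgc, fun ψ _ => rfl⟩
  | cons j l ih =>
    intro g hg hgc
    have hd : ContDiff ℝ (⊤ : ℕ∞) (pderiv j g) := contDiff_pderiv hg j
    have hdc : HasCompactSupport (pderiv j g) := hgc.fderiv_apply ℝ (EuclideanSpace.single j 1)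
    obtain ⟨g', h1, h2, h3⟩ := ih (fun t => -pderiv j g t) hd.neg hdc.neg
    refine ⟨g', h1, h2, fun ψ hψ => ?_⟩
    have hP := contDiff_pdList hψ l
    have hP' := contDiff_pderiv hP j
    have h := integral_mul_fderiv_eq_neg_fderiv_mul_of_integrable (μ := volume) (f := g)
      (g := pdList l ψ) (v := EuclideanSpace.single j 1)
      ((hd.continuous.mul hP.continuous).integrable_of_hasCompactSupport hdc.mul_right)
      ((hg.continuous.mul hP'.continuous).integrable_of_hasCompactSupport hgc.mul_right)
      ((hg.continuous.mul hP.continuous).integrable_of_hasCompactSupport hgc.mul_right)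
      (fun x _ => hg.differentiable (by simp) x) (fun x _ => hP.differentiable (by simp) x)
    rw [← h3 ψ hψ]
    refine h.trans ?_
    rw [← integral_neg]
    congr 1
    funext t
    exact (neg_mul _ _).symm

theorem integral_pairing_mul_integral_mul_mderiv (hω : IsWeightFunction ω) {n : ℕ+}
    (φ : StepSpace ω d n) (χ γ : SSpace d) (α : Fin d → ℕ) {g : E d → ℂ}
    (hg : ContDiff ℝ (⊤ : ℕ∞) g) (hgc : HasCompactSupport g) :
    ∫ z, pairing φ.1 γ z * ∫ t, g t * mderiv α (conjShift χ z.1 z.2) t =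
      innerL2 γ χ * ∫ t, g t * mderiv α φ.1 t := by
  obtain ⟨g', h1, h2, h3⟩ := exists_integral_mul_pdList (wordOf α) g hg hgc
  simp only [mderiv_eq]
  rw [h3 _ φ.2.1]
  simp only [fun z : E d × E d => h3 _ (conjShift χ z.1 z.2).2.1]
  exact integral_pairing_mul_integral_mul_conjShift hω φ χ γ h1 h2

end WeakReconstruction

/-! ### Embedding of the step spaces in a Banach space -/

section Embedding

open scoped BoundedContinuousFunction

variable {d : ℕ} {ω : ℝ → ℝ}

theorem StepSpace.mderiv_add {n : ℕ+} (φ ψ : StepSpace ω d n) (α : Fin d → ℕ) :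
    mderiv α (φ + ψ).1 = mderiv α φ.1 + mderiv α ψ.1 :=
  BoundedUltra.mderiv_add φ.2.1 ψ.2.1 α

theorem StepSpace.mderiv_smul {n : ℕ+} (c : ℂ) (φ : StepSpace ω d n) (α : Fin d → ℕ) :
    mderiv α (c • φ).1 = c • mderiv α φ.1 :=
  BoundedUltra.mderiv_smul φ.2.1 c α

/-- The weighted derivative `exp(-ψ*(n|α|)/n) φ^{(α)}` in `L¹`. -/
def weightedDeriv {n : ℕ+} (φ : StepSpace ω d n) (α : Fin d → ℕ) : E d →₁[volume] ℂ :=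
  ((expWeight ω n (∑ i, α i) : ℝ) : ℂ) • (φ.2.2.1 α).toL1 (mderiv α φ.1)

theorem norm_weightedDeriv {n : ℕ+} (φ : StepSpace ω d n) (α : Fin d → ℕ) :
    ‖weightedDeriv φ α‖ = (∫ t, ‖mderiv α φ.1 t‖) * expWeight ω n (∑ i, α i) := by
  rw [weightedDeriv, norm_smul, L1.norm_of_fun_eq_integral_norm, Complex.norm_real,
    Real.norm_of_nonneg (expWeight_nonneg _ _ _), mul_comm]

/-- The isometric embedding of `D_{L¹,ω,n}(ℝ^d)` in a Banach space by its weighted derivatives. -/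
def stepEmbed (ω : ℝ → ℝ) (d : ℕ) (n : ℕ+) :
    StepSpace ω d n →ₗ[ℂ] ((Fin d → ℕ) →ᵇ (E d →₁[volume] ℂ)) where
  toFun φ := BoundedContinuousFunction.ofNormedAddCommGroupDiscrete (weightedDeriv φ)
    (StepSpace.seminorm ω d n φ) fun α => by
      rw [norm_weightedDeriv, mul_expWeight_le_iff]
      exact φ.integral_norm_mderiv_le α
  map_add' φ ψ := by
    ext1 α
    change weightedDeriv (φ + ψ) α = weightedDeriv φ α + weightedDeriv ψ α
    rw [weightedDeriv, weightedDeriv, weightedDeriv, ← smul_add, ← Integrable.toL1_add]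
    congr 1
    exact (Integrable.toL1_eq_toL1_iff _ _ _ _).2 (by rw [StepSpace.mderiv_add])
  map_smul' c φ := by
    ext1 α
    change weightedDeriv (c • φ) α = c • weightedDeriv φ α
    have h : ((c • φ).2.2.1 α).toL1 (mderiv α (c • φ).1) =
        c • (φ.2.2.1 α).toL1 (mderiv α φ.1) := by
      rw [← Integrable.toL1_smul']
      exact (Integrable.toL1_eq_toL1_iff _ _ _ ((φ.2.2.1 α).smul c)).2
        (by rw [StepSpace.mderiv_smul])
    rw [weightedDeriv, weightedDeriv, smul_comm, h]

theorem stepEmbed_apply {n : ℕ+} (φ : StepSpace ω d n) (α : Fin d → ℕ) :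
    stepEmbed ω d n φ α = weightedDeriv φ α := rfl

theorem norm_stepEmbed_le {n : ℕ+} (φ : StepSpace ω d n) :
    ‖stepEmbed ω d n φ‖ ≤ StepSpace.seminorm ω d n φ := by
  refine (BoundedContinuousFunction.norm_le (apply_nonneg _ _)).2 fun α => ?_
  rw [stepEmbed_apply, norm_weightedDeriv, mul_expWeight_le_iff]
  exact φ.integral_norm_mderiv_le α

theorem seminorm_le_norm_stepEmbed {n : ℕ+} (φ : StepSpace ω d n) :
    StepSpace.seminorm ω d n φ ≤ ‖stepEmbed ω d n φ‖ := by
  refine StepSpace.seminorm_le_iff.2 fun α => ?_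
  rw [← mul_expWeight_le_iff, ← norm_weightedDeriv]
  exact (stepEmbed ω d n φ).norm_coe_le_norm α

theorem continuous_stepEmbed (n : ℕ+) : Continuous (stepEmbed ω d n) := by
  refine WithSeminorms.continuous_of_isBounded StepSpace.withSeminorms
    (norm_withSeminorms ℂ _) _ fun _ => ⟨{()}, 1, fun φ => ?_⟩
  rw [Finset.sup_singleton, one_smul]
  exact norm_stepEmbed_le φ

/-- A linear functional dominated by the norm of a linear map factors through this map by a
continuous linear functional. -/
theorem exists_clm_comp_eq {V X : Type*} [AddCommGroup V] [Module ℂ V] [NormedAddCommGroup X]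
    [NormedSpace ℂ X] (i : V →ₗ[ℂ] X) (g : V →ₗ[ℂ] ℂ) (A : ℝ) (h : ∀ v, ‖g v‖ ≤ A * ‖i v‖) :
    ∃ L : X →L[ℂ] ℂ, ∀ v, L (i v) = g v := by
  have hker : LinearMap.ker i ≤ LinearMap.ker g := fun v hv => by
    have := h v
    rw [LinearMap.mem_ker.1 hv, norm_zero, mul_zero] at this
    exact norm_le_zero_iff.1 this
  let g' : LinearMap.range i →ₗ[ℂ] ℂ :=
    ((LinearMap.ker i).liftQ g hker).comp i.quotKerEquivRange.symm.toLinearMap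
  have hg' : ∀ v, g' ⟨i v, v, rfl⟩ = g v := by
    intro v
    have h1 : i.quotKerEquivRange.symm ⟨i v, v, rfl⟩ = (LinearMap.ker i).mkQ v := by
      rw [LinearEquiv.symm_apply_eq]
      rfl
    change (LinearMap.ker i).liftQ g hker (i.quotKerEquivRange.symm ⟨i v, v, rfl⟩) = g v
    rw [h1]
    rfl
  -- The induced functional on the range is bounded by `A`, so Hahn–Banach extends it to the whole
  -- space.
  let G : StrongDual ℂ (LinearMap.range i) := g'.mkContinuous A (by
    rintro ⟨_, v, rfl⟩
    rw [hg']
    exact h v)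
  obtain ⟨L, hL, -⟩ := exists_extension_norm_eq (LinearMap.range i) G
  exact ⟨L, fun v => (hL ⟨i v, v, rfl⟩).trans (hg' v)⟩

/-- Integration of `L¹` functions against a bounded continuous function. -/
theorem exists_clm_integral_mul {g : E d → ℂ} (hg : Continuous g) {K : ℝ}
    (hK : ∀ t, ‖g t‖ ≤ K) :
    ∃ Λ : (E d →₁[volume] ℂ) →L[ℂ] ℂ, ∀ u, Λ u = ∫ t, g t * u t := by
  have hi : ∀ u : E d →₁[volume] ℂ, Integrable fun t => g t * u t := fun u =>
    (L1.integrable_coeFn u).bdd_mul hg.aestronglyMeasurable (Eventually.of_forall hK)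
  let Λ : (E d →₁[volume] ℂ) →ₗ[ℂ] ℂ :=
    { toFun := fun u => ∫ t, g t * u t
      map_add' := fun u v => by
        rw [← integral_add (hi u) (hi v)]
        refine integral_congr_ae ?_
        filter_upwards [Lp.coeFn_add u v] with t ht
        rw [ht, Pi.add_apply, mul_add]
      map_smul' := fun c u => by
        rw [RingHom.id_apply, smul_eq_mul, ← integral_const_mul]
        refine integral_congr_ae ?_
        filter_upwards [Lp.coeFn_smul c u] with t ht
        rw [ht, Pi.smul_apply, smul_eq_mul, mul_left_comm] }
  refine ⟨Λ.mkContinuous K fun u => ?_, fun u => rfl⟩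
  refine (norm_integral_le_of_norm_le ((L1.integrable_coeFn u).norm.const_mul K)
    (Eventually.of_forall fun t => ?_)).trans ?_
  · rw [norm_mul]
    gcongr
    exact hK t
  · rw [integral_const_mul, L1.norm_eq_integral_norm]

theorem L1.eq_of_integral_contDiff_mul_eq {u v : E d →₁[volume] ℂ}
    (h : ∀ g : E d → ℂ, ContDiff ℝ (⊤ : ℕ∞) g → HasCompactSupport g →
      ∫ t, g t * u t = ∫ t, g t * v t) : u = v := by
  refine Lp.ext ?_
  refine ae_eq_of_integral_contDiff_smul_eq (L1.integrable_coeFn u).locallyIntegrable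
    (L1.integrable_coeFn v).locallyIntegrable fun g hg hgc => ?_
  have := h (fun t => (g t : ℂ)) (Complex.ofRealCLM.contDiff.comp hg)
    (hgc.comp_left (g := fun r : ℝ => (r : ℂ)) Complex.ofReal_zero)
  simpa only [Complex.real_smul] using this

end Embedding

/-! ### The reconstruction formula -/

section Reconstruction

variable {d : ℕ} {ω : ℝ → ℝ}

theorem StepSpace.exists_val_eq_of_le (hω : IsWeightFunction ω) {n m : ℕ+} (h : n ≤ m)
    (φ : StepSpace ω d n) : ∃ φ' : StepSpace ω d m, φ'.1 = φ.1 :=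
  ⟨⟨φ.1, stepSubmodule_mono hω d h φ.2⟩, rfl⟩

theorem integral_mul_weightedDeriv {n : ℕ+} (φ : StepSpace ω d n) (α : Fin d → ℕ)
    (g : E d → ℂ) : ∫ t, g t * weightedDeriv φ α t =
      ((expWeight ω n (∑ i, α i) : ℝ) : ℂ) * ∫ t, g t * mderiv α φ.1 t := by
  rw [← integral_const_mul]
  refine integral_congr_ae ?_
  filter_upwards [Lp.coeFn_smul ((expWeight ω n (∑ i, α i) : ℝ) : ℂ)
    ((φ.2.2.1 α).toL1 (mderiv α φ.1)), (φ.2.2.1 α).coeFn_toL1] with t h1 h2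
  rw [weightedDeriv, h1, Pi.smul_apply, h2, smul_eq_mul]
  ring

/-- The reconstruction formula in the Banach space containing the step space. -/
theorem integral_pairing_smul_stepEmbed (hω : IsWeightFunction ω) {n : ℕ+}
    (φ : StepSpace ω d n) (χ γ : SSpace d)
    (hint : Integrable fun z : E d × E d =>
      pairing φ.1 γ z • stepEmbed ω d n (toStep hω n (conjShift χ z.1 z.2))) :
    ∫ z, pairing φ.1 γ z • stepEmbed ω d n (toStep hω n (conjShift χ z.1 z.2)) =
      innerL2 γ χ • stepEmbed ω d n φ := by
  ext1 α
  have hev := (BoundedContinuousFunction.evalCLM ℂ α).integral_comp_comm hint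
  have hintα := (BoundedContinuousFunction.evalCLM ℂ α).integrable_comp hint
  change _ = (BoundedContinuousFunction.evalCLM ℂ α) _ at hev
  change (BoundedContinuousFunction.evalCLM ℂ α) _ = _
  rw [← hev]
  -- Each α-component is an identity in L¹. Testing against `g` is a continuous functional, so it
  -- passes under the Bochner integral and leaves the weak formula with `α` derivatives.
  refine L1.eq_of_integral_contDiff_mul_eq fun g hg hgc => ?_
  obtain ⟨K, hK⟩ := hg.continuous.bounded_above_of_compact_support hgc
  obtain ⟨Λ, hΛ⟩ := exists_clm_integral_mul hg.continuous hK
  rw [← hΛ, ← Λ.integral_comp_comm hintα, ← hΛ]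
  have h1 : ∀ z : E d × E d, Λ ((BoundedContinuousFunction.evalCLM ℂ α)
      (pairing φ.1 γ z • stepEmbed ω d n (toStep hω n (conjShift χ z.1 z.2)))) =
      ((expWeight ω n (∑ i, α i) : ℝ) : ℂ) *
        (pairing φ.1 γ z * ∫ t, g t * mderiv α (conjShift χ z.1 z.2) t) := by
    intro z
    rw [map_smul, map_smul, smul_eq_mul, BoundedContinuousFunction.evalCLM_apply,
      stepEmbed_apply, hΛ, integral_mul_weightedDeriv, toStep_val]
    ring
  simp only [h1]
  rw [integral_const_mul, integral_pairing_mul_integral_mul_mderiv hω φ χ γ α hg hgc,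
    BoundedContinuousFunction.coe_smul, map_smul, smul_eq_mul, stepEmbed_apply, hΛ,
    integral_mul_weightedDeriv]
  ring

/-- The reconstruction formula. -/
theorem adjointSTFT_stftLin (hω : IsWeightFunction ω) (χ γ : SSpace d) (f : BDual ω d) :
    adjointSTFT hω γ (stftLin hω χ f) = innerL2 γ χ • f := by
  ext φ
  obtain ⟨n₀, φ, rfl⟩ := φ.exists_step hω
  obtain ⟨m, hm⟩ := exists_integrable_weighted_pairing hω d n₀
  obtain ⟨n₁, hn₁⟩ := exists_seminorm_conjShift_le (d := d) hω m
  obtain ⟨n₂, hn₂⟩ := exists_continuous_toStep_atomS (d := d) hω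
  -- One step must contain φ, bound the shifts by e^{ω(|ξ|)/m} with the `m` against which the
  -- transform of φ is integrable, and make the shifts continuous in (x, ξ).
  set n := max n₀ (max n₁ n₂) with hn
  obtain ⟨C, hC, hb⟩ := hn₁ n ((le_max_left _ _).trans (le_max_right _ _)) χ
  have hcont := hn₂ n ((le_max_right _ _).trans (le_max_right _ _)) (conjS χ)
  obtain ⟨φ', hφ'⟩ := StepSpace.exists_val_eq_of_le hω (le_max_left n₀ (max n₁ n₂)) φ
  have hφφ : DSpace.ofStep ω d n₀ φ = DSpace.ofStep ω d n φ' :=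
    Subtype.ext ((ofStep_val n₀ φ).trans (hφ'.symm.trans (ofStep_val n φ').symm))
  obtain ⟨_, _, hwi⟩ := hm γ
  have hwi := (hwi φ).1
  rw [← hφ'] at hwi
  rw [hφφ]
  obtain ⟨A, hA, hf⟩ := exists_norm_apply_ofStep_le f n
  -- On this step f is dominated by the norm of the embedding, so it is the restriction of a
  -- functional on the ambient Banach space, where the Bochner integral lives.
  obtain ⟨L, hL⟩ := exists_clm_comp_eq (stepEmbed ω d n)
    (f.toLinearMap.comp (DSpace.ofStep ω d n)) A fun ψ =>
      (hf ψ).trans (mul_le_mul_of_nonneg_left (seminorm_le_norm_stepEmbed ψ) hA)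
  have hc2 : Continuous fun z : E d × E d =>
      stepEmbed ω d n (toStep hω n (conjShift χ z.1 z.2)) := by
    simp only [conjShift_eq]
    exact ((continuous_stepEmbed n).comp hcont).comp
      (by fun_prop : Continuous fun z : E d × E d => (z.1, -z.2))
  have hint : Integrable fun z : E d × E d =>
      pairing φ'.1 γ z • stepEmbed ω d n (toStep hω n (conjShift χ z.1 z.2)) := by
    refine (hwi.const_mul C).mono'
      ((continuous_pairing_step hω φ' γ).smul hc2).aestronglyMeasurable
      (Eventually.of_forall fun z => ?_)
    rw [norm_smul]
    have := mul_le_mul_of_nonneg_left ((norm_stepEmbed_le _).trans (hb z.1 z.2))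
      (norm_nonneg (pairing φ'.1 γ z))
    linarith
  have hrec := congrArg L (integral_pairing_smul_stepEmbed hω φ' χ γ hint)
  rw [← L.integral_comp_comm hint] at hrec
  have hpt : ∀ z : E d × E d,
      L (pairing φ'.1 γ z • stepEmbed ω d n (toStep hω n (conjShift χ z.1 z.2))) =
        stftLin hω χ f z * pairing (DSpace.ofStep ω d n φ').1 γ z := by
    intro z
    rw [map_smul, hL, smul_eq_mul, mul_comm, ofStep_val, LinearMap.comp_apply, ofStep_toStep]
    rfl
  simp only [hpt] at hrec
  rw [adjointSTFT_apply, hrec, map_smul, hL]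
  rfl

end Reconstruction

/-! ### The Gaussian as a test function -/

section Gaussian

variable {d : ℕ} {ω : ℝ → ℝ}

/-- The restriction to the real line of the `k`-th derivative of `exp(-z²)`. -/
def gaussDeriv (k : ℕ) (x : ℝ) : ℂ := iteratedDeriv k (fun z : ℂ => Complex.exp (-z ^ 2)) x

theorem hasDerivAt_gaussDeriv (k : ℕ) (x : ℝ) :
    HasDerivAt (gaussDeriv k) (gaussDeriv (k + 1) x) x := by
  have hc : ContDiff ℂ (⊤ : ℕ∞) fun z : ℂ => Complex.exp (-z ^ 2) := by fun_prop
  have hd : Differentiable ℂ (iteratedDeriv k fun z : ℂ => Complex.exp (-z ^ 2)) :=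
    hc.differentiable_iteratedDeriv k (by exact_mod_cast WithTop.coe_lt_top _)
  have h := (hd x).hasDerivAt.comp_ofReal
  rw [← iteratedDeriv_succ] at h
  exact h

/-- Cauchy's estimate on circles of one fixed radius around x. On such a circle the entire function
exp(-z²) is still at most exp(-x² + O(|x|)), which beats e^{N|x|}. -/
theorem exists_norm_gaussDeriv_le (N : ℕ) : ∃ C, 0 ≤ C ∧ ∀ (k : ℕ) (x : ℝ),
    (N : ℝ) ^ k * ‖gaussDeriv k x‖ * Real.exp (N * |x|) ≤ C * k.factorial := by
  -- The radius must be at least `N`, so that R^{-k} absorbs N^k, and positive also when `N = 0`.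
  set R : ℝ := N + 1 with hR
  have hR0 : 0 < R := by positivity
  refine ⟨Real.exp (R ^ 2 + (2 * R + N) ^ 2), (Real.exp_pos _).le, fun k x => ?_⟩
  have hs : ∀ z ∈ Metric.sphere (x : ℂ) R, ‖Complex.exp (-z ^ 2)‖ ≤
      Real.exp (-x ^ 2 + 2 * R * |x| + R ^ 2) := by
    intro z hz
    obtain ⟨w, rfl⟩ : ∃ w, z = x + w := ⟨z - x, by ring⟩
    rw [mem_sphere_iff_norm, add_sub_cancel_left] at hz
    rw [Complex.norm_exp]
    refine Real.exp_le_exp.2 ?_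
    have h1 : (-((x : ℂ) + w) ^ 2).re = -((x + w.re) ^ 2 - w.im ^ 2) := by
      simp [pow_two]
    have h2 : |w.re| ≤ R := (Complex.abs_re_le_norm w).trans hz.le
    have h3 : |w.im| ≤ R := (Complex.abs_im_le_norm w).trans hz.le
    have h4 : w.im ^ 2 ≤ R ^ 2 := sq_le_sq' (abs_le.1 h3).1 (abs_le.1 h3).2
    have h5 : |x * w.re| ≤ |x| * R := by
      rw [abs_mul]
      gcongr
    have h6 := neg_abs_le (x * w.re)
    rw [h1]
    nlinarith [sq_nonneg w.re]
  have hd : Differentiable ℂ fun z : ℂ => Complex.exp (-z ^ 2) := by fun_prop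
  have hC := Complex.norm_iteratedDeriv_le_of_forall_mem_sphere_norm_le k hR0
    hd.diffContOnCl hs
  have hNR : (N : ℝ) ≤ R := by rw [hR]; linarith
  calc (N : ℝ) ^ k * ‖gaussDeriv k x‖ * Real.exp (N * |x|)
      ≤ R ^ k * (k.factorial * Real.exp (-x ^ 2 + 2 * R * |x| + R ^ 2) / R ^ k) *
        Real.exp (N * |x|) := by
        gcongr
        exact hC
    _ = k.factorial * Real.exp (-x ^ 2 + 2 * R * |x| + R ^ 2 + N * |x|) := by
        rw [Real.exp_add _ (N * |x|)]
        field_simp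
    _ ≤ k.factorial * Real.exp (R ^ 2 + (2 * R + N) ^ 2) := by
        refine mul_le_mul_of_nonneg_left (Real.exp_le_exp.2 ?_) (by positivity)
        rw [← sq_abs x]
        nlinarith [sq_nonneg (|x| - (2 * R + N)), sq_nonneg |x|, sq_nonneg (2 * R + N)]
    _ = _ := mul_comm _ _

/-- The Gaussian on `ℝ^d` as a product. -/
def gauss (d : ℕ) : E d → ℂ := fun x => ∏ j, gaussDeriv 0 (x j)

theorem pderiv_prod_gaussDeriv (c : Fin d → ℕ) (i : Fin d) (x : E d) :
    pderiv i (fun x => ∏ j, gaussDeriv (c j) (x j)) x =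
      ∏ j, gaussDeriv (if j = i then c j + 1 else c j) (x j) := by
  have h1 : ∀ j : Fin d, HasFDerivAt (fun x : E d => gaussDeriv (c j) (x j))
      ((ContinuousLinearMap.toSpanSingleton ℝ (gaussDeriv (c j + 1) (x j))).comp
        (EuclideanSpace.proj j)) x := fun j =>
    HasFDerivAt.comp (g := gaussDeriv (c j)) x (hasDerivAt_gaussDeriv (c j) (x j)).hasFDerivAt
      (EuclideanSpace.proj (𝕜 := ℝ) j).hasFDerivAt
  have h2 := HasFDerivAt.finsetProd (u := Finset.univ) fun j _ => h1 j
  rw [pderiv, h2.fderiv]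
  have h3 : ∀ j : Fin d, EuclideanSpace.proj (𝕜 := ℝ) j (EuclideanSpace.single i (1 : ℝ)) =
      if j = i then 1 else 0 := fun j => by simp
  simp only [sum_apply, smul_apply, ContinuousLinearMap.comp_apply,
    ContinuousLinearMap.toSpanSingleton_apply, h3]
  rw [Finset.sum_eq_single i (fun j _ hj => by simp [hj]) (by simp),
    ← Finset.mul_prod_erase _ _ (Finset.mem_univ i)]
  simp only [if_true, one_smul, smul_eq_mul]
  rw [mul_comm]
  congr 1
  refine Finset.prod_congr rfl fun j hj => ?_
  rw [if_neg (Finset.ne_of_mem_erase hj)]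

theorem pdList_gauss (l : List (Fin d)) :
    pdList l (gauss d) = fun x => ∏ j, gaussDeriv (l.count j) (x j) := by
  induction l with
  | nil => rfl
  | cons i l ih =>
    change pderiv i (pdList l (gauss d)) = _
    rw [ih]
    funext x
    rw [pderiv_prod_gaussDeriv]
    refine Finset.prod_congr rfl fun j _ => ?_
    rw [List.count_cons]
    by_cases h : j = i
    · simp [h]
    · simp [h, Ne.symm h]

theorem contDiff_gauss : ContDiff ℝ (⊤ : ℕ∞) (gauss d) := by
  unfold gauss
  refine contDiff_prod fun j _ => ?_
  simp only [gaussDeriv, iteratedDeriv_zero]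
  refine Complex.contDiff_exp.comp (ContDiff.neg (ContDiff.pow ?_ 2))
  exact Complex.ofRealCLM.contDiff.comp (EuclideanSpace.proj (𝕜 := ℝ) j).contDiff

/-- The one-dimensional bounds are multiplied over the coordinates, with |x| ≤ Σ|x_j| for the
exponential and ∏ α_j! ≤ |α|! for the factorials. -/
theorem gauss_mem : gauss d ∈ sSubmodule d := by
  refine ⟨contDiff_gauss, fun n => ?_⟩
  obtain ⟨C, hC, h⟩ := exists_norm_gaussDeriv_le n
  refine ⟨C ^ d, ?_⟩
  rintro _ ⟨⟨α, x⟩, rfl⟩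
  simp only
  rw [div_le_iff₀ (by positivity), mderiv_eq, pdList_gauss]
  simp only [count_wordOf]
  have h1 : Real.exp (n * ‖x‖) ≤ ∏ j, Real.exp (n * |x j|) := by
    rw [← Real.exp_sum, ← Finset.mul_sum]
    gcongr
    exact norm_le_sum_abs x
  have h2 : ∏ j, ((α j).factorial : ℝ) ≤ (∑ j, α j).factorial := by
    exact_mod_cast Nat.le_of_dvd (Nat.factorial_pos _)
      (Nat.prod_factorial_dvd_factorial_sum Finset.univ α)
  rw [norm_prod, ← Finset.prod_pow_eq_pow_sum]
  calc _ ≤ (∏ j, (n : ℝ) ^ α j) * (∏ j, ‖gaussDeriv (α j) (x j)‖) *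
        ∏ j, Real.exp (n * |x j|) := by gcongr
    _ = ∏ j, ((n : ℝ) ^ α j * ‖gaussDeriv (α j) (x j)‖ * Real.exp (n * |x j|)) := by
        rw [Finset.prod_mul_distrib, Finset.prod_mul_distrib]
    _ ≤ ∏ j, (C * (α j).factorial) :=
        Finset.prod_le_prod (fun j _ => by positivity) fun j _ => h (α j) (x j)
    _ = C ^ d * ∏ j, ((α j).factorial : ℝ) := by
        rw [Finset.prod_mul_distrib, Finset.prod_const, Finset.card_univ, Fintype.card_fin]
    _ ≤ _ := by gcongr

/-- The Gaussian as an element of `S^{(1)}_{(1)}(ℝ^d)`. -/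
def gaussS (d : ℕ) : SSpace d := ⟨gauss d, gauss_mem⟩

theorem innerL2_gaussS_ne_zero (hω : IsWeightFunction ω) (d : ℕ) :
    innerL2 (gaussS d) (gaussS d) ≠ 0 := by
  have h0 : ∀ x, gauss d x ≠ 0 := fun x => Finset.prod_ne_zero_iff.2 fun j _ => by
    simp only [gaussDeriv, iteratedDeriv_zero]
    exact Complex.exp_ne_zero _
  have h1 : innerL2 (gaussS d) (gaussS d) = ((∫ x, ‖gauss d x‖ * ‖gauss d x‖ : ℝ) : ℂ) := by
    rw [innerL2, ← integral_complex_ofReal]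
    congr 1
    funext x
    rw [Complex.ofReal_mul, ← pow_two]
    exact Complex.mul_conj' _
  have hi : Integrable (gauss d) := integrable_pdList_step (toStep hω 1 (gaussS d)) []
  obtain ⟨M, hM⟩ := exists_norm_pdList_le_const hω (gaussS d) []
  have hi2 : Integrable fun x => ‖gauss d x‖ * ‖gauss d x‖ :=
    hi.norm.mul_bdd contDiff_gauss.continuous.norm.aestronglyMeasurable
      (Eventually.of_forall fun x => (norm_norm _).trans_le (hM x))
  have hpos : 0 < ∫ x, ‖gauss d x‖ * ‖gauss d x‖ := by
    rw [integral_pos_iff_support_of_nonneg (fun x => by positivity) hi2]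
    have : Function.support (fun x => ‖gauss d x‖ * ‖gauss d x‖) = univ :=
      eq_univ_of_forall fun x => mul_ne_zero (norm_ne_zero_iff.2 (h0 x)) (norm_ne_zero_iff.2 (h0 x))
    rw [this]
    exact isOpen_univ.measure_pos _ univ_nonempty
  rw [h1]
  exact_mod_cast hpos.ne'

/-- A functional in `B'_{{ω}}(ℝ^d)` is determined by its restriction to test functions. -/
theorem BDual.ext_of_toSDual_eq (hω : IsWeightFunction ω) {f g : BDual ω d}
    (h : ∀ φ, toSDual hω f φ = toSDual hω g φ) : f = g := by
  -- The transform evaluates functionals only at shifts of a test function, so it is determined by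
  -- the restriction; reconstruction then recovers the functional, (γ, χ) being nonzero for χ = γ
  -- Gaussian.
  have h1 : stftLin hω (gaussS d) f = stftLin hω (gaussS d) g :=
    Subtype.ext (funext fun z => h _)
  have h2 := congrArg (adjointSTFT hω (gaussS d)) h1
  rw [adjointSTFT_stftLin, adjointSTFT_stftLin] at h2
  exact smul_right_injective _ (innerL2_gaussS_ne_zero hω d) h2

end Gaussian

end BoundedUltra

end

/-! ### The proposition -/

theorem mainTheorem5 (d : ℕ) (ω : ℝ → ℝ) (hω : IsWeightFunction ω) :
    ∃ (V : SSpace d → BDual ω d →L[ℂ] CbSpace ω d)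
      (Vadj : SSpace d → CbSpace ω d →L[ℂ] BDual ω d),
      (∀ (χ : SSpace d) (f : BDual ω d) (z : E d × E d),
        V χ f z = stft χ (toSDual hω f) z) ∧
      (∀ (χ : SSpace d) (F : CbSpace ω d) (f : BDual ω d),
        IsAdjointSTFT χ F (toSDual hω f) ↔ f = Vadj χ F) ∧
      ∀ χ γ : SSpace d, innerL2 γ χ ≠ 0 → ∀ f : BDual ω d,
        (innerL2 γ χ)⁻¹ • Vadj γ (V χ f) = f := by
  refine ⟨fun χ => ⟨stftLin hω χ, continuous_stftLin hω χ⟩,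
    fun γ => ⟨adjointSTFT hω γ, continuous_adjointSTFT hω γ⟩, fun χ f z => rfl,
    fun χ F f => ⟨fun h => ?_, ?_⟩, fun χ γ h f => ?_⟩
  -- Uniqueness: the defining identity fixes `f` on test functions, which determines it.
  · exact BDual.ext_of_toSDual_eq hω fun φ =>
      (h φ).2.trans (isAdjointSTFT_adjointSTFT hω χ F φ).2.symm
  · rintro rfl
    exact isAdjointSTFT_adjointSTFT hω χ F
  · change (innerL2 γ χ)⁻¹ • adjointSTFT hω γ (stftLin hω χ f) = f
    rw [adjointSTFT_stftLin, smul_smul, inv_mul_cancel₀ h, one_smul]
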